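/- Let $\mathbb T^2=[0,2\pi]^2$ with periodic boundary conditions, let $\mathfrak H_n=L^2_{\rm sym}((\mathbb T^2)^n)$ (with $\mathfrak H_0=\mathbb C$) and let $\mathfrak F=\bigoplus_{n\ge 0}\mathfrak H_n$ be the bosonic Fock space, with number operator $\mathcal N$. For $k\in\mathbb Z^2$ put $e_k(x)=(2\pi)^{-1}e^{ik\cdot x}$ and $a_k=a(e_k)$, where $(a(f)\psi)(x_1,\dots,x_{n-1})=\sqrt n\int\overline{f(x)}\,\psi(x_1,\dots,x_{n-1},x)\,dx$. Fix $\tfrac32<\beta\le 2$ and $\lambda>0$. Let $\widehat v_\beta(k)=(1+|k|^2)^{-\beta/2}$, let $v_\beta(x)=(2\pi)^{-2}\sum_{k}\widehat v_\beta(k)e^{ik\cdot x}$ (convergent in $L^2(\mathbb T^2)$) be the kernel of $(1-\Delta)^{-\beta/2}$, let $h=-\Delta+1$, and let $N_0=\sum_{k\in\mathbb Z^2}(e^{\lambda(|k|^2+1)}-1)^{-1}$ be the mean particle number of the free Gibbs state $Z_0^{-1}e^{-\lambda\,d\Gamma(h)}$. The formal renormalized Hamiltonian is $\lambda\, d\Gamma(h)+W^{\rm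 re}$, where $d\Gamma(h)=\sum_k(|k|^2+1)a_k^*a_k$ and $$W^{\rm re}=\frac{\lambda^2}{2(2\pi)^2}\sum_{k\ne0}\widehat v_\beta(k)\sum_{p,q\in\mathbb Z^2}a^*_{p+k}a^*_{q-k}a_qa_p+\frac{\lambda^2}{2(2\pi)^2}(\mathcal N-N_0)^2 .$$ Let $c_\lambda=\frac{\lambda^2}{2(2\pi)^2}(1-2N_0)$ and $C_\lambda=\frac{\lambda^2}{2(2\pi)^2}N_0^2$. On $\mathfrak H_n$ consider the quadratic form $$q_{n}[\Psi]=\lambda\sum_{j=1}^n\|\nabla_j\Psi\|^2+\big((\lambda+c_\lambda)n+C_\lambda\big)\|\Psi\|^2+\lambda^2\sum_{1\le i<j\le n}\int v_\beta(x_i-x_j)|\Psi|^2\,dX$$ with form domain $Q_n=\{\Psi\in H^1_{\rm sym}((\mathbb T^2)^n):\int v_\beta(x_i-x_j)|\Psi|^2\,dX<\infty\ \text{for all } i<j\}$. Then: 1. For every $n\ge0$ the operator $\mathbb H_n$ on $\mathfrak H_n$ associated with $q_n$ is a well-defined self-adjoint operator; here $\Psi\in\mathrm{dom}\,\mathbb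 H_n$ with $\mathbb H_n\Psi=\chi$ if and only if $\Psi\in Q_n$ and $q_n(\Phi,\Psi)=\langle\Phi,\chi\rangle$ for all $\Phi\in Q_n$. 2. The direct sum $\mathbb H=\bigoplus_{n\ge0}\mathbb H_n$ is a self-adjoint operator on $\mathfrak F$. It realizes $\lambda\, d\Gamma(h)+W^{\rm re}$: every vector $\Psi$ with finitely many particles and finitely many momenta lies in $\mathrm{dom}\,\mathbb H$, and for every other such vector $\Phi$ the number $\langle\Phi,\mathbb H\Psi\rangle$ equals the matrix element of $\lambda\, d\Gamma(h)+W^{\rm re}$ computed from the displayed formulas, with the creation operators moved to $\Phi$ as annihilation operators. 3. $\mathbb H$ is bounded from below. 4. $e^{-\mathbb H}$ is trace class and $Z=\mathrm{Tr}\,e^{-\mathbb H}$ satisfies $0<Z<\infty$. Hence the grand-canonical Gibbs state $Z^{-1}e^{-\mathbb H}$ is well defined, i.e. it is a positive trace-class operator of trace one. -/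

import Mathlib

open MeasureTheory Filter Topology
open scoped ComplexConjugate ENNReal

noncomputable section

namespace BesselGas

/-! ### The torus, plane waves and the periodic fractional Bessel potential -/

instance twoPiPos : Fact ((0 : ℝ) < 2 * Real.pi) := ⟨Real.two_pi_pos⟩

/-- The torus `[0, 2π]²` with periodic boundary conditions, carrying Lebesgue measure of total
mass `(2π)²`. -/
abbrev Torus : Type := Fin 2 → AddCircle (2 * Real.pi)

/-- Momenta `k ∈ ℤ²`. -/
abbrev Mom : Type := Fin 2 → ℤ

/-- `|k|²`. -/
def normSq (k : Mom) : ℝ := ∑ a, (k a : ℝ) ^ 2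

/-- The normalized plane wave `e_k(x) = (2π)⁻¹ exp(i k·x)`. -/
def mode (k : Mom) : C(Torus, ℂ) :=
  ⟨fun x => ((2 * Real.pi : ℝ) : ℂ)⁻¹ * ∏ a, fourier (k a) (x a), by fun_prop⟩

/-- The Fourier coefficient `⟨k⟩^{-β} = (1 + |k|²)^{-β/2}` of the potential. -/
def besselCoeff (β : ℝ) (k : Mom) : ℝ := (1 + normSq k) ^ (-β / 2)

/-- The fractional Bessel potential `v_β(x) = (2π)⁻² ∑_k ⟨k⟩^{-β} exp(i k·x)`, i.e. the convolution
kernel of `(1 - Δ)^{-β/2}`. The Fourier series is summed in `L²` of the torus, where it converges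
for `β > 1` (it does not converge absolutely pointwise for `β ≤ 2`). -/
def besselPotential (β : ℝ) : Lp ℂ 2 (volume : Measure Torus) :=
  ∑' k : Mom, (((2 * Real.pi)⁻¹ * besselCoeff β k : ℝ) : ℂ) •
    ContinuousMap.toLp (E := ℂ) 2 (volume : Measure Torus) ℂ (mode k)

/-! ### Bosonic Fock space -/

/-- Configurations of `n` particles. -/
abbrev Conf (n : ℕ) : Type := Fin n → Torus

/-- `L²((𝕋²)ⁿ)`. -/
abbrev L2 (n : ℕ) : Type := Lp ℂ 2 (volume : Measure (Conf n))

/-- Permuting the particles preserves Lebesgue measure. -/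
theorem measurePreserving_perm {n : ℕ} (σ : Equiv.Perm (Fin n)) :
    MeasurePreserving (fun X : Conf n => fun i => X (σ i)) volume volume := by
  have h := volume_measurePreserving_piCongrLeft (fun _ : Fin n => Torus) σ.symm
  convert h using 1
  funext X i
  have := MeasurableEquiv.piCongrLeft_apply_apply (β := fun _ : Fin n => Torus) σ.symm X (σ i)
  simpa using this.symm

/-- The unitary action of a permutation of the particles on `L²((𝕋²)ⁿ)`. -/
def permAction {n : ℕ} (σ : Equiv.Perm (Fin n)) : L2 n →ₗᵢ[ℂ] L2 n :=
  Lp.compMeasurePreservingₗᵢ ℂ (fun X : Conf n => fun i => X (σ i)) (measurePreserving_perm σ)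

/-- The permutation-invariant functions `L²_sym((𝕋²)ⁿ)`. -/
def symSubspace (n : ℕ) : Submodule ℂ (L2 n) :=
  ⨅ σ : Equiv.Perm (Fin n), LinearMap.eqLocus (permAction σ).toLinearMap LinearMap.id

/-- The `n`-particle sector `L²_sym((𝕋²)ⁿ)`; for `n = 0` it is `ℂ`. -/
abbrev Sector (n : ℕ) : Type := symSubspace n

theorem isClosed_symSubspace (n : ℕ) : IsClosed (symSubspace n : Set (L2 n)) := by
  have h : (symSubspace n : Set (L2 n)) =
      ⋂ σ : Equiv.Perm (Fin n), {f | permAction σ f = f} := by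
    ext f
    simp [symSubspace, LinearMap.mem_eqLocus]
  rw [h]
  exact isClosed_iInter fun σ => isClosed_eq (permAction σ).continuous continuous_id

instance (n : ℕ) : CompleteSpace (Sector n) := (isClosed_symSubspace n).completeSpace_coe

/-- The bosonic Fock space: the Hilbert direct sum of the sectors. -/
abbrev Fock : Type := lp (fun n : ℕ => Sector n) 2

/-- A representative of an `n`-particle wave function. -/
def wave {n : ℕ} (ψ : Sector n) : Conf n → ℂ := ((ψ : L2 n) : Conf n → ℂ)

/-! ### Quadratic forms of the sector Hamiltonians -/

/-- The normalized plane wave `∏ⱼ e_{Kⱼ}(xⱼ)` on `(𝕋²)ⁿ`. -/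
def planeWave {n : ℕ} (K : Fin n → Mom) (X : Conf n) : ℂ := ∏ j, mode (K j) (X j)

/-- The Fourier coefficient `⟨e_{K₁} ⊗ ⋯ ⊗ e_{Kₙ}, ψ⟩`. -/
def coeff {n : ℕ} (ψ : Sector n) (K : Fin n → Mom) : ℂ :=
  ∫ X : Conf n, conj (planeWave K X) * wave ψ X

/-- `∑ⱼ |Kⱼ|²`, the eigenvalue of `-∑ⱼ Δⱼ` on the plane wave of momenta `K`. -/
def kinetic {n : ℕ} (K : Fin n → Mom) : ℝ := ∑ j, normSq (K j)

/-- The mean particle number of the free Gibbs state `exp(-λ dΓ(1 - Δ)) / Z₀`: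
`N₀ = ∑_k n_k` with `n_k = (exp(λ(|k|² + 1)) - 1)⁻¹`. -/
def freeNumber (lam : ℝ) : ℝ := ∑' k : Mom, (Real.exp (lam * (normSq k + 1)) - 1)⁻¹

/-- The pairs `i < j` of particles. -/
def pairs (n : ℕ) : Finset (Fin n × Fin n) := Finset.univ.filter fun p => p.1 < p.2

/-- The form domain: symmetric functions in `H¹((𝕋²)ⁿ)` (here `∑_K |K|² |ψ̂(K)|² < ∞`) for which
the interaction energies `∫ v_β(xᵢ - xⱼ) |ψ|²` are finite. -/
def InFormDomain (β : ℝ) {n : ℕ} (ψ : Sector n) : Prop :=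
  (Summable fun K : Fin n → Mom => kinetic K * ‖coeff ψ K‖ ^ 2) ∧
  ∀ p ∈ pairs n, Integrable
    (fun X : Conf n => besselPotential β (X p.1 - X p.2) * ((‖wave ψ X‖ ^ 2 : ℝ) : ℂ)) volume

/-- The sesquilinear form of the `n`-particle Hamiltonian
`λ ∑ⱼ (-Δⱼ + 1) + λ² ∑_{i<j} v_β(xᵢ - xⱼ) + λ²/(2(2π)²) ((n - N₀)² - (n² - n))`. The last term
replaces the zero mode `n² - n` of the two-body interaction by the centred one `(n - N₀)²`; it
equals `c_λ n + C_λ` with `c_λ = λ²/(2(2π)²) (1 - 2N₀)` and `C_λ = λ²/(2(2π)²) N₀²`. -/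
def sectorForm (β lam : ℝ) {n : ℕ} (φ ψ : Sector n) : ℂ :=
  (lam : ℂ) * (∑' K : Fin n → Mom, (kinetic K : ℂ) * (conj (coeff φ K) * coeff ψ K))
  + ((lam * n + lam ^ 2 / (2 * (2 * Real.pi) ^ 2) *
      (((n : ℝ) - freeNumber lam) ^ 2 - ((n : ℝ) ^ 2 - n)) : ℝ) : ℂ) * inner ℂ φ ψ
  + (lam : ℂ) ^ 2 * ∑ p ∈ pairs n, ∫ X : Conf n,
      besselPotential β (X p.1 - X p.2) * (conj (wave φ X) * wave ψ X)

/-- `A` is the operator associated with the form `q` on the form domain `D`: `ψ ∈ dom A` with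
`A ψ = χ` if and only if `ψ ∈ D` and `q(φ, ψ) = ⟨φ, χ⟩` for all `φ ∈ D`. -/
def IsFormOperator {E : Type*} [NormedAddCommGroup E] [InnerProductSpace ℂ E]
    (D : E → Prop) (q : E → E → ℂ) (A : E →ₗ.[ℂ] E) : Prop :=
  ∀ ψ χ : E, (ψ, χ) ∈ A.graph ↔ D ψ ∧ ∀ φ : E, D φ → q φ ψ = inner ℂ φ χ

/-- `H = ⨁ₙ Hₙ` on Fock space, with its maximal domain. -/
def IsDirectSum (Hn : ∀ n, Sector n →ₗ.[ℂ] Sector n) (H : Fock →ₗ.[ℂ] Fock) : Prop :=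
  ∀ Ψ Χ : Fock, (Ψ, Χ) ∈ H.graph ↔ ∀ n, (Ψ n, Χ n) ∈ (Hn n).graph

/-! ### The formal Hamiltonian in terms of creation and annihilation operators -/

/-- A sequence of `n`-particle functions, `n = 0, 1, 2, …`. -/
abbrev Waves : Type := ∀ n : ℕ, Conf n → ℂ

/-- Representatives of the components of a Fock space vector. -/
def waves (Ψ : Fock) : Waves := fun n => wave (Ψ n)

/-- The annihilation operator `a_k = a(e_k)`:
`(a_k Ψ)(x₁, …, xₙ) = √(n+1) ∫ conj(e_k(x)) Ψ(x₁, …, xₙ, x) dx`. -/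
def annihilate (k : Mom) (Ψ : Waves) : Waves := fun n X =>
  (Real.sqrt (n + 1) : ℂ) * ∫ x : Torus, conj (mode k x) *
    Ψ (n + 1) (Fin.snoc (α := fun _ => Torus) X x)

/-- The Fock space inner product `∑ₙ ∫ conj(Φₙ) Ψₙ`. -/
def pairing (Φ Ψ : Waves) : ℂ := ∑' n : ℕ, ∫ X : Conf n, conj (Φ n X) * Ψ n X

/-- Multiplication by `n - N₀` on the `n`-particle sector, i.e. `𝒩 - N₀`. -/
def centredNumber (lam : ℝ) (Ψ : Waves) : Waves := fun n X =>
  (((n : ℝ) - freeNumber lam : ℝ) : ℂ) * Ψ n X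

/-- The matrix element `⟨Φ, (λ dΓ(h) + W^re) Ψ⟩` with `dΓ(h) = ∑_k (|k|² + 1) a_k* a_k` and
`W^re = λ²/(2(2π)²) ∑_{k ≠ 0} v̂_β(k) ∑_{p,q} a*_{p+k} a*_{q-k} a_q a_p + λ²/(2(2π)²) (𝒩 - N₀)²`,
the creation operators being moved to the left-hand vector as annihilation operators. -/
def formalHamiltonian (β lam : ℝ) (Φ Ψ : Waves) : ℂ :=
  (lam : ℂ) * (∑' k : Mom, ((normSq k + 1 : ℝ) : ℂ) * pairing (annihilate k Φ) (annihilate k Ψ))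
  + ((lam ^ 2 / (2 * (2 * Real.pi) ^ 2) : ℝ) : ℂ) *
      (∑' k : {k : Mom // k ≠ 0}, (besselCoeff β k : ℂ) * ∑' pq : Mom × Mom,
        pairing (annihilate (pq.2 - k) (annihilate (pq.1 + k) Φ))
          (annihilate pq.2 (annihilate pq.1 Ψ)))
  + ((lam ^ 2 / (2 * (2 * Real.pi) ^ 2) : ℝ) : ℂ) *
      pairing (centredNumber lam Φ) (centredNumber lam Ψ)

/-- Vectors with finitely many particles and finitely many momenta. -/
def IsFinite (Ψ : Fock) : Prop :=
  {n : ℕ | Ψ n ≠ 0}.Finite ∧ ∀ n, {K : Fin n → Mom | coeff (Ψ n) K ≠ 0}.Finite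

/-! ### Boltzmann operator, trace class operators and states -/

section Hilbert

variable {E : Type} [NormedAddCommGroup E] [InnerProductSpace ℂ E]

/-- `⟨Ψ, HΨ⟩ ≥ -C ‖Ψ‖²` on the domain of `H`. -/
def IsBoundedBelow (H : E →ₗ.[ℂ] E) : Prop :=
  ∃ C : ℝ, ∀ Ψ : H.domain, -C * ‖(Ψ : E)‖ ^ 2 ≤ (inner ℂ (Ψ : E) (H Ψ)).re

/-- `S = exp(-H)`: `S` is the value at time `1` of a strongly continuous semigroup `(exp(-tH))`,
`t ≥ 0`, of bounded operators whose generator is exactly `-H`. -/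
def IsExpNeg (H : E →ₗ.[ℂ] E) (S : E →L[ℂ] E) : Prop :=
  ∃ T : ℝ → E →L[ℂ] E,
    T 0 = ContinuousLinearMap.id ℂ E ∧
    (∀ s t : ℝ, 0 ≤ s → 0 ≤ t → T (s + t) = (T s).comp (T t)) ∧
    (∀ Ψ : E, ContinuousOn (fun t => T t Ψ) (Set.Ici 0)) ∧
    (∀ Ψ Χ : E, (Ψ, Χ) ∈ H.graph ↔
      Tendsto (fun t : ℝ => ((t⁻¹ : ℝ) : ℂ) • (Ψ - T t Ψ)) (𝓝[>] 0) (𝓝 Χ)) ∧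
    T 1 = S

/-- Trace class: `∑ᵢ |⟨eᵢ, S fᵢ⟩|` is bounded uniformly over finite orthonormal systems. -/
def IsTraceClass (S : E →L[ℂ] E) : Prop :=
  ∃ C : ℝ, ∀ (m : ℕ) (e f : Fin m → E), Orthonormal ℂ e → Orthonormal ℂ f →
    ∑ i, ‖inner ℂ (e i) (S (f i))‖ ≤ C

/-- `Tr S = z`: in every Hilbert basis the diagonal of `S` sums to `z`. -/
def HasTrace (S : E →L[ℂ] E) (z : ℂ) : Prop :=
  ∀ (ι : Type) (b : HilbertBasis ι ℂ E), HasSum (fun i => inner ℂ (b i) (S (b i))) z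

/-- A quantum state: a positive trace class operator of trace one. -/
def IsState [CompleteSpace E] (Γ : E →L[ℂ] E) : Prop :=
  Γ.IsPositive ∧ IsTraceClass Γ ∧ HasTrace Γ 1

end Hilbert

end BesselGas

end

/-! The potential is repulsive with a margin: v_β ≥ c > 0 almost everywhere. Indeed v_β is, up to
1/Γ(β/2), the integral of s^(β/2-1) e^(-s) times the torus heat kernel at time s. That kernel is
nonnegative by the functional equation of the Jacobi theta function, and bounded below for large s
because only the zero mode survives (`exists_circleHeat_re_ge`, `exists_besselPotential_ge`). The
n-particle interaction is therefore at least λ² c n(n-1)/2. This quadratic growth absorbs the linear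
term c_λ n, whatever its sign, and also the entropy of n particles.

In each sector the form, up to a multiple of the inner product, is the graph inner product of a
closed operator: √(λ|K|²) on the Fourier side together with λ√v_β(xᵢ-xⱼ) as multiplication operators
(`formGraph`, `sectorForm_eq_inner`). The kinetic part makes the form domain compactly embedded, so
the form operator has a Hilbert basis of eigenvectors (`exists_formBasis`, `exists_sectorBasis`).
The bases of all sectors join to one of Fock space (`exists_lpBasis`). Self-adjointness, the
semigroup, the trace and positivity then become statements about real multipliers in a fixed basis.

For the partition function, Jensen's inequality in the momentum distribution of each eigenvector and
Bessel's inequality give Σ e^(-E) ≤ e^(-κ_n) zⁿ, with z = Σ_k e^(-λ|k|²) and κ_n the quadratic lower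
bound. Completing the square turns this into e^(D-n) (`exists_sum_exp_neg_le`), which is summable in
n and also shows E ≥ -D.

The formal Hamiltonian is matched on trigonometric polynomials. There v_β ∈ L² makes v_β ψ square
integrable, the L² Fourier series of v_β may be integrated term by term, and by symmetry all pairs
contribute equally. The k = 0 term is (n² - n)⟨φ, ψ⟩, which the form replaces by (n - N₀)². -/

noncomputable section

namespace BesselGas

/-! ### Operators that are diagonal in a Hilbert basis -/

section Diagonal

variable {E ι : Type*} [NormedAddCommGroup E] [InnerProductSpace ℂ E]

theorem HilbertBasis.eq_of_inner (b : HilbertBasis ι ℂ E) {x y : E}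
    (h : ∀ i, inner ℂ (b i) x = inner ℂ (b i) y) : x = y := by
  apply b.repr.injective
  ext i
  simpa [b.repr_apply_apply] using h i

theorem HilbertBasis.hasSum_norm_sq (b : HilbertBasis ι ℂ E) (x : E) :
    HasSum (fun i => ‖inner ℂ (b i) x‖ ^ 2) (‖x‖ ^ 2) := by
  have h := lp.hasSum_norm (p := 2) (by norm_num) (b.repr x)
  simpa [b.repr_apply_apply] using h

theorem HilbertBasis.exists_of_summable (b : HilbertBasis ι ℂ E) (f : ι → ℂ)
    (hf : Summable fun i => ‖f i‖ ^ 2) : ∃ x : E, ∀ i, inner ℂ (b i) x = f i := by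
  have hm : Memℓp f 2 := memℓp_gen (by simpa using hf)
  refine ⟨b.repr.symm ⟨f, hm⟩, fun i => ?_⟩
  rw [← b.repr_apply_apply, LinearIsometryEquiv.apply_symm_apply]

/-- A bounded sequence of multipliers defines a bounded operator. -/
theorem exists_diagonal (b : HilbertBasis ι ℂ E) (s : ι → ℝ) {M : ℝ} (hs : ∀ i, |s i| ≤ M) :
    ∃ S : E →L[ℂ] E, ∀ x i, inner ℂ (b i) (S x) = s i * inner ℂ (b i) x := by
  have hle : ∀ x i, ‖(s i : ℂ) * inner ℂ (b i) x‖ ^ 2 ≤ M ^ 2 * ‖inner ℂ (b i) x‖ ^ 2 := by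
    intro x i
    rw [norm_mul, mul_pow]
    gcongr
    simpa using hs i
  have hex : ∀ x : E, ∃ y : E, ∀ i, inner ℂ (b i) y = s i * inner ℂ (b i) x := fun x =>
    HilbertBasis.exists_of_summable b _ (Summable.of_nonneg_of_le (fun _ => by positivity) (hle x)
      ((HilbertBasis.hasSum_norm_sq b x).summable.mul_left _))
  choose f hf using hex
  refine ⟨LinearMap.mkContinuous
    { toFun := f
      map_add' := fun x y => HilbertBasis.eq_of_inner b fun i => by
        simp only [inner_add_right, hf, mul_add]
      map_smul' := fun c x => HilbertBasis.eq_of_inner b fun i => by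
        simp only [inner_smul_right, hf, RingHom.id_apply]; ring } |M| fun x => ?_, hf⟩
  refine abs_le_of_sq_le_sq' ?_ (by positivity) |>.2
  have h1 := HilbertBasis.hasSum_norm_sq b (f x)
  have h2 := (HilbertBasis.hasSum_norm_sq b x).mul_left (M ^ 2)
  rw [mul_pow, sq_abs]
  refine hasSum_le (fun i => ?_) h1 h2
  rw [hf]
  exact hle x i

/-- The operator `H` is diagonal in the basis `b` with eigenvalues `μ`, on its maximal domain. -/
def IsDiagonal (b : HilbertBasis ι ℂ E) (μ : ι → ℝ) (H : E →ₗ.[ℂ] E) : Prop :=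
  ∀ x y : E, (x, y) ∈ H.graph ↔ ∀ i, inner ℂ (b i) y = μ i * inner ℂ (b i) x

theorem exists_isDiagonal (b : HilbertBasis ι ℂ E) (μ : ι → ℝ) :
    ∃ H : E →ₗ.[ℂ] E, IsDiagonal b μ H := by
  let g : Submodule ℂ (E × E) :=
    { carrier := {p | ∀ i, inner ℂ (b i) p.2 = μ i * inner ℂ (b i) p.1}
      add_mem' := fun {p q} hp hq i => by
        simp only [Prod.snd_add, Prod.fst_add, inner_add_right, hp i, hq i, mul_add]
      zero_mem' := fun i => by simp
      smul_mem' := fun c p hp i => by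
        simp only [Prod.smul_snd, Prod.smul_fst, inner_smul_right, hp i]; ring }
  refine ⟨g.toLinearPMap, fun x y => ?_⟩
  rw [Submodule.toLinearPMap_graph_eq]
  · rfl
  · intro p hp h0
    refine HilbertBasis.eq_of_inner b fun i => ?_
    rw [hp i, h0]
    simp

variable {b : HilbertBasis ι ℂ E} {μ : ι → ℝ} {H : E →ₗ.[ℂ] E}

theorem IsDiagonal.basis_mem (hH : IsDiagonal b μ H) (i : ι) :
    (b i, (μ i : ℂ) • b i) ∈ H.graph := by
  classical
  rw [hH]
  intro j
  rw [inner_smul_right]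
  rcases eq_or_ne j i with rfl | h
  · rfl
  · rw [b.orthonormal.2 h]; simp

theorem IsDiagonal.dense_domain (hH : IsDiagonal b μ H) : Dense (H.domain : Set E) := by
  have h : Submodule.span ℂ (Set.range b) ≤ H.domain := by
    rw [Submodule.span_le]
    rintro _ ⟨i, rfl⟩
    exact LinearPMap.mem_domain_of_mem_graph (hH.basis_mem i)
  have hd : Dense (Submodule.span ℂ (Set.range b) : Set E) := by
    rw [Submodule.dense_iff_topologicalClosure_eq_top]
    exact b.dense_span
  exact hd.mono h

/-- Testing the adjoint relation on the basis vectors alone already forces the diagonal relation;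
Parseval gives the converse. The maximal domain is thus the domain of the adjoint. -/
theorem IsDiagonal.isSelfAdjoint [CompleteSpace E] (hH : IsDiagonal b μ H) :
    IsSelfAdjoint H := by
  rw [LinearPMap.isSelfAdjoint_def]
  apply LinearPMap.eq_of_eq_graph
  rw [LinearPMap.adjoint_graph_eq_graph_adjoint hH.dense_domain]
  ext ⟨x, y⟩
  rw [Submodule.mem_adjoint_iff, hH]
  constructor
  · intro h i
    have := h _ _ (hH.basis_mem i)
    rw [inner_smul_left, sub_eq_zero] at this
    simpa using this.symm
  · intro h u v huv
    rw [hH] at huv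
    rw [sub_eq_zero, ← b.tsum_inner_mul_inner, ← b.tsum_inner_mul_inner]
    congr 1
    ext i
    rw [h i, ← inner_conj_symm v, huv i, map_mul, inner_conj_symm, Complex.conj_ofReal]
    ring

theorem IsDiagonal.isBoundedBelow {E : Type} {ι : Type*} [NormedAddCommGroup E]
    [InnerProductSpace ℂ E] {b : HilbertBasis ι ℂ E} {μ : ι → ℝ} {H : E →ₗ.[ℂ] E}
    (hH : IsDiagonal b μ H) {C : ℝ} (hC : ∀ i, -C ≤ μ i) : IsBoundedBelow H := by
  refine ⟨C, fun x => ?_⟩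
  have hx := (hH _ _).1 (H.mem_graph x)
  have h1 := (HilbertBasis.hasSum_norm_sq b (x : E)).mul_left (-C)
  have h2 := Complex.hasSum_re (b.hasSum_inner_mul_inner (x : E) (H x))
  refine hasSum_le (fun i => ?_) h1 h2
  have : inner ℂ (x : E) (b i) * inner ℂ (b i) (H x)
      = ((μ i * ‖inner ℂ (b i) (x : E)‖ ^ 2 : ℝ) : ℂ) := by
    rw [hx i, ← inner_conj_symm (x : E), mul_left_comm, ← Complex.normSq_eq_conj_mul_self,
      Complex.normSq_eq_norm_sq]
    push_cast
    ring
  rw [this, Complex.ofReal_re]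
  gcongr
  exact hC i

end Diagonal

/-! ### The semigroup generated by a diagonal operator -/

section Semigroup

theorem _root_.HasSum.congr_summand {α M : Type*} [AddCommMonoid M] [TopologicalSpace M]
    {f g : α → M} {a : M} (h : HasSum f a) (hfg : ∀ i, g i = f i) : HasSum g a := by
  rwa [funext hfg]

/-- Applied with x = tμ and 0 < t < 1, this dominates the difference quotients of the semigroup by a
multiple of |μ| that does not depend on t. -/
theorem abs_one_sub_exp_neg_le {C x : ℝ} (hC : 0 ≤ C) (hx : -C ≤ x) :
    |1 - Real.exp (-x)| ≤ Real.exp C * |x| := by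
  have hC1 : 1 ≤ Real.exp C := Real.one_le_exp hC
  rcases le_total 0 x with h | h
  · have h1 : Real.exp (-x) ≤ 1 := Real.exp_le_one_iff.2 (by linarith)
    have h2 := Real.one_sub_le_exp_neg x
    rw [abs_of_nonneg (by linarith), abs_of_nonneg h]
    nlinarith
  · have h1 : 1 ≤ Real.exp (-x) := Real.one_le_exp (by linarith)
    have h2 := Real.add_one_le_exp x
    have h3 : Real.exp (-x) ≤ Real.exp C := Real.exp_le_exp.2 (by linarith)
    have h4 : Real.exp (-x) * Real.exp x = 1 := by rw [← Real.exp_add]; simp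
    rw [abs_of_nonpos (by linarith), abs_of_nonpos h]
    have h5 : Real.exp (-x) * (x + 1) ≤ 1 :=
      (mul_le_mul_of_nonneg_left h2 (Real.exp_pos _).le).trans_eq h4
    nlinarith

variable {E : Type} {ι : Type*} [NormedAddCommGroup E] [InnerProductSpace ℂ E]
  {b : HilbertBasis ι ℂ E} {μ : ι → ℝ} {H : E →ₗ.[ℂ] E}

/-- Dominated convergence in Parseval's identity for the squared distance. -/
theorem tendsto_of_coeff_tendsto {α : Type*} {l : Filter α} [l.IsCountablyGenerated]
    (b : HilbertBasis ι ℂ E) {f : α → E} {y : E}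
    {bound : ι → ℝ} (hb : Summable fun i => bound i ^ 2)
    (hlim : ∀ i, Tendsto (fun t => inner ℂ (b i) (f t)) l (𝓝 (inner ℂ (b i) y)))
    (hle : ∀ᶠ t in l, ∀ i, ‖inner ℂ (b i) (f t) - inner ℂ (b i) y‖ ≤ bound i) :
    Tendsto f l (𝓝 y) := by
  rw [tendsto_iff_norm_sub_tendsto_zero]
  have h : Tendsto (fun t => ‖f t - y‖ ^ 2) l (𝓝 0) := by
    have h1 : ∀ t, ‖f t - y‖ ^ 2 = ∑' i, ‖inner ℂ (b i) (f t) - inner ℂ (b i) y‖ ^ 2 := by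
      intro t
      rw [← (HilbertBasis.hasSum_norm_sq b (f t - y)).tsum_eq]
      simp only [inner_sub_right]
    simp only [h1]
    rw [← tsum_zero (β := ι)]
    refine tendsto_tsum_of_dominated_convergence hb (fun i => ?_) ?_
    · have := ((hlim i).sub_const (inner ℂ (b i) y)).norm.pow 2
      simpa using this
    · filter_upwards [hle] with t ht i
      rw [Real.norm_of_nonneg (by positivity)]
      gcongr
      exact ht i
  have := h.sqrt
  simpa using this

theorem IsDiagonal.exists_isExpNeg (hH : IsDiagonal b μ H) {C : ℝ} (hC0 : 0 ≤ C)
    (hC : ∀ i, -C ≤ μ i) : ∃ S : E →L[ℂ] E, IsExpNeg H S ∧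
      ∀ x i, inner ℂ (b i) (S x) = (Real.exp (-μ i) : ℝ) * inner ℂ (b i) x := by
  have hbd : ∀ t : ℝ, 0 ≤ t → ∀ i, Real.exp (-(t * μ i)) ≤ Real.exp (t * C) := by
    intro t ht i
    apply Real.exp_le_exp.2
    nlinarith [hC i]
  -- The absolute value makes the multipliers bounded for every real t; only t ≥ 0 matters, and for
  -- negative t the factor exp(-tμ) may be unbounded.
  have hex : ∀ t : ℝ, ∃ T : E →L[ℂ] E, ∀ x i,
      inner ℂ (b i) (T x) = ((Real.exp (-(|t| * μ i)) : ℝ) : ℂ) * inner ℂ (b i) x := fun t =>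
    exists_diagonal b _ (M := Real.exp (|t| * C)) fun i => by
      rw [abs_of_pos (Real.exp_pos _)]
      exact hbd _ (abs_nonneg t) i
  choose T hT using hex
  have hT' : ∀ t, 0 ≤ t → ∀ x i,
      inner ℂ (b i) (T t x) = ((Real.exp (-(t * μ i)) : ℝ) : ℂ) * inner ℂ (b i) x := by
    intro t ht x i
    rw [hT, abs_of_nonneg ht]
  refine ⟨T 1, ⟨T, ?_, ?_, ?_, ?_, rfl⟩, fun x i => by rw [hT' 1 zero_le_one, one_mul]⟩
  · ext x
    refine HilbertBasis.eq_of_inner b fun i => ?_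
    rw [hT' 0 le_rfl]
    simp
  · intro s t hs ht
    ext x
    refine HilbertBasis.eq_of_inner b fun i => ?_
    rw [hT' _ (add_nonneg hs ht), ContinuousLinearMap.comp_apply, hT' s hs, hT' t ht, ← mul_assoc,
      ← Complex.ofReal_mul, ← Real.exp_add]
    congr 3
    ring
  · intro x t₀ ht₀
    refine tendsto_of_coeff_tendsto b
      (bound := fun i => 2 * Real.exp ((t₀ + 1) * C) * ‖inner ℂ (b i) x‖) ?_ ?_ ?_
    · simp only [mul_pow _ (‖_‖)]
      exact (HilbertBasis.hasSum_norm_sq b x).summable.mul_left _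
    · intro i
      have hc : Continuous fun t : ℝ =>
          ((Real.exp (-(|t| * μ i)) : ℝ) : ℂ) * inner ℂ (b i) x := by fun_prop
      simp only [hT]
      exact (hc.tendsto t₀).mono_left nhdsWithin_le_nhds
    · have h1 : ∀ᶠ t in 𝓝[Set.Ici 0] t₀, t < t₀ + 1 :=
        nhdsWithin_le_nhds (Iio_mem_nhds (by linarith))
      filter_upwards [h1, self_mem_nhdsWithin] with t ht ht0 i
      have ht0 : 0 ≤ t := ht0
      have ht₀ : 0 ≤ t₀ := ht₀
      rw [hT' t ht0, hT' t₀ ht₀, ← sub_mul, norm_mul, ← Complex.ofReal_sub, Complex.norm_real]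
      gcongr
      have e1 : Real.exp (-(t * μ i)) ≤ Real.exp ((t₀ + 1) * C) :=
        (hbd t ht0 i).trans (by gcongr)
      have e2 : Real.exp (-(t₀ * μ i)) ≤ Real.exp ((t₀ + 1) * C) :=
        (hbd t₀ ht₀ i).trans (by gcongr; linarith)
      have e3 := Real.exp_pos (-(t * μ i))
      have e4 := Real.exp_pos (-(t₀ * μ i))
      rw [Real.norm_eq_abs, abs_le]
      constructor <;> linarith
  · intro x y
    rw [hH]
    have hc : ∀ t, 0 < t → ∀ i, inner ℂ (b i) (((t⁻¹ : ℝ) : ℂ) • (x - T t x)) =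
        ((t⁻¹ * (1 - Real.exp (-(t * μ i))) : ℝ) : ℂ) * inner ℂ (b i) x := by
      intro t ht i
      rw [inner_smul_right, inner_sub_right, hT' t ht.le]
      push_cast
      ring
    have hlim : ∀ i, Tendsto (fun t : ℝ => inner ℂ (b i) (((t⁻¹ : ℝ) : ℂ) • (x - T t x)))
        (𝓝[>] 0) (𝓝 (μ i * inner ℂ (b i) x)) := by
      intro i
      have hd : HasDerivAt (fun t : ℝ => -Real.exp (-(t * μ i))) (μ i) 0 := by
        exact (((hasDerivAt_id (0 : ℝ)).mul_const (μ i)).neg.exp.neg).congr_deriv (by simp)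
      have h1 := hd.tendsto_slope_zero_right
      have h2 : Tendsto (fun t : ℝ => ((t⁻¹ * (1 - Real.exp (-(t * μ i))) : ℝ) : ℂ)
          * inner ℂ (b i) x) (𝓝[>] 0) (𝓝 (μ i * inner ℂ (b i) x)) := by
        refine Tendsto.mul_const _ ?_
        refine (Complex.continuous_ofReal.tendsto _).comp ?_
        refine h1.congr fun t => ?_
        simp only [zero_add, smul_eq_mul, zero_mul, neg_zero, Real.exp_zero]
        ring
      refine h2.congr' ?_
      filter_upwards [self_mem_nhdsWithin] with t ht
      exact (hc t ht i).symm
    -- On the domain the quotients are dominated by the coefficients of `y`. Conversely, a norm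
    -- limit of the quotients determines every coefficient, which is the diagonal relation.
    constructor
    · intro h
      refine tendsto_of_coeff_tendsto b
        (bound := fun i => (Real.exp C + 1) * ‖inner ℂ (b i) y‖) ?_ ?_ ?_
      · simp only [mul_pow _ (‖_‖)]
        exact (HilbertBasis.hasSum_norm_sq b y).summable.mul_left _
      · intro i
        rw [h i]
        exact hlim i
      · have h1 : ∀ᶠ t in 𝓝[>] (0 : ℝ), t < 1 := nhdsWithin_le_nhds (Iio_mem_nhds one_pos)
        filter_upwards [h1, self_mem_nhdsWithin] with t ht ht0 i
        have ht0 : 0 < t := ht0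
        refine (norm_sub_le _ _).trans ?_
        rw [add_mul, one_mul]
        gcongr
        rw [hc t ht0, h i, norm_mul, norm_mul, ← mul_assoc]
        gcongr
        rw [Complex.norm_real, Complex.norm_real, Real.norm_eq_abs, Real.norm_eq_abs, abs_mul,
          abs_of_pos (inv_pos.2 ht0)]
        have := abs_one_sub_exp_neg_le (x := t * μ i) hC0 (by nlinarith [hC i])
        rw [abs_mul, abs_of_pos ht0] at this
        calc t⁻¹ * |1 - Real.exp (-(t * μ i))| ≤ t⁻¹ * (Real.exp C * (t * |μ i|)) := by gcongr
          _ = Real.exp C * |μ i| := by field_simp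
    · intro h i
      have h1 : Tendsto (fun t : ℝ => inner ℂ (b i) (((t⁻¹ : ℝ) : ℂ) • (x - T t x)))
          (𝓝[>] 0) (𝓝 (inner ℂ (b i) y)) :=
        ((innerSL ℂ (b i)).continuous.tendsto y).comp h
      exact tendsto_nhds_unique h1 (hlim i)

end Semigroup

/-! ### Trace class, trace and states for diagonal operators -/

section Trace

variable {E : Type} {ι : Type*} [NormedAddCommGroup E] [InnerProductSpace ℂ E]
  {b : HilbertBasis ι ℂ E} {s : ι → ℝ} {S : E →L[ℂ] E}

theorem hasSum_inner_diagonal (hS : ∀ x i, inner ℂ (b i) (S x) = s i * inner ℂ (b i) x)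
    (x y : E) :
    HasSum (fun i => s i * (inner ℂ x (b i) * inner ℂ (b i) y)) (inner ℂ x (S y)) := by
  refine (b.hasSum_inner_mul_inner x (S y)).congr_summand ?_
  intro i
  rw [hS]
  ring

/-- Expand in the eigenbasis, split each product of two inner products by 2ab ≤ a² + b², and sum
over the orthonormal systems first: Bessel's inequality leaves at most one copy of each eigenvalue.
-/
theorem isTraceClass_of_diagonal (hS : ∀ x i, inner ℂ (b i) (S x) = s i * inner ℂ (b i) x)
    (h0 : ∀ i, 0 ≤ s i) (hs : Summable s) : IsTraceClass S := by
  refine ⟨∑' i, s i, fun m e f he hf => ?_⟩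
  have hle : ∀ i j, ‖(s j : ℂ) * (inner ℂ (e i) (b j) * inner ℂ (b j) (f i))‖ ≤
      s j * ((‖inner ℂ (e i) (b j)‖ ^ 2 + ‖inner ℂ (f i) (b j)‖ ^ 2) / 2) := by
    intro i j
    rw [norm_mul, norm_mul, Complex.norm_real, Real.norm_of_nonneg (h0 j),
      norm_inner_symm (b j) (f i)]
    gcongr
    · exact h0 j
    · nlinarith [sq_nonneg (‖inner ℂ (e i) (b j)‖ - ‖inner ℂ (f i) (b j)‖)]
  have hbess : ∀ (g : Fin m → E), Orthonormal ℂ g → ∀ j, ∑ i, ‖inner ℂ (g i) (b j)‖ ^ 2 ≤ 1 := by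
    intro g hg j
    have := hg.sum_inner_products_le (b j) (s := Finset.univ)
    rwa [b.orthonormal.1, one_pow] at this
  have hb1 : ∀ (g : Fin m → E), Orthonormal ℂ g → ∀ i j, ‖inner ℂ (g i) (b j)‖ ^ 2 ≤ 1 :=
    fun g hg i j => (Finset.single_le_sum (f := fun i => ‖inner ℂ (g i) (b j)‖ ^ 2)
      (fun _ _ => by positivity) (Finset.mem_univ i)).trans (hbess g hg j)
  have hsum : ∀ i, Summable fun j =>
      s j * ((‖inner ℂ (e i) (b j)‖ ^ 2 + ‖inner ℂ (f i) (b j)‖ ^ 2) / 2) := by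
    intro i
    refine Summable.of_nonneg_of_le (fun j => mul_nonneg (h0 j) (by positivity)) (fun j => ?_) hs
    have := hb1 e he i j
    have := hb1 f hf i j
    exact mul_le_of_le_one_right (h0 j) (by linarith)
  calc ∑ i, ‖inner ℂ (e i) (S (f i))‖
      ≤ ∑ i, ∑' j, s j * ((‖inner ℂ (e i) (b j)‖ ^ 2 + ‖inner ℂ (f i) (b j)‖ ^ 2) / 2) := by
        refine Finset.sum_le_sum fun i _ => ?_
        rw [← (hasSum_inner_diagonal hS (e i) (f i)).tsum_eq]
        exact tsum_of_norm_bounded (hsum i).hasSum (hle i)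
    _ = ∑' j, ∑ i, s j * ((‖inner ℂ (e i) (b j)‖ ^ 2 + ‖inner ℂ (f i) (b j)‖ ^ 2) / 2) :=
        (Summable.tsum_finsetSum fun i _ => hsum i).symm
    _ ≤ ∑' j, s j := by
        refine (summable_sum fun i _ => hsum i).tsum_le_tsum (fun j => ?_) hs
        rw [← Finset.mul_sum, ← Finset.sum_div, Finset.sum_add_distrib]
        have := hbess e he j
        have := hbess f hf j
        exact mul_le_of_le_one_right (h0 j) (by linarith)

/-- Independence of the basis is Tonelli's theorem for the nonnegative double family `s j * ‖⟨c i, b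
j⟩‖ ^ 2`: summing over `i` gives `s j`, summing over `j` gives the diagonal element of `S` at `c i`.
-/
theorem hasTrace_of_diagonal (hS : ∀ x i, inner ℂ (b i) (S x) = s i * inner ℂ (b i) x)
    (h0 : ∀ i, 0 ≤ s i) (hs : Summable s) : HasTrace S ((∑' i, s i : ℝ) : ℂ) := by
  intro κ c
  have hfib : ∀ j, HasSum (fun i => s j * ‖inner ℂ (c i) (b j)‖ ^ 2) (s j) := by
    intro j
    have := (HilbertBasis.hasSum_norm_sq c (b j)).mul_left (s j)
    rwa [b.orthonormal.1, one_pow, mul_one] at this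
  have hprod : Summable fun p : ι × κ => s p.1 * ‖inner ℂ (c p.2) (b p.1)‖ ^ 2 := by
    rw [summable_prod_of_nonneg fun p => mul_nonneg (h0 _) (by positivity)]
    exact ⟨fun j => (hfib j).summable, by simpa only [(hfib _).tsum_eq] using hs⟩
  have htot : HasSum (fun p : ι × κ => s p.1 * ‖inner ℂ (c p.2) (b p.1)‖ ^ 2) (∑' i, s i) := by
    have h1 := hprod.hasSum
    have h2 := h1.prod_fiberwise hfib
    rw [h2.tsum_eq]
    exact h1
  have hsw := (Equiv.prodComm κ ι).hasSum_iff.2 htot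
  have hdiag : ∀ i, HasSum (fun j => s j * ‖inner ℂ (c i) (b j)‖ ^ 2)
      (inner ℂ (c i) (S (c i))).re := by
    intro i
    refine (Complex.hasSum_re (hasSum_inner_diagonal hS (c i) (c i))).congr_summand fun j => ?_
    rw [← inner_conj_symm (b j), Complex.mul_conj, Complex.normSq_eq_norm_sq, ← Complex.ofReal_mul,
      Complex.ofReal_re]
  have him : ∀ i, (((inner ℂ (c i) (S (c i))).re : ℝ) : ℂ) = inner ℂ (c i) (S (c i)) := by
    intro i
    have h1 := Complex.hasSum_ofReal.2 (hdiag i)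
    refine h1.unique ((hasSum_inner_diagonal hS (c i) (c i)).congr_summand fun j => ?_)
    rw [← inner_conj_symm (b j), Complex.mul_conj, Complex.normSq_eq_norm_sq, ← Complex.ofReal_mul]
  have hre : HasSum (fun i => (inner ℂ (c i) (S (c i))).re) (∑' i, s i) :=
    hsw.prod_fiberwise hdiag
  refine (Complex.hasSum_ofReal.2 hre).congr_summand fun i => (him i).symm

theorem isState_of_diagonal [CompleteSpace E]
    (hS : ∀ x i, inner ℂ (b i) (S x) = s i * inner ℂ (b i) x)
    (h0 : ∀ i, 0 ≤ s i) (hs : HasSum s 1) : IsState S := by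
  refine ⟨⟨fun x y => ?_, fun x => ?_⟩, isTraceClass_of_diagonal hS h0 hs.summable, ?_⟩
  · change inner ℂ (S x) y = inner ℂ x (S y)
    have h2 := hasSum_inner_diagonal hS x y
    have h1 := Complex.hasSum_conj'.2 (hasSum_inner_diagonal hS y x)
    rw [← inner_conj_symm]
    refine h1.unique (h2.congr_summand fun i => ?_)
    simp only [map_mul, Complex.conj_ofReal, inner_conj_symm]
    ring
  · rw [ContinuousLinearMap.reApplyInnerSelf_apply, ← inner_conj_symm, RCLike.conj_re]
    refine (Complex.hasSum_re (hasSum_inner_diagonal hS x x)).nonneg fun i => ?_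
    rw [← inner_conj_symm (b i), Complex.mul_conj, ← Complex.ofReal_mul, Complex.ofReal_re]
    exact mul_nonneg (h0 i) (Complex.normSq_nonneg _)
  · have := hasTrace_of_diagonal hS h0 hs.summable
    rwa [hs.tsum_eq, Complex.ofReal_one] at this

end Trace

/-! ### Form operators with compactly embedded domain -/

section FormOperator

variable {E K : Type} [NormedAddCommGroup E] [InnerProductSpace ℂ E] [CompleteSpace E]
  [NormedAddCommGroup K] [InnerProductSpace ℂ K] [CompleteSpace K]

/-- A compact symmetric operator has a Hilbert basis of eigenvectors. -/
theorem exists_eigenbasis {R : E →L[ℂ] E} (hR : IsCompactOperator R) (hs : R.IsSymmetric) :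
    ∃ (ι : Type) (b : HilbertBasis ι ℂ E) (z : ι → ℂ), ∀ i, R (b i) = z i • b i := by
  have hcl : ∀ z : ℂ, IsClosed (Module.End.eigenspace (R : Module.End ℂ E) z : Set E) := by
    intro z
    have : (Module.End.eigenspace (R : Module.End ℂ E) z : Set E) = {x | R x = z • x} := by
      ext x
      simp
    rw [this]
    exact isClosed_eq R.continuous (continuous_const_smul z)
  have hcomp : ∀ z : ℂ, CompleteSpace (Module.End.eigenspace (R : Module.End ℂ E) z) :=
    fun z => (hcl z).completeSpace_coe
  have hb := fun z : ℂ => exists_hilbertBasis ℂ (Module.End.eigenspace (R : Module.End ℂ E) z)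
  choose w b hb using hb
  have hfam := LinearMap.IsSymmetric.orthogonalFamily_eigenspaces hs
  -- Hilbert bases of the single eigenspaces are glued; different eigenspaces are orthogonal.
  have hon : Orthonormal ℂ fun p : Σ z : ℂ, w z =>
      ((b p.1 p.2 : Module.End.eigenspace (R : Module.End ℂ E) p.1) : E) :=
    hfam.orthonormal_sigma_orthonormal fun z => (b z).orthonormal
  have hbot : (Submodule.span ℂ (Set.range fun p : Σ z : ℂ, w z =>
      ((b p.1 p.2 : Module.End.eigenspace (R : Module.End ℂ E) p.1) : E)))ᗮ = ⊥ := by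
    rw [eq_bot_iff, ← ContinuousLinearMap.orthogonalComplement_iSup_eigenspaces_eq_bot hR hs]
    intro x hx
    rw [Submodule.mem_orthogonal] at hx
    rw [← Submodule.iInf_orthogonal, Submodule.mem_iInf]
    intro z
    rw [Submodule.mem_orthogonal']
    intro y hy
    have h1 := ((b z).hasSum_repr ⟨y, hy⟩).mapL
      ((innerSL ℂ x).comp (Module.End.eigenspace (R : Module.End ℂ E) z).subtypeL)
    have h2 : ∀ i, ((innerSL ℂ x).comp (Module.End.eigenspace (R : Module.End ℂ E) z).subtypeL)
        ((b z).repr ⟨y, hy⟩ i • b z i) = 0 := by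
      intro i
      have := hx _ (Submodule.subset_span ⟨⟨z, i⟩, rfl⟩)
      rw [map_smul]
      simp only [ContinuousLinearMap.comp_apply, Submodule.subtypeL_apply, innerSL_apply_apply]
      rw [inner_eq_zero_symm.1 this, smul_zero]
    simp only [h2] at h1
    exact h1.unique hasSum_zero
  refine ⟨_, HilbertBasis.mkOfOrthogonalEqBot hon hbot, fun p => p.1, fun p => ?_⟩
  rw [HilbertBasis.coe_mkOfOrthogonalEqBot]
  exact Module.End.mem_eigenspace_iff.1 (b p.1 p.2).2

/-- The operator associated with the graph form of a closed operator (given by its graph `G`) with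
compactly embedded dense domain is diagonal in some Hilbert basis. -/
theorem exists_formBasis (G : Submodule ℂ (WithLp 2 (E × K)))
    (hG : IsClosed (G : Set (WithLp 2 (E × K))))
    (hdense : ∀ e : E, (∀ x ∈ G, inner ℂ x.fst e = 0) → e = 0)
    (hcomp : IsCompactOperator fun x : G => x.1.fst) :
    ∃ (ι : Type) (b : HilbertBasis ι ℂ E) (μ : ι → ℝ), ∀ ψ χ : E,
      (∃ x ∈ G, x.fst = ψ ∧ ∀ y ∈ G, inner ℂ y x = inner ℂ y.fst χ) ↔
        ∀ i, inner ℂ (b i) χ = μ i * inner ℂ (b i) ψ := by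
  have := hG.completeSpace_coe
  -- `J` embeds the form domain, with its graph norm, into `E`. The form equation says exactly that
  -- the solution is `A χ`, by Riesz and the definition of the adjoint. Hence `R = J A` is the
  -- inverse of the form operator, and it is compact and symmetric.
  let J : G →L[ℂ] E := (WithLp.fstL 2 ℂ E K).comp G.subtypeL
  have hJ : ∀ x : G, J x = x.1.fst := fun x => rfl
  let A := ContinuousLinearMap.adjoint J
  let R : E →L[ℂ] E := J.comp A
  have hRc : IsCompactOperator R := IsCompactOperator.comp_clm (f := J) hcomp A
  have hR : ∀ x y, inner ℂ x (R y) = inner ℂ (A x) (A y) := fun x y =>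
    (ContinuousLinearMap.adjoint_inner_left J (A y) x).symm
  have hR' : ∀ x y, inner ℂ (R x) y = inner ℂ (A x) (A y) := fun x y =>
    (ContinuousLinearMap.adjoint_inner_right J (A x) y).symm
  have hRs : R.IsSymmetric := fun x y => (hR' x y).trans (hR x y).symm
  -- Density of the form domain makes `A` injective, so that `R` has no eigenvalue zero.
  have hA : ∀ e, A e = 0 → e = 0 := by
    intro e he
    refine hdense e fun x hx => ?_
    have := ContinuousLinearMap.adjoint_inner_right J ⟨x, hx⟩ e
    rw [← hJ ⟨x, hx⟩, ← this]
    change inner ℂ _ (A e) = 0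
    rw [he, inner_zero_right]
  obtain ⟨ι, b, z, hz⟩ := exists_eigenbasis hRc hRs
  have hzr : ∀ i, z i = ((‖A (b i)‖ ^ 2 : ℝ) : ℂ) := by
    intro i
    have h1 := hR (b i) (b i)
    rw [hz, inner_smul_right, inner_self_eq_norm_sq_to_K, b.orthonormal.1] at h1
    have h2 := inner_self_eq_norm_sq_to_K (𝕜 := ℂ) (A (b i))
    rw [← h1] at h2
    simpa using h2
  have hpos : ∀ i, (‖A (b i)‖ ^ 2 : ℝ) ≠ 0 := by
    intro i h
    have h1 : A (b i) = 0 := by simpa using h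
    have h2 := b.orthonormal.1 i
    rw [hA _ h1, norm_zero] at h2
    exact zero_ne_one h2
  -- The eigenvalue of `R` at `b i` is `‖A (b i)‖ ^ 2`; the form operator has the inverse one.
  refine ⟨ι, b, fun i => (‖A (b i)‖ ^ 2)⁻¹, fun ψ χ => ?_⟩
  have h1 : (∃ x ∈ G, x.fst = ψ ∧ ∀ y ∈ G, inner ℂ y x = inner ℂ y.fst χ) ↔ R χ = ψ := by
    constructor
    · rintro ⟨x, hx, rfl, h⟩
      have : A χ = ⟨x, hx⟩ := by
        refine ext_inner_left ℂ fun y => ?_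
        rw [ContinuousLinearMap.adjoint_inner_right]
        exact (h y y.2).symm
      change J (A χ) = _
      rw [this]
      rfl
    · rintro rfl
      refine ⟨A χ, (A χ).2, rfl, fun y hy => ?_⟩
      exact ContinuousLinearMap.adjoint_inner_right J ⟨y, hy⟩ χ
  rw [h1]
  have h2 : ∀ i, inner ℂ (b i) (R χ) = ((‖A (b i)‖ ^ 2 : ℝ) : ℂ) * inner ℂ (b i) χ := by
    intro i
    rw [hR, ← hR', hz, inner_smul_left, hzr, Complex.conj_ofReal]
  constructor
  · rintro rfl i
    rw [h2, ← mul_assoc, ← Complex.ofReal_mul, inv_mul_cancel₀ (hpos i), Complex.ofReal_one,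
      one_mul]
  · intro h
    refine HilbertBasis.eq_of_inner b fun i => ?_
    rw [h2, h i, ← mul_assoc, ← Complex.ofReal_mul, mul_inv_cancel₀ (hpos i), Complex.ofReal_one,
      one_mul]

end FormOperator

/-! ### Plane waves on (𝕋²)ⁿ and functions of a relative position -/

section Fourier

open Real in
theorem two_pi_complex_ne_zero : ((2 * π : ℝ) : ℂ) ≠ 0 :=
  Complex.ofReal_ne_zero.2 two_pi_pos.ne'

theorem integral_fourier (m : ℤ) :
    ∫ x : AddCircle (2 * Real.pi), fourier m x = if m = 0 then ((2 * Real.pi : ℝ) : ℂ) else 0 := by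
  split_ifs with h
  · subst h
    simp only [fourier_zero, integral_const]
    rw [Measure.real, AddCircle.measure_univ, ENNReal.toReal_ofReal Real.two_pi_pos.le]
    simp
  · exact integral_eq_zero_of_add_right_eq_neg (fourier_add_half_inv_index h Real.two_pi_pos)

theorem integral_conj_mode_mul_mode (k l : Mom) :
    ∫ x : Torus, conj (mode k x) * mode l x = if k = l then 1 else 0 := by
  have h : ∀ x : Torus, conj (mode k x) * mode l x =
      ∏ a, (((2 * Real.pi : ℝ) : ℂ)⁻¹ * fourier (l a - k a) (x a)) := by
    intro x
    have h1 : ∀ a, fourier (l a - k a) (x a) =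
        conj (fourier (k a) (x a)) * fourier (l a) (x a) := by
      intro a
      rw [sub_eq_neg_add, fourier_add, fourier_neg]
    simp only [h1, mode, ContinuousMap.coe_mk, map_mul, map_inv₀, Complex.conj_ofReal,
      Fin.prod_univ_two]
    ring
  simp only [h]
  rw [integral_fintype_prod_volume_eq_prod
    (f := fun (a : Fin 2) (y : AddCircle (2 * Real.pi)) =>
      ((2 * Real.pi : ℝ) : ℂ)⁻¹ * fourier (l a - k a) y)]
  simp only [integral_const_mul, integral_fourier, sub_eq_zero, mul_ite, mul_zero]
  rw [inv_mul_cancel₀ two_pi_complex_ne_zero]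
  rw [Finset.prod_ite_zero]
  simp only [Finset.mem_univ, forall_const, Finset.prod_const_one, funext_iff, eq_comm]

theorem continuous_planeWave {n : ℕ} (K : Fin n → Mom) : Continuous (planeWave K) := by
  unfold planeWave
  fun_prop

theorem integral_conj_planeWave_mul_planeWave {n : ℕ} (K L : Fin n → Mom) :
    ∫ X : Conf n, conj (planeWave K X) * planeWave L X = if K = L then 1 else 0 := by
  have h : ∀ X : Conf n, conj (planeWave K X) * planeWave L X =
      ∏ j, (conj (mode (K j) (X j)) * mode (L j) (X j)) := by
    intro X
    simp only [planeWave, map_prod, Finset.prod_mul_distrib]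
  simp only [h]
  rw [integral_fintype_prod_volume_eq_prod
    (f := fun (j : Fin n) (y : Torus) => conj (mode (K j) y) * mode (L j) y)]
  simp only [integral_conj_mode_mul_mode]
  rw [Finset.prod_ite_zero]
  simp only [Finset.mem_univ, forall_const, Finset.prod_const_one, funext_iff]

/-- The plane waves as continuous functions. -/
def planeWaveC {n : ℕ} (K : Fin n → Mom) : C(Conf n, ℂ) := ⟨planeWave K, continuous_planeWave K⟩

/-- The plane waves as elements of `L²`. -/
def planeWaveLp {n : ℕ} (K : Fin n → Mom) : L2 n :=
  ContinuousMap.toLp (E := ℂ) 2 (volume : Measure (Conf n)) ℂ (planeWaveC K)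

theorem coeFn_planeWaveLp {n : ℕ} (K : Fin n → Mom) : planeWaveLp K =ᵐ[volume] planeWave K :=
  ContinuousMap.coeFn_toLp volume (planeWaveC K)

theorem orthonormal_planeWaveLp (n : ℕ) : Orthonormal ℂ (planeWaveLp (n := n)) := by
  rw [orthonormal_iff_ite]
  intro K L
  rw [planeWaveLp, planeWaveLp, ContinuousMap.inner_toLp, ← integral_conj_planeWave_mul_planeWave]
  congr 1
  ext X
  exact mul_comm _ _

/-- The characters of `(𝕋²)ⁿ`. -/
def character {n : ℕ} (K : Fin n → Mom) : C(Conf n, ℂ) :=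
  ⟨fun X => ∏ j, ∏ a, fourier (K j a) (X j a), by fun_prop⟩

theorem planeWave_eq_character {n : ℕ} (K : Fin n → Mom) (X : Conf n) :
    planeWave K X = (((2 * Real.pi : ℝ) : ℂ)⁻¹) ^ n * character K X := by
  simp [planeWave, mode, character, Finset.prod_mul_distrib]

theorem character_add {n : ℕ} (K L : Fin n → Mom) (X : Conf n) :
    character (K + L) X = character K X * character L X := by
  simp only [character, ContinuousMap.coe_mk, Pi.add_apply, fourier_add, Finset.prod_mul_distrib]

theorem character_neg {n : ℕ} (K : Fin n → Mom) (X : Conf n) :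
    character (-K) X = conj (character K X) := by
  simp only [character, ContinuousMap.coe_mk, Pi.neg_apply, fourier_neg, map_prod]

theorem character_zero {n : ℕ} (X : Conf n) : character (0 : Fin n → Mom) X = 1 := by
  simp [character]

/-- The algebra of trigonometric polynomials. -/
def trigPoly (n : ℕ) : StarSubalgebra ℂ C(Conf n, ℂ) where
  toSubalgebra := Algebra.adjoin ℂ (Set.range character)
  star_mem' := by
    change Algebra.adjoin ℂ (Set.range character) ≤ star (Algebra.adjoin ℂ (Set.range character))
    refine Algebra.adjoin_le ?_
    rintro _ ⟨K, rfl⟩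
    refine Algebra.subset_adjoin ⟨-K, ?_⟩
    ext1 X
    simp only [character_neg, starRingEnd_apply, ContinuousMap.star_apply]

/-- Products of characters are characters, so the generated algebra is only their linear span. -/
theorem trigPoly_coe (n : ℕ) :
    Subalgebra.toSubmodule (trigPoly n).toSubalgebra = Submodule.span ℂ (Set.range character) := by
  apply Algebra.adjoin_eq_span_of_subset
  refine .trans (fun x ↦ Submonoid.closure_induction (fun _ ↦ id) ⟨0, ?_⟩ ?_) Submodule.subset_span
  · ext X
    simp only [character_zero, ContinuousMap.one_apply]
  · rintro _ _ _ _ ⟨K, rfl⟩ ⟨L, rfl⟩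
    refine ⟨K + L, ?_⟩
    ext X
    simp only [character_add, ContinuousMap.mul_apply]

theorem character_single {n : ℕ} (j : Fin n) (a : Fin 2) (X : Conf n) :
    character (Pi.single j (Pi.single a 1)) X = fourier 1 (X j a) := by
  change ∏ j', ∏ a', fourier ((Pi.single j (Pi.single a 1) : Fin n → Mom) j' a') (X j' a') = _
  rw [Finset.prod_eq_single j, Finset.prod_eq_single a]
  · rw [Pi.single_eq_same, Pi.single_eq_same]
  · intro a' _ h
    rw [Pi.single_eq_same, Pi.single_eq_of_ne h, fourier_zero]
  · simp
  · intro j' _ h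
    rw [Pi.single_eq_of_ne h]
    simp
  · simp

theorem trigPoly_separatesPoints (n : ℕ) : (trigPoly n).SeparatesPoints := by
  intro X Y hXY
  rw [Ne, funext_iff, not_forall] at hXY
  obtain ⟨j, hj⟩ := hXY
  rw [funext_iff, not_forall] at hj
  obtain ⟨a, ha⟩ := hj
  refine ⟨_, ⟨character (Pi.single j (Pi.single a 1)),
    Algebra.subset_adjoin ⟨_, rfl⟩, rfl⟩, ?_⟩
  dsimp only
  rw [character_single, character_single, fourier_one, fourier_one]
  intro h
  exact ha (AddCircle.injective_toCircle Real.two_pi_pos.ne' (Circle.ext h))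

theorem span_character_closure_eq_top (n : ℕ) :
    (Submodule.span ℂ (Set.range (character (n := n)))).topologicalClosure = ⊤ := by
  rw [← trigPoly_coe]
  exact congr_arg (Subalgebra.toSubmodule <| StarSubalgebra.toSubalgebra ·)
    (ContinuousMap.starSubalgebra_topologicalClosure_eq_top_of_separatesPoints _
      (trigPoly_separatesPoints n))

/-- Stone–Weierstrass gives density in the uniform norm, and continuous functions are dense in L².
-/
theorem span_planeWaveLp_closure_eq_top (n : ℕ) :
    (Submodule.span ℂ (Set.range (planeWaveLp (n := n)))).topologicalClosure = ⊤ := by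
  have h1 : Submodule.span ℂ (Set.range (character (n := n))) ≤
      Submodule.span ℂ (Set.range (planeWaveC (n := n))) := by
    rw [Submodule.span_le]
    rintro _ ⟨K, rfl⟩
    have : character K = (((2 * Real.pi : ℝ) : ℂ)) ^ n • planeWaveC K := by
      ext X
      change _ = _ * planeWave K X
      rw [planeWave_eq_character, ← mul_assoc, ← mul_pow, mul_inv_cancel₀ two_pi_complex_ne_zero,
        one_pow, one_mul]
    rw [this]
    exact Submodule.smul_mem _ _ (Submodule.subset_span ⟨K, rfl⟩)
  have h2 : (Submodule.span ℂ (Set.range (planeWaveC (n := n)))).topologicalClosure = ⊤ := by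
    rw [eq_top_iff, ← span_character_closure_eq_top]
    exact Submodule.topologicalClosure_mono h1
  have h3 := (ContinuousMap.toLp_denseRange ℂ (volume : Measure (Conf n)) ℂ
    (p := 2) (by simp)).topologicalClosure_map_submodule h2
  rw [Submodule.map_span, ← Set.range_comp] at h3
  exact h3

/-- The Hilbert basis of plane waves of `L²((𝕋²)ⁿ)`. -/
def planeWaveBasis (n : ℕ) : HilbertBasis (Fin n → Mom) ℂ (L2 n) :=
  HilbertBasis.mk (orthonormal_planeWaveLp n) (span_planeWaveLp_closure_eq_top n).ge

theorem planeWaveBasis_apply {n : ℕ} (K : Fin n → Mom) : planeWaveBasis n K = planeWaveLp K := by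
  rw [planeWaveBasis, HilbertBasis.coe_mk]

theorem inner_planeWaveLp {n : ℕ} (K : Fin n → Mom) (f : L2 n) :
    inner ℂ (planeWaveLp K) f = ∫ X, conj (planeWave K X) * f X := by
  rw [MeasureTheory.L2.inner_def]
  apply integral_congr_ae
  filter_upwards [coeFn_planeWaveLp K] with X hX
  rw [hX, RCLike.inner_apply, mul_comm]

theorem coeff_eq_inner {n : ℕ} (ψ : Sector n) (K : Fin n → Mom) :
    coeff ψ K = inner ℂ (planeWaveBasis n K) (ψ : L2 n) := by
  rw [planeWaveBasis_apply, inner_planeWaveLp]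
  rfl

theorem hasSum_coeff_inner {n : ℕ} (φ ψ : Sector n) :
    HasSum (fun K => conj (coeff φ K) * coeff ψ K) (inner ℂ φ ψ) := by
  refine ((planeWaveBasis n).hasSum_inner_mul_inner (φ : L2 n) (ψ : L2 n)).congr_summand fun K => ?_
  rw [coeff_eq_inner, coeff_eq_inner, inner_conj_symm]

theorem hasSum_coeff_norm_sq {n : ℕ} (ψ : Sector n) :
    HasSum (fun K => ‖coeff ψ K‖ ^ 2) (‖ψ‖ ^ 2) := by
  refine (HilbertBasis.hasSum_norm_sq (planeWaveBasis n) (ψ : L2 n)).congr_summand fun K => ?_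
  rw [coeff_eq_inner]

theorem mem_symSubspace {n : ℕ} {f : L2 n} :
    f ∈ symSubspace n ↔ ∀ σ : Equiv.Perm (Fin n), permAction σ f = f := by
  simp [symSubspace, LinearMap.mem_eqLocus]

theorem coeFn_permAction {n : ℕ} (σ : Equiv.Perm (Fin n)) (f : L2 n) :
    permAction σ f =ᵐ[volume] fun X => f fun i => X (σ i) :=
  Lp.coeFn_compMeasurePreserving f (measurePreserving_perm σ)

theorem wave_perm {n : ℕ} (ψ : Sector n) (σ : Equiv.Perm (Fin n)) :
    (fun X : Conf n => wave ψ fun i => X (σ i)) =ᵐ[volume] wave ψ := by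
  have h := coeFn_permAction σ (ψ : L2 n)
  rw [mem_symSubspace.1 ψ.2 σ] at h
  exact h.symm

theorem planeWave_perm {n : ℕ} (K : Fin n → Mom) (σ : Equiv.Perm (Fin n)) (X : Conf n) :
    planeWave (fun i => K (σ i)) (fun i => X (σ i)) = planeWave K X :=
  Equiv.prod_comp σ fun j => mode (K j) (X j)

instance (n : ℕ) : BorelSpace (Conf n) := Pi.borelSpace

instance : Measure.IsAddHaarMeasure (volume : Measure Torus) :=
  Measure.pi.isAddHaarMeasure fun _ : Fin 2 => (volume : Measure (AddCircle (2 * Real.pi)))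

instance (n : ℕ) : Measure.IsAddHaarMeasure (volume : Measure (Conf n)) :=
  Measure.pi.isAddHaarMeasure fun _ : Fin n => (volume : Measure Torus)

theorem measurableEmbedding_perm {n : ℕ} (σ : Equiv.Perm (Fin n)) :
    MeasurableEmbedding (fun X : Conf n => fun i => X (σ i)) :=
  Homeomorph.measurableEmbedding (γ := Conf n) (γ₂ := Conf n)
    { toFun := fun X i => X (σ i)
      invFun := fun X i => X (σ.symm i)
      left_inv := fun X => by simp
      right_inv := fun X => by simp
      continuous_toFun := by fun_prop
      continuous_invFun := by fun_prop }

theorem coeff_perm {n : ℕ} (ψ : Sector n) (σ : Equiv.Perm (Fin n)) (K : Fin n → Mom) :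
    coeff ψ (fun i => K (σ i)) = coeff ψ K := by
  unfold coeff
  rw [← (measurePreserving_perm σ).integral_comp (measurableEmbedding_perm σ)]
  apply integral_congr_ae
  filter_upwards [wave_perm ψ σ] with X hX
  rw [hX, planeWave_perm]

/-- The relative position `xᵢ - xⱼ` as a homomorphism. -/
def relPos {n : ℕ} (i j : Fin n) : Conf n →+ Torus :=
  Pi.evalAddMonoidHom (fun _ : Fin n => Torus) i - Pi.evalAddMonoidHom (fun _ : Fin n => Torus) j

theorem relPos_apply {n : ℕ} (i j : Fin n) (X : Conf n) : relPos i j X = X i - X j := rfl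

theorem continuous_relPos {n : ℕ} (i j : Fin n) : Continuous (relPos i j) := by
  have : (relPos i j : Conf n → Torus) = fun X => X i - X j := rfl
  rw [this]
  fun_prop

/-- The image of Haar measure under a surjective continuous homomorphism of compact groups is again
a Haar measure, hence a finite multiple of Lebesgue measure on the torus. The value of the multiple
is never needed. -/
theorem exists_map_relPos {n : ℕ} {i j : Fin n} (hij : i ≠ j) :
    ∃ c : ℝ≥0∞, c ≠ ∞ ∧ Measure.map (relPos i j) volume = c • (volume : Measure Torus) := by
  have hs : Function.Surjective (relPos i j) := by
    intro y
    refine ⟨Pi.single i y, ?_⟩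
    rw [relPos_apply, Pi.single_eq_same, Pi.single_eq_of_ne hij.symm, sub_zero]
  have := Measure.isAddHaarMeasure_map (volume : Measure (Conf n)) (relPos i j)
    (continuous_relPos i j) hs (by simp)
  exact ⟨_, ENNReal.coe_ne_top, Measure.isAddLeftInvariant_eq_smul _ _⟩

theorem quasiMeasurePreserving_relPos {n : ℕ} {i j : Fin n} (hij : i ≠ j) :
    Measure.QuasiMeasurePreserving (relPos i j) volume volume := by
  obtain ⟨c, _, h⟩ := exists_map_relPos hij
  refine ⟨(continuous_relPos i j).measurable, ?_⟩
  rw [h]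
  exact Measure.smul_absolutelyContinuous

theorem memLp_comp_relPos {n : ℕ} {i j : Fin n} (hij : i ≠ j) {f : Torus → ℂ} {p : ℝ≥0∞}
    (hf : MemLp f p volume) : MemLp (fun X : Conf n => f (X i - X j)) p volume := by
  obtain ⟨c, hc, h⟩ := exists_map_relPos hij
  refine MemLp.comp_of_map (f := relPos i j) ?_ (continuous_relPos i j).aemeasurable
  rw [h]
  exact hf.smul_measure hc

theorem integral_norm_comp_relPos {n : ℕ} {i j : Fin n} (hij : i ≠ j) :
    ∃ c : ℝ, ∀ f : Torus → ℂ, AEStronglyMeasurable f volume →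
      ∫ X : Conf n, ‖f (X i - X j)‖ = c * ∫ x, ‖f x‖ := by
  obtain ⟨c, hc, h⟩ := exists_map_relPos hij
  refine ⟨c.toReal, fun f hf => ?_⟩
  have h1 := integral_map (μ := (volume : Measure (Conf n))) (φ := relPos i j)
    (f := fun x => ‖f x‖) (continuous_relPos i j).aemeasurable (by
      rw [h]; exact hf.norm.smul_measure c)
  rw [h, integral_smul_measure] at h1
  exact h1.symm

/-- Integration of `f(xᵢ - xⱼ)` against a bounded function is `L²`-continuous in `f`. -/
theorem exists_relPos_functional {n : ℕ} {i j : Fin n} (hij : i ≠ j) (g : C(Conf n, ℂ)) :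
    ∃ Λ : Lp ℂ 2 (volume : Measure Torus) →L[ℂ] ℂ,
      ∀ f, Λ f = ∫ X : Conf n, f (X i - X j) * g X := by
  obtain ⟨c, hc⟩ := integral_norm_comp_relPos hij
  have hg : ∀ f : Lp ℂ 2 (volume : Measure Torus),
      Integrable (fun X : Conf n => f (X i - X j) * g X) := fun f =>
    ((memLp_comp_relPos hij (Lp.memLp f)).integrable (by norm_num)).mul_bdd (c := ‖g‖)
      g.continuous.aestronglyMeasurable (ae_of_all _ fun X => g.norm_coe_le_norm X)
  refine ⟨LinearMap.mkContinuous
    { toFun := fun f => ∫ X : Conf n, f (X i - X j) * g X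
      map_add' := fun f f' => by
        rw [← integral_add (hg f) (hg f')]
        apply integral_congr_ae
        filter_upwards [(quasiMeasurePreserving_relPos hij).ae (Lp.coeFn_add f f')] with X hX
        rw [relPos_apply] at hX
        rw [hX, Pi.add_apply, add_mul]
      map_smul' := fun z f => by
        rw [RingHom.id_apply, ← integral_smul]
        apply integral_congr_ae
        filter_upwards [(quasiMeasurePreserving_relPos hij).ae (Lp.coeFn_smul z f)] with X hX
        rw [relPos_apply] at hX
        rw [hX, Pi.smul_apply, smul_mul_assoc] }
    (‖g‖ * (|c| * ‖(Lp.const 2 (volume : Measure Torus) (1 : ℝ))‖)) fun f => ?_, fun f => rfl⟩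
  -- Cauchy–Schwarz against the constant function 1.
  have h1 : ∫ x, ‖f x‖ ≤ ‖(Lp.const 2 (volume : Measure Torus) (1 : ℝ))‖ * ‖f‖ := by
    have h2 := norm_inner_le_norm (𝕜 := ℝ) (Lp.const 2 (volume : Measure Torus) (1 : ℝ))
      ((Lp.memLp f).norm.toLp _)
    rw [MeasureTheory.L2.inner_def, Lp.norm_toLp, eLpNorm_norm, ← Lp.norm_def] at h2
    refine le_trans (le_trans (le_of_eq ?_) (le_abs_self _)) h2
    apply integral_congr_ae
    filter_upwards [(Lp.memLp f).norm.coeFn_toLp, Lp.coeFn_const 2 (volume : Measure Torus) (1:ℝ)]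
      with x hx hx1
    rw [hx, hx1]
    simp
  calc ‖∫ X : Conf n, f (X i - X j) * g X‖ ≤ ∫ X : Conf n, ‖f (X i - X j) * g X‖ :=
        norm_integral_le_integral_norm _
    _ ≤ ∫ X : Conf n, ‖f (X i - X j)‖ * ‖g‖ := by
        refine integral_mono (hg f).norm
          (((memLp_comp_relPos hij (Lp.memLp f)).integrable (by norm_num)).norm.mul_const _)
          fun X => ?_
        rw [norm_mul]
        gcongr
        exact g.norm_coe_le_norm X
    _ = ‖g‖ * (c * ∫ x, ‖f x‖) := by
        rw [integral_mul_const, hc _ (Lp.aestronglyMeasurable f), mul_comm]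
    _ ≤ ‖g‖ * (|c| * (‖(Lp.const 2 (volume : Measure Torus) (1 : ℝ))‖ * ‖f‖)) := by
        gcongr
        · exact le_abs_self c
    _ = _ := by ring

end Fourier

/-! ### Fourier series of the potential and the heat kernel of the circle -/

section Potential

theorem normSq_nonneg (k : Mom) : 0 ≤ normSq k := Finset.sum_nonneg fun _ _ => sq_nonneg _

theorem besselCoeff_pos (β : ℝ) (k : Mom) : 0 < besselCoeff β k :=
  Real.rpow_pos_of_pos (by linarith [normSq_nonneg k]) _

/-- The squares are bounded by the power -2β of the sup norm of `k` away from the origin, which is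
summable over ℤ² exactly because 2β > 2. -/
theorem summable_besselCoeff_sq {β : ℝ} (hβ : 1 < β) : Summable fun k => besselCoeff β k ^ 2 := by
  have h := EisensteinSeries.summable_one_div_norm_rpow (k := 2 * β) (by linarith)
  refine h.of_norm_bounded_eventually ?_
  filter_upwards [(Set.finite_singleton (0 : Mom)).compl_mem_cofinite] with k hk
  have hk : k ≠ 0 := hk
  have hk' : 0 < ‖k‖ := norm_pos_iff.2 hk
  have h1 : ‖k‖ ^ 2 ≤ 1 + normSq k := by
    have : ‖k‖ ≤ Real.sqrt (normSq k) := by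
      rw [pi_norm_le_iff_of_nonneg (Real.sqrt_nonneg _)]
      intro a
      apply Real.le_sqrt_of_sq_le
      rw [Int.norm_eq_abs, sq_abs]
      exact Finset.single_le_sum (f := fun a => (k a : ℝ) ^ 2) (fun _ _ => sq_nonneg _)
        (Finset.mem_univ a)
    have h2 := Real.sq_sqrt (normSq_nonneg k)
    have h3 : ‖k‖ ^ 2 ≤ Real.sqrt (normSq k) ^ 2 := by gcongr
    linarith
  rw [Real.norm_of_nonneg (by positivity), besselCoeff, ← Real.rpow_natCast,
    ← Real.rpow_mul (by linarith [normSq_nonneg k])]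
  have h3 : -β / 2 * ((2 : ℕ) : ℝ) = -β := by push_cast; ring
  rw [h3]
  calc (1 + normSq k) ^ (-β) ≤ (‖k‖ ^ 2) ^ (-β) :=
        Real.rpow_le_rpow_of_nonpos (by positivity) h1 (by linarith)
    _ = ‖k‖ ^ (-(2 * β)) := by
        rw [← Real.rpow_natCast, ← Real.rpow_mul hk'.le]
        congr 1
        push_cast; ring

/-- The plane waves as elements of `L²` of the torus. -/
def modeLp (k : Mom) : Lp ℂ 2 (volume : Measure Torus) :=
  ContinuousMap.toLp (E := ℂ) 2 (volume : Measure Torus) ℂ (mode k)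

theorem orthonormal_modeLp : Orthonormal ℂ modeLp := by
  rw [orthonormal_iff_ite]
  intro K L
  rw [modeLp, modeLp, ContinuousMap.inner_toLp, ← integral_conj_mode_mul_mode]
  congr 1
  ext X
  exact mul_comm _ _

theorem hasSum_besselPotential {β : ℝ} (hβ : 1 < β) :
    HasSum (fun k : Mom => (((2 * Real.pi)⁻¹ * besselCoeff β k : ℝ) : ℂ) • modeLp k)
      (besselPotential β) := by
  have h1 : Summable fun k : Mom => ‖(((2 * Real.pi)⁻¹ * besselCoeff β k : ℝ) : ℂ)‖ ^ 2 := by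
    simp only [Complex.norm_real, Real.norm_eq_abs, sq_abs, mul_pow]
    exact (summable_besselCoeff_sq hβ).mul_left _
  have h2 := (orthonormal_modeLp.orthogonalFamily.summable_iff_norm_sq_summable
    fun k : Mom => (((2 * Real.pi)⁻¹ * besselCoeff β k : ℝ) : ℂ)).2 h1
  simp only [LinearIsometry.toSpanSingleton_apply] at h2
  exact h2.hasSum

/-- The series of the potential converges in L² only, so it is tested against indicator functions,
which act as continuous functionals. -/
theorem hasSum_setIntegral_besselPotential {β : ℝ} (hβ : 1 < β) {A : Set Torus}
    (hA : MeasurableSet A) :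
    HasSum (fun k : Mom => (((2 * Real.pi)⁻¹ * besselCoeff β k : ℝ) : ℂ) * ∫ x in A, mode k x)
      (∫ x in A, besselPotential β x) := by
  have h := (hasSum_besselPotential hβ).mapL
    (innerSL ℂ (indicatorConstLp 2 hA (measure_ne_top volume A) (1 : ℂ)))
  have h1 : ∀ f : Lp ℂ 2 (volume : Measure Torus),
      innerSL ℂ (indicatorConstLp 2 hA (measure_ne_top volume A) (1 : ℂ)) f = ∫ x in A, f x :=
    fun f => L2.inner_indicatorConstLp_one hA _ f
  rw [h1] at h
  refine h.congr_summand fun k => ?_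
  rw [map_smul, h1, smul_eq_mul]
  congr 1
  apply integral_congr_ae
  filter_upwards [ae_restrict_of_ae (ContinuousMap.coeFn_toLp (p := 2) (𝕜 := ℂ) volume (mode k))]
    with x hx
  exact hx.symm

/-! ### Positivity of the heat kernel -/

theorem summable_exp_neg_mul_sq {s : ℝ} (hs : 0 < s) :
    Summable fun m : ℤ => Real.exp (-(s * (m : ℝ) ^ 2)) := by
  have h := ((summable_jacobiTheta₂_term_iff 0 (Complex.I * (s / Real.pi : ℝ))).2 (by
    simp; positivity)).norm
  refine h.congr fun m => ?_
  rw [norm_jacobiTheta₂_term]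
  congr 1
  simp
  field_simp

/-- The heat kernel of the circle, up to normalization. -/
def circleHeat (s : ℝ) (x : AddCircle (2 * Real.pi)) : ℂ :=
  ∑' m : ℤ, (Real.exp (-(s * (m : ℝ) ^ 2)) : ℂ) * fourier m x

theorem norm_fourier_apply (m : ℤ) (x : AddCircle (2 * Real.pi)) : ‖fourier m x‖ = 1 := by
  rw [fourier_apply, Circle.norm_coe]

theorem summable_circleHeat {s : ℝ} (hs : 0 < s) (x : AddCircle (2 * Real.pi)) :
    Summable fun m : ℤ => ‖(Real.exp (-(s * (m : ℝ) ^ 2)) : ℂ) * fourier m x‖ := by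
  refine (summable_exp_neg_mul_sq hs).congr fun m => ?_
  rw [norm_mul, norm_fourier_apply, Complex.norm_real, Real.norm_of_nonneg (Real.exp_pos _).le,
    mul_one]

theorem circleHeat_eq_jacobiTheta₂ {s : ℝ} (x : ℝ) :
    circleHeat s (x : AddCircle (2 * Real.pi)) =
      jacobiTheta₂ ((x / (2 * Real.pi) : ℝ) : ℂ) (Complex.I * (s / Real.pi : ℝ)) := by
  unfold circleHeat jacobiTheta₂ jacobiTheta₂_term
  congr 1
  ext m
  rw [fourier_coe_apply, Complex.ofReal_exp, ← Complex.exp_add]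
  congr 1
  have : (Real.pi : ℂ) ≠ 0 := Complex.ofReal_ne_zero.2 Real.pi_ne_zero
  push_cast
  field_simp
  linear_combination (-(s * m ^ 2 : ℂ)) * Complex.I_sq

/-- The functional equation of the theta function (Poisson summation) rewrites the oscillating
series as a positive prefactor times a series of real exponentials. -/
theorem circleHeat_nonneg {s : ℝ} (hs : 0 < s) (x : AddCircle (2 * Real.pi)) :
    ∃ r : ℝ, 0 ≤ r ∧ circleHeat s x = r := by
  induction x using QuotientAddGroup.induction_on with
  | H x =>
  have hpi : (Real.pi : ℂ) ≠ 0 := Complex.ofReal_ne_zero.2 Real.pi_ne_zero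
  have hs' : (s : ℂ) ≠ 0 := Complex.ofReal_ne_zero.2 hs.ne'
  rw [circleHeat_eq_jacobiTheta₂, jacobiTheta₂_functional_equation]
  have h1 : (1 : ℂ) / (-Complex.I * (Complex.I * (s / Real.pi : ℝ))) ^ (1 / 2 : ℂ) =
      ((1 / (s / Real.pi) ^ (1 / 2 : ℝ) : ℝ) : ℂ) := by
    have : -Complex.I * (Complex.I * ((s / Real.pi : ℝ) : ℂ)) = ((s / Real.pi : ℝ) : ℂ) := by
      rw [← mul_assoc, neg_mul, Complex.I_mul_I, neg_neg, one_mul]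
    rw [this, Complex.ofReal_div (1 : ℝ), Complex.ofReal_cpow (by positivity)]
    push_cast
    rfl
  have h2 : Complex.exp (-Real.pi * Complex.I * ((x / (2 * Real.pi) : ℝ) : ℂ) ^ 2 /
      (Complex.I * (s / Real.pi : ℝ))) =
      ((Real.exp (-(Real.pi ^ 2 * (x / (2 * Real.pi)) ^ 2 / s)) : ℝ) : ℂ) := by
    rw [Complex.ofReal_exp]
    congr 1
    push_cast
    field_simp
  have h3 : jacobiTheta₂ (((x / (2 * Real.pi) : ℝ) : ℂ) / (Complex.I * (s / Real.pi : ℝ)))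
      (-1 / (Complex.I * (s / Real.pi : ℝ))) =
      ((∑' m : ℤ, Real.exp (Real.pi * m * x / s - Real.pi ^ 2 * m ^ 2 / s) : ℝ) : ℂ) := by
    unfold jacobiTheta₂ jacobiTheta₂_term
    rw [Complex.ofReal_tsum]
    congr 1
    ext m
    rw [Complex.ofReal_exp]
    congr 1
    push_cast
    field_simp
    ring
  rw [h1, h2, h3, ← Complex.ofReal_mul, ← Complex.ofReal_mul]
  refine ⟨_, ?_, rfl⟩
  have : 0 ≤ ∑' m : ℤ, Real.exp (Real.pi * m * x / s - Real.pi ^ 2 * m ^ 2 / s) :=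
    tsum_nonneg fun _ => (Real.exp_pos _).le
  positivity

/-- All modes except m = 0 carry m² ≥ 1, so their sum is at most e^(-(s-1)) Σ e^(-m²). This is at
most 1/2 once s ≥ 1 + 2C, since e^(s-1) ≥ s. -/
theorem exists_circleHeat_re_ge :
    ∃ s₀ : ℝ, 0 < s₀ ∧ ∀ s, s₀ ≤ s → ∀ x, 1 / 2 ≤ (circleHeat s x).re := by
  set C : ℝ := ∑' m : ℤ, Real.exp (-(1 * (m : ℝ) ^ 2)) with hC
  have hsC := summable_exp_neg_mul_sq one_pos
  have hC0 : 0 ≤ C := tsum_nonneg fun _ => (Real.exp_pos _).le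
  refine ⟨1 + 2 * C, by linarith, fun s hs x => ?_⟩
  have hs1 : 1 ≤ s := by linarith
  have hs0 : 0 < s := by linarith
  have h1 := (summable_circleHeat hs0 x).of_norm
  have h2 : circleHeat s x - 1 = ∑' m : ℤ, if m = 0 then 0 else
      (Real.exp (-(s * (m : ℝ) ^ 2)) : ℂ) * fourier m x := by
    rw [circleHeat, h1.tsum_eq_add_tsum_ite 0]
    simp
  have h3 : ‖circleHeat s x - 1‖ ≤ Real.exp (-(s - 1)) * C := by
    rw [h2]
    refine tsum_of_norm_bounded (hsC.hasSum.mul_left _) fun m => ?_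
    split_ifs with hm
    · rw [norm_zero]; positivity
    · rw [norm_mul, norm_fourier_apply, Complex.norm_real, Real.norm_of_nonneg (Real.exp_pos _).le,
        mul_one, ← Real.exp_add]
      apply Real.exp_le_exp.2
      have : (1 : ℝ) ≤ (m : ℝ) ^ 2 := by
        have : 1 ≤ m ^ 2 := by have := sq_pos_of_ne_zero hm; omega
        exact_mod_cast this
      nlinarith
  have h4 : Real.exp (-(s - 1)) * C ≤ 1 / 2 := by
    have h5 : 2 * C ≤ Real.exp (s - 1) := by linarith [Real.add_one_le_exp (s - 1)]
    have h6 : Real.exp (-(s - 1)) * Real.exp (s - 1) = 1 := by rw [← Real.exp_add]; simp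
    nlinarith [Real.exp_pos (-(s - 1))]
  have h7 := (Complex.abs_re_le_norm (circleHeat s x - 1)).trans (h3.trans h4)
  rw [abs_le] at h7
  simp only [Complex.sub_re, Complex.one_re] at h7
  linarith

end Potential

/-! ### The potential is bounded below by a positive constant -/

section Positivity

/-- A finite set of tuples lies in the product of its coordinate projections, over which the sum
factorizes. -/
theorem sum_prod_le_tsum_pow {α : Type*} {f : α → ℝ} (h0 : ∀ a, 0 ≤ f a) (hf : Summable f) {n : ℕ}
    (s : Finset (Fin n → α)) : ∑ K ∈ s, ∏ j, f (K j) ≤ (∑' a, f a) ^ n := by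
  classical
  let t : Fin n → Finset α := fun j => s.image fun K => K j
  have hs : s ⊆ Fintype.piFinset t := by
    intro K hK
    rw [Fintype.mem_piFinset]
    exact fun j => Finset.mem_image_of_mem _ hK
  calc ∑ K ∈ s, ∏ j, f (K j) ≤ ∑ K ∈ Fintype.piFinset t, ∏ j, f (K j) :=
        Finset.sum_le_sum_of_subset_of_nonneg hs fun K _ _ => Finset.prod_nonneg fun j _ => h0 _
    _ = ∏ j, ∑ a ∈ t j, f a := (Finset.prod_univ_sum t fun _ a => f a).symm
    _ ≤ ∏ _j : Fin n, ∑' a, f a := by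
        refine Finset.prod_le_prod (fun j _ => Finset.sum_nonneg fun a _ => h0 a) fun j _ => ?_
        exact hf.sum_le_tsum _ fun a _ => h0 a
    _ = _ := by simp

theorem summable_prod_pi {α : Type*} {f : α → ℝ} (h0 : ∀ a, 0 ≤ f a) (hf : Summable f) (n : ℕ) :
    Summable fun K : Fin n → α => ∏ j, f (K j) :=
  summable_of_sum_le (fun _ => Finset.prod_nonneg fun _ _ => h0 _) (sum_prod_le_tsum_pow h0 hf)

theorem exp_neg_mul_normSq (s : ℝ) (k : Mom) :
    Real.exp (-(s * normSq k)) = ∏ a, Real.exp (-(s * (k a : ℝ) ^ 2)) := by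
  rw [← Real.exp_sum, normSq, Finset.mul_sum, Finset.sum_neg_distrib]

theorem summable_exp_neg_mul_normSq {s : ℝ} (hs : 0 < s) :
    Summable fun k : Mom => Real.exp (-(s * normSq k)) := by
  simp only [exp_neg_mul_normSq]
  exact summable_prod_pi (fun _ => (Real.exp_pos _).le) (summable_exp_neg_mul_sq hs) 2

theorem norm_mode_apply (k : Mom) (x : Torus) : ‖mode k x‖ = (2 * Real.pi)⁻¹ := by
  simp only [mode, ContinuousMap.coe_mk, norm_mul, norm_prod, norm_fourier_apply,
    Finset.prod_const_one, mul_one, norm_inv]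
  rw [Complex.norm_real, Real.norm_of_nonneg Real.two_pi_pos.le]

/-- The terms of the Fourier series of the circle heat kernel. -/
def circleHeatTerm (s : ℝ) (x : AddCircle (2 * Real.pi)) (m : ℤ) : ℂ :=
  (Real.exp (-(s * (m : ℝ) ^ 2)) : ℂ) * fourier m x

theorem hasSum_circleHeat_mul {s : ℝ} (hs : 0 < s) (x y : AddCircle (2 * Real.pi)) :
    HasSum (fun p : ℤ × ℤ => circleHeatTerm s x p.1 * circleHeatTerm s y p.2)
      (circleHeat s x * circleHeat s y) := by
  have h1 : Summable fun m => ‖circleHeatTerm s x m‖ := summable_circleHeat hs x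
  have h2 : Summable fun m => ‖circleHeatTerm s y m‖ := summable_circleHeat hs y
  have h3 : HasSum (circleHeatTerm s x) (circleHeat s x) := h1.of_norm.hasSum
  have h4 : HasSum (circleHeatTerm s y) (circleHeat s y) := h2.of_norm.hasSum
  exact h3.mul h4 (summable_mul_of_summable_norm h1 h2)

theorem hasSum_torusHeat {s : ℝ} (hs : 0 < s) (x : Torus) :
    HasSum (fun k : Mom => (Real.exp (-(s * normSq k)) : ℂ) * mode k x)
      (((2 * Real.pi : ℝ) : ℂ)⁻¹ * (circleHeat s (x 0) * circleHeat s (x 1))) := by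
  have h3 := ((finTwoArrowEquiv ℤ).hasSum_iff.2 (hasSum_circleHeat_mul hs (x 0) (x 1))).mul_left
    (((2 * Real.pi : ℝ) : ℂ)⁻¹)
  refine h3.congr_summand fun k => ?_
  change _ * (_ * ∏ a, fourier (k a) (x a)) =
    _ * (circleHeatTerm s (x 0) (k 0) * circleHeatTerm s (x 1) (k 1))
  rw [exp_neg_mul_normSq, Fin.prod_univ_two]
  rw [Fin.prod_univ_two, Complex.ofReal_mul, circleHeatTerm, circleHeatTerm]
  ring

/-- The torus kernel is (2π)⁻¹ times the product of two circle kernels, each at least 1/2 for s ≥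
s₀; hence the bound (2π)⁻¹ · 1/4 = (8π)⁻¹. The threshold does not depend on the set. -/
theorem exists_hasSum_heat_setIntegral :
    ∃ s₀ : ℝ, 0 < s₀ ∧ ∀ (A : Set Torus) (s : ℝ), 0 < s → ∃ r : ℝ, 0 ≤ r ∧
      (s₀ ≤ s → (8 * Real.pi)⁻¹ * volume.real A ≤ r) ∧
      HasSum (fun k : Mom => (Real.exp (-(s * normSq k)) : ℂ) * ∫ x in A, mode k x) (r : ℂ) := by
  obtain ⟨s₀, hs₀, hge⟩ := exists_circleHeat_re_ge
  refine ⟨s₀, hs₀, fun A s hs => ?_⟩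
  choose r hr0 hr using circleHeat_nonneg hs
  have hint : ∀ k : Mom, Integrable (fun x => (Real.exp (-(s * normSq k)) : ℂ) * mode k x)
      (volume.restrict A) := fun k =>
    (((mode k).continuous.integrable_of_hasCompactSupport
      (HasCompactSupport.of_compactSpace _)).restrict).const_mul _
  have hsum := hasSum_integral_of_summable_integral_norm hint (by
    have : ∀ k : Mom, ∀ x : Torus, ‖(Real.exp (-(s * normSq k)) : ℂ) * mode k x‖ =
        Real.exp (-(s * normSq k)) * (2 * Real.pi)⁻¹ := by
      intro k x
      rw [norm_mul, norm_mode_apply, Complex.norm_real, Real.norm_of_nonneg (Real.exp_pos _).le]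
    simp only [this, integral_const, smul_eq_mul]
    exact ((summable_exp_neg_mul_normSq hs).mul_right _).mul_left _)
  have htot : ∀ x : Torus, ∑' k : Mom, (Real.exp (-(s * normSq k)) : ℂ) * mode k x =
      (((2 * Real.pi)⁻¹ * (r (x 0) * r (x 1)) : ℝ) : ℂ) := by
    intro x
    rw [(hasSum_torusHeat hs x).tsum_eq, hr, hr]
    push_cast
    rfl
  simp only [integral_const_mul, htot] at hsum
  rw [integral_complex_ofReal] at hsum
  refine ⟨_, integral_nonneg fun x => ?_, fun hss => ?_, hsum⟩
  · have := hr0 (x 0)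
    have := hr0 (x 1)
    have := Real.two_pi_pos
    simp only [Pi.zero_apply]
    positivity
  · have hrge : ∀ y, 1 / 2 ≤ r y := fun y => by
      have := hge s hss y
      rwa [hr, Complex.ofReal_re] at this
    have hcont : Continuous fun x : Torus => (2 * Real.pi)⁻¹ * (r (x 0) * r (x 1)) := by
      have h1 : Continuous fun x : Torus =>
          ∑' k : Mom, (Real.exp (-(s * normSq k)) : ℂ) * mode k x := by
        refine continuous_tsum (fun k => by fun_prop)
          ((summable_exp_neg_mul_normSq hs).mul_right (2 * Real.pi)⁻¹) fun k x => ?_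
        rw [norm_mul, norm_mode_apply, Complex.norm_real, Real.norm_of_nonneg (Real.exp_pos _).le]
      simp only [htot] at h1
      exact (Complex.continuous_re.comp h1).congr fun x => Complex.ofReal_re _
    have h1 : ∫ _x in A, (8 * Real.pi)⁻¹ ≤ ∫ x in A, (2 * Real.pi)⁻¹ * (r (x 0) * r (x 1)) := by
      refine integral_mono (integrable_const _) (hcont.integrable_of_hasCompactSupport
        (HasCompactSupport.of_compactSpace _)).restrict fun x => ?_
      have h2 : (1 / 2 : ℝ) * (1 / 2) ≤ r (x 0) * r (x 1) := by
        exact mul_le_mul (hrge _) (hrge _) (by norm_num) (hr0 _)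
      have h3 : (8 * Real.pi)⁻¹ = (2 * Real.pi)⁻¹ * (1 / 2 * (1 / 2)) := by
        field_simp
        norm_num
      dsimp only
      rw [h3]
      gcongr
    rw [setIntegral_const, smul_eq_mul, mul_comm] at h1
    exact h1

theorem integrableOn_rpow_mul_exp_neg {a r : ℝ} (ha : 0 < a) (hr : 0 < r) :
    IntegrableOn (fun s : ℝ => s ^ (a - 1) * Real.exp (-(r * s))) (Set.Ioi 0) := by
  have := integrableOn_rpow_mul_exp_neg_mul_rpow (p := 1) (s := a - 1) (b := r) (by linarith)
    one_pos hr
  simpa only [Real.rpow_one, neg_mul] using this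

/-- The set integrals of the potential are real and bounded below by a positive multiple of the
measure. -/
theorem exists_setIntegral_besselPotential {β : ℝ} (hβ : 1 < β) :
    ∃ c : ℝ, 0 < c ∧ ∀ A : Set Torus, MeasurableSet A → ∃ r : ℝ, c * volume.real A ≤ r ∧
      ∫ x in A, besselPotential β x = r := by
  obtain ⟨s₀, hs₀, hheat⟩ := exists_hasSum_heat_setIntegral
  have ha : 0 < β / 2 := by linarith
  have hG := Real.Gamma_pos_of_pos ha
  -- The weight of the times s > s₀ at which the kernel is known to be bounded below.
  set g : ℝ := ∫ s in Set.Ioi 0,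
    (Set.Ioi s₀).indicator (fun s => s ^ (β / 2 - 1) * Real.exp (-(1 * s))) s with hg
  have hgint : IntegrableOn (fun s : ℝ =>
      (Set.Ioi s₀).indicator (fun s => s ^ (β / 2 - 1) * Real.exp (-(1 * s))) s) (Set.Ioi 0) :=
    (integrableOn_rpow_mul_exp_neg ha one_pos).indicator measurableSet_Ioi
  have hgpos : 0 < g := by
    rw [hg, setIntegral_indicator measurableSet_Ioi, Set.Ioi_inter_Ioi, max_eq_right hs₀.le]
    have hi := (integrableOn_rpow_mul_exp_neg ha one_pos).mono_set (Set.Ioi_subset_Ioi hs₀.le)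
    rw [setIntegral_pos_iff_support_of_nonneg_ae _ hi]
    · have : Set.Ioi s₀ ⊆ Function.support (fun s : ℝ => s ^ (β / 2 - 1) * Real.exp (-(1 * s))) ∩
          Set.Ioi s₀ := fun s hs => by
        have hs' : 0 < s := hs₀.trans hs
        exact ⟨(mul_pos (Real.rpow_pos_of_pos hs' _) (Real.exp_pos _)).ne', hs⟩
      exact lt_of_lt_of_le (by simp) (measure_mono this)
    · filter_upwards [ae_restrict_mem measurableSet_Ioi] with s hs
      have hs' : 0 < s := hs₀.trans hs
      exact (mul_pos (Real.rpow_pos_of_pos hs' _) (Real.exp_pos _)).le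
  refine ⟨(2 * Real.pi)⁻¹ * (Real.Gamma (β / 2))⁻¹ * (g * (8 * Real.pi)⁻¹), by
    have := Real.pi_pos; positivity, fun A hA => ?_⟩
  set w : Mom → ℂ := fun k => ∫ x in A, mode k x with hw
  have hsv := hasSum_setIntegral_besselPotential hβ hA
  -- The series converges unconditionally in ℂ, hence absolutely. This replaces the absolute
  -- convergence that the Fourier series of the potential itself may lack.
  have hsb : Summable fun k => besselCoeff β k * ‖w k‖ := by
    have h1 := (hsv.mul_left ((2 * Real.pi : ℝ) : ℂ)).summable.norm
    refine h1.congr fun k => ?_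
    rw [← mul_assoc, ← Complex.ofReal_mul, norm_mul, Complex.norm_real, ← mul_assoc,
      mul_inv_cancel₀ Real.two_pi_pos.ne', one_mul, Real.norm_of_nonneg (besselCoeff_pos β k).le]
  have hgam : ∀ k, ∫ s in Set.Ioi 0, s ^ (β / 2 - 1) * Real.exp (-((1 + normSq k) * s)) =
      besselCoeff β k * Real.Gamma (β / 2) := by
    intro k
    have h1 : 0 < 1 + normSq k := by linarith [normSq_nonneg k]
    rw [Real.integral_rpow_mul_exp_neg_mul_Ioi ha h1, besselCoeff, one_div, Real.inv_rpow h1.le,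
      ← Real.rpow_neg h1.le, neg_div]
  -- `F k` is the Gamma integrand of the k-th coefficient. `D` carries the claimed lower bound,
  -- placed entirely in the term k = 0. A single exchange of sum and integral for `F - D` then gives
  -- both reality and the lower bound.
  let F : Mom → ℝ → ℂ := fun k s =>
    ((s ^ (β / 2 - 1) * Real.exp (-((1 + normSq k) * s)) : ℝ) : ℂ) * w k
  let D : Mom → ℝ → ℂ := fun k s => if k = 0 then (((Set.Ioi s₀).indicator
    (fun s => s ^ (β / 2 - 1) * Real.exp (-(1 * s))) s * ((8 * Real.pi)⁻¹ * volume.real A) : ℝ) : ℂ)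
    else 0
  have hFi : ∀ k, IntegrableOn (F k) (Set.Ioi 0) := fun k =>
    (integrableOn_rpow_mul_exp_neg ha (by linarith [normSq_nonneg k])).ofReal.mul_const _
  have hDi : ∀ k, IntegrableOn (D k) (Set.Ioi 0) := by
    intro k
    by_cases hk : k = 0
    · simp only [D, hk, if_true]
      exact (hgint.mul_const _).ofReal
    · simp only [D, hk, if_false]
      exact integrable_zero _ _ _
  have hFn : Summable fun k => ∫ s in Set.Ioi 0, ‖F k s‖ := by
    refine (hsb.mul_left (Real.Gamma (β / 2))).congr fun k => ?_
    have : ∫ s in Set.Ioi 0, ‖F k s‖ = ∫ s in Set.Ioi 0,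
        s ^ (β / 2 - 1) * Real.exp (-((1 + normSq k) * s)) * ‖w k‖ := by
      refine setIntegral_congr_fun measurableSet_Ioi fun s hs => ?_
      have hs' : 0 < s := hs
      simp only [F]
      rw [norm_mul, Complex.norm_real, Real.norm_of_nonneg (by positivity)]
    rw [this, integral_mul_const, hgam]
    ring
  have hDn : Summable fun k => ∫ s in Set.Ioi 0, ‖D k s‖ := by
    refine summable_of_ne_finset_zero (s := {0}) fun k hk => ?_
    have hk : k ≠ 0 := by simpa using hk
    simp [D, hk]
  have hsum := hasSum_integral_of_summable_integral_norm (μ := volume.restrict (Set.Ioi 0))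
    (F := fun k s => F k s - D k s) (fun k => (hFi k).sub (hDi k)) (by
      refine Summable.of_nonneg_of_le (fun k => integral_nonneg fun _ => norm_nonneg _)
        (fun k => ?_) (hFn.add hDn)
      rw [← integral_add (hFi k).norm (hDi k).norm]
      exact integral_mono ((hFi k).sub (hDi k)).norm ((hFi k).norm.add (hDi k).norm)
        fun s => norm_sub_le _ _)
  -- At fixed s the sum is the weighted heat kernel integral minus its lower bound: for s > s₀ the
  -- bound applies, below s₀ the subtracted term is zero.
  have hval : ∀ s ∈ Set.Ioi (0 : ℝ), ∃ r : ℝ, 0 ≤ r ∧ ∑' k, (F k s - D k s) = r := by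
    intro s hs
    have hs' : 0 < s := hs
    obtain ⟨r, hr0, hrs, hr⟩ := hheat A s hs'
    have h1 : HasSum (fun k => F k s)
        ((s ^ (β / 2 - 1) * Real.exp (-(1 * s)) : ℝ) * (r : ℂ)) := by
      refine (hr.mul_left _).congr_summand fun k => ?_
      have : Real.exp (-((1 + normSq k) * s)) =
          Real.exp (-(1 * s)) * Real.exp (-(s * normSq k)) := by
        rw [← Real.exp_add]; ring_nf
      simp only [F, this, Complex.ofReal_mul]
      ring
    have h2 : HasSum (fun k => D k s) (((Set.Ioi s₀).indicator
        (fun s => s ^ (β / 2 - 1) * Real.exp (-(1 * s))) s *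
          ((8 * Real.pi)⁻¹ * volume.real A) : ℝ) : ℂ) := hasSum_ite_eq 0 _
    refine ⟨_, ?_, (h1.sub h2).tsum_eq.trans (by rw [← Complex.ofReal_mul, ← Complex.ofReal_sub])⟩
    rw [sub_nonneg]
    have hpos : 0 ≤ s ^ (β / 2 - 1) * Real.exp (-(1 * s)) := by positivity
    by_cases h : s ∈ Set.Ioi s₀
    · rw [Set.indicator_of_mem h]
      exact mul_le_mul_of_nonneg_left (hrs (le_of_lt h)) hpos
    · rw [Set.indicator_of_notMem h, zero_mul]
      exact mul_nonneg hpos hr0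
  have hreal : ∃ r : ℝ, 0 ≤ r ∧ ∫ s in Set.Ioi 0, ∑' k, (F k s - D k s) = r := by
    refine ⟨∫ s in Set.Ioi 0, (∑' k, (F k s - D k s)).re, ?_, ?_⟩
    · refine setIntegral_nonneg measurableSet_Ioi fun s hs => ?_
      obtain ⟨r, hr, h⟩ := hval s hs
      rw [h, Complex.ofReal_re]
      exact hr
    · rw [← integral_complex_ofReal]
      refine setIntegral_congr_fun measurableSet_Ioi fun s hs => ?_
      obtain ⟨r, hr, h⟩ := hval s hs
      simp only [h, Complex.ofReal_re]
  obtain ⟨r, hr0, hr⟩ := hreal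
  rw [hr] at hsum
  have hDsum : HasSum (fun k => ∫ s in Set.Ioi 0, D k s)
      ((g * ((8 * Real.pi)⁻¹ * volume.real A) : ℝ) : ℂ) := by
    have h1 : ∀ k, ∫ s in Set.Ioi 0, D k s =
        if k = 0 then ((g * ((8 * Real.pi)⁻¹ * volume.real A) : ℝ) : ℂ) else 0 := by
      intro k
      by_cases hk : k = 0
      · simp only [D, hk, if_true]
        rw [integral_complex_ofReal, integral_mul_const]
      · simp [D, hk]
    simp only [h1]
    exact hasSum_ite_eq 0 _
  have hFsum : HasSum (fun k => ∫ s in Set.Ioi 0, F k s)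
      (((Real.Gamma (β / 2) * (2 * Real.pi) : ℝ) : ℂ) * ∫ x in A, besselPotential β x) := by
    refine (hsv.mul_left _).congr_summand fun k => ?_
    simp only [F]
    rw [integral_mul_const, integral_complex_ofReal, hgam, ← mul_assoc, ← Complex.ofReal_mul]
    congr 2
    have := Real.two_pi_pos.ne'
    field_simp
  have hFD := hFsum.sub hDsum
  have heq := hFD.unique (hsum.congr_summand fun k => (integral_sub (hFi k) (hDi k)).symm)
  refine ⟨(2 * Real.pi)⁻¹ * (Real.Gamma (β / 2))⁻¹ * (g * (8 * Real.pi)⁻¹) * volume.real A +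
    (2 * Real.pi)⁻¹ * (Real.Gamma (β / 2))⁻¹ * r, ?_, ?_⟩
  · have := Real.two_pi_pos
    have : 0 ≤ (2 * Real.pi)⁻¹ * (Real.Gamma (β / 2))⁻¹ * r := by positivity
    linarith
  · rw [sub_eq_iff_eq_add] at heq
    have hne : ((Real.Gamma (β / 2) * (2 * Real.pi) : ℝ) : ℂ) ≠ 0 :=
      Complex.ofReal_ne_zero.2 (mul_pos hG Real.two_pi_pos).ne'
    apply mul_left_cancel₀ hne
    rw [heq, ← Complex.ofReal_add, ← Complex.ofReal_mul]
    congr 1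
    have := Real.pi_pos.ne'
    field_simp
    ring

/-- The potential is real and bounded below by a positive constant. -/
theorem exists_besselPotential_ge {β : ℝ} (hβ : 1 < β) :
    ∃ c : ℝ, 0 < c ∧ ∀ᵐ x : Torus, (besselPotential β x).im = 0 ∧ c ≤ (besselPotential β x).re := by
  obtain ⟨c, hc, h⟩ := exists_setIntegral_besselPotential hβ
  refine ⟨c, hc, ?_⟩
  have hint : Integrable (besselPotential β) (volume : Measure Torus) :=
    (Lp.memLp (besselPotential β)).integrable (by norm_num)
  have him : ∀ᵐ x : Torus, (besselPotential β x).im = 0 := by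
    refine ae_eq_zero_of_forall_setIntegral_eq_of_sigmaFinite (fun A _ _ => hint.im.integrableOn)
      fun A hA _ => ?_
    obtain ⟨r, _, hr⟩ := h A hA
    have := integral_im (𝕜 := ℂ) (hint.integrableOn (s := A))
    simp only [RCLike.im_to_complex] at this
    rw [this, hr, Complex.ofReal_im]
  have hre : (fun _ : Torus => c) ≤ᵐ[volume] fun x => (besselPotential β x).re := by
    refine ae_le_of_forall_setIntegral_le (integrable_const c) hint.re fun A hA _ => ?_
    obtain ⟨r, hr', hr⟩ := h A hA
    have := integral_re (𝕜 := ℂ) (hint.integrableOn (s := A))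
    simp only [RCLike.re_to_complex] at this ⊢
    rw [this, hr, Complex.ofReal_re, setIntegral_const, smul_eq_mul, mul_comm]
    exact hr'
  filter_upwards [him, hre] with x h1 h2
  exact ⟨h1, h2⟩

end Positivity

/-! ### Fourier coefficients and symmetrized plane waves in a sector -/

section Sector

theorem kinetic_nonneg {n : ℕ} (K : Fin n → Mom) : 0 ≤ kinetic K :=
  Finset.sum_nonneg fun _ _ => normSq_nonneg _

theorem exp_neg_mul_kinetic {n : ℕ} (s : ℝ) (K : Fin n → Mom) :
    Real.exp (-(s * kinetic K)) = ∏ j, Real.exp (-(s * normSq (K j))) := by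
  rw [← Real.exp_sum, kinetic, Finset.mul_sum, Finset.sum_neg_distrib]

theorem summable_exp_neg_mul_kinetic {s : ℝ} (hs : 0 < s) (n : ℕ) :
    Summable fun K : Fin n → Mom => Real.exp (-(s * kinetic K)) := by
  simp only [exp_neg_mul_kinetic]
  exact summable_prod_pi (fun _ => (Real.exp_pos _).le) (summable_exp_neg_mul_normSq hs) n

theorem tsum_exp_neg_mul_kinetic_le {s : ℝ} (hs : 0 < s) (n : ℕ) :
    ∑' K : Fin n → Mom, Real.exp (-(s * kinetic K)) ≤
      (∑' k : Mom, Real.exp (-(s * normSq k))) ^ n := by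
  simp only [exp_neg_mul_kinetic]
  exact Real.tsum_le_of_sum_le (fun _ => Finset.prod_nonneg fun _ _ => (Real.exp_pos _).le)
    (sum_prod_le_tsum_pow (fun _ => (Real.exp_pos _).le) (summable_exp_neg_mul_normSq hs))

/-- The summable family exp(-kinetic) tends to zero along the cofinite filter, so only finitely many
terms reach exp(-N). -/
theorem finite_kinetic_le (n : ℕ) (N : ℝ) : {K : Fin n → Mom | kinetic K ≤ N}.Finite := by
  have h := (summable_exp_neg_mul_kinetic one_pos n).tendsto_cofinite_zero
  have h1 := h.eventually (gt_mem_nhds (Real.exp_pos (-N)))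
  rw [Filter.eventually_cofinite] at h1
  refine h1.subset fun K hK => ?_
  have hK : kinetic K ≤ N := hK
  simp only [Set.mem_ofPred_eq, not_lt, one_mul]
  exact Real.exp_le_exp.2 (by linarith)

theorem Sector.ext_coeff {n : ℕ} {φ ψ : Sector n} (h : ∀ K, coeff φ K = coeff ψ K) : φ = ψ := by
  apply Subtype.ext
  refine HilbertBasis.eq_of_inner (planeWaveBasis n) fun K => ?_
  rw [← coeff_eq_inner, ← coeff_eq_inner, h]

theorem hasSum_coeff {n : ℕ} (ψ : Sector n) :
    HasSum (fun K => coeff ψ K • planeWaveLp K) (ψ : L2 n) := by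
  refine ((planeWaveBasis n).hasSum_repr (ψ : L2 n)).congr_summand fun K => ?_
  rw [coeff_eq_inner, HilbertBasis.repr_apply_apply, planeWaveBasis_apply]

/-- The trigonometric polynomial with the Fourier coefficients of `ψ` in `F`. -/
def trigPart {n : ℕ} (ψ : Sector n) (F : Finset (Fin n → Mom)) : C(Conf n, ℂ) :=
  ∑ K ∈ F, coeff ψ K • planeWaveC K

theorem trigPart_apply {n : ℕ} (ψ : Sector n) (F : Finset (Fin n → Mom)) (X : Conf n) :
    trigPart ψ F X = ∑ K ∈ F, coeff ψ K * planeWave K X := by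
  rw [trigPart, ContinuousMap.sum_apply]
  rfl

theorem wave_ae_eq_trigPart {n : ℕ} {ψ : Sector n} {F : Finset (Fin n → Mom)}
    (hF : ∀ K ∉ F, coeff ψ K = 0) : wave ψ =ᵐ[volume] trigPart ψ F := by
  have h1 : (ψ : L2 n) = ContinuousMap.toLp (E := ℂ) 2 (volume : Measure (Conf n)) ℂ
      (trigPart ψ F) := by
    rw [trigPart, map_sum]
    simp only [map_smul]
    refine (hasSum_coeff ψ).unique (hasSum_sum_of_ne_finset_zero fun K hK => ?_)
    rw [hF K hK, zero_smul]
  unfold wave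
  rw [h1]
  exact ContinuousMap.coeFn_toLp volume (trigPart ψ F)

theorem permAction_planeWaveLp {n : ℕ} (σ : Equiv.Perm (Fin n)) (K : Fin n → Mom) :
    permAction σ (planeWaveLp K) = planeWaveLp fun i => K (σ.symm i) := by
  apply Lp.ext
  filter_upwards [coeFn_permAction σ (planeWaveLp K), coeFn_planeWaveLp fun i => K (σ.symm i),
    (measurePreserving_perm σ).quasiMeasurePreserving.ae (coeFn_planeWaveLp K)] with X h1 h2 h3
  rw [h1, h2, h3, ← planeWave_perm (fun i => K (σ.symm i)) σ X]
  simp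

/-- The symmetrized plane wave. -/
def symWave {n : ℕ} (K : Fin n → Mom) : Sector n :=
  ⟨∑ σ : Equiv.Perm (Fin n), planeWaveLp fun i => K (σ i), by
    rw [mem_symSubspace]
    intro τ
    rw [map_sum]
    simp only [permAction_planeWaveLp]
    exact Equiv.sum_comp (Equiv.mulRight τ.symm) fun σ : Equiv.Perm (Fin n) =>
      planeWaveLp fun i => K (σ i)⟩

/-- Each permutation contributes the same coefficient. A vector orthogonal to all symmetrized plane
waves is therefore zero, which gives density of the form domain. -/
theorem inner_symWave {n : ℕ} (K : Fin n → Mom) (ψ : Sector n) :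
    inner ℂ (symWave K) ψ = (Fintype.card (Equiv.Perm (Fin n)) : ℂ) * coeff ψ K := by
  change inner ℂ (∑ σ : Equiv.Perm (Fin n), planeWaveLp fun i => K (σ i)) (ψ : L2 n) = _
  rw [sum_inner]
  have : ∀ σ : Equiv.Perm (Fin n), inner ℂ (planeWaveLp fun i => K (σ i)) (ψ : L2 n) =
      coeff ψ K := by
    intro σ
    rw [← planeWaveBasis_apply, ← coeff_eq_inner, coeff_perm]
  simp [this]

theorem finite_coeff_symWave {n : ℕ} (K : Fin n → Mom) : {L | coeff (symWave K) L ≠ 0}.Finite := by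
  refine (Set.finite_range fun σ : Equiv.Perm (Fin n) => fun i => K (σ i)).subset fun L hL => ?_
  by_contra hne
  apply hL
  rw [coeff_eq_inner, planeWaveBasis_apply]
  change inner ℂ (planeWaveLp L) (∑ σ : Equiv.Perm (Fin n), planeWaveLp fun i => K (σ i)) = 0
  rw [inner_sum]
  refine Finset.sum_eq_zero fun σ _ => (orthonormal_planeWaveLp n).2 fun h => hne ⟨σ, h.symm⟩

/-- Multiplication operators are closed: pass to a subsequence along which both components converge
almost everywhere. -/
theorem isClosed_ae_eq_mul {α : Type*} [MeasurableSpace α] {ν : Measure α} (m : α → ℂ) :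
    IsClosed {p : Lp ℂ 2 ν × Lp ℂ 2 ν | p.2 =ᵐ[ν] fun x => m x * p.1 x} := by
  apply IsSeqClosed.isClosed
  intro u p hu hlim
  have h1 : Tendsto (fun k => (u k).1) atTop (𝓝 p.1) := (continuous_fst.tendsto p).comp hlim
  have h2 : Tendsto (fun k => (u k).2) atTop (𝓝 p.2) := (continuous_snd.tendsto p).comp hlim
  obtain ⟨a, ha, ha'⟩ := (tendstoInMeasure_of_tendsto_Lp h1).exists_seq_tendsto_ae
  obtain ⟨b, hb, hb'⟩ := (tendstoInMeasure_of_tendsto_Lp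
    (h2.comp ha.tendsto_atTop)).exists_seq_tendsto_ae
  have hall : ∀ᵐ x ∂ν, ∀ k, (u k).2 x = m x * (u k).1 x := ae_all_iff.2 hu
  filter_upwards [ha', hb', hall] with x h3 h4 h5
  have h6 := (h3.comp hb.tendsto_atTop).const_mul (m x)
  refine tendsto_nhds_unique h4 (h6.congr fun k => ?_)
  exact (h5 _).symm

end Sector

/-! ### The form as the graph inner product of a closed operator -/

section FormGraph

/-- The target space of the square root of the `n`-particle form. -/
abbrev FormTarget (n : ℕ) : Type :=
  WithLp 2 (lp (fun _ : Fin n → Mom => ℂ) 2 × PiLp 2 fun _ : pairs n => L2 n)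

/-- The square root of the kinetic energy. -/
def kinWeight (lam : ℝ) {n : ℕ} (K : Fin n → Mom) : ℂ := (Real.sqrt (lam * kinetic K) : ℝ)

/-- The square root of the interaction energy. -/
def intWeight (β lam : ℝ) {n : ℕ} (p : Fin n × Fin n) (X : Conf n) : ℂ :=
  (lam * Real.sqrt (besselPotential β (X p.1 - X p.2)).re : ℝ)

theorem wave_add {n : ℕ} (φ ψ : Sector n) : wave (φ + ψ) =ᵐ[volume] fun X => wave φ X + wave ψ X :=
  Lp.coeFn_add (φ : L2 n) (ψ : L2 n)

theorem wave_smul {n : ℕ} (c : ℂ) (ψ : Sector n) : wave (c • ψ) =ᵐ[volume] fun X => c * wave ψ X :=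
  Lp.coeFn_smul c (ψ : L2 n)

theorem coeff_add {n : ℕ} (φ ψ : Sector n) (K : Fin n → Mom) :
    coeff (φ + ψ) K = coeff φ K + coeff ψ K := by
  simp only [coeff_eq_inner, Submodule.coe_add, inner_add_right]

theorem coeff_smul {n : ℕ} (c : ℂ) (ψ : Sector n) (K : Fin n → Mom) :
    coeff (c • ψ) K = c * coeff ψ K := by
  simp only [coeff_eq_inner, Submodule.coe_smul, inner_smul_right]

theorem coeff_zero {n : ℕ} (K : Fin n → Mom) : coeff (0 : Sector n) K = 0 := by
  simp only [coeff_eq_inner, Submodule.coe_zero, inner_zero_right]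

theorem continuous_coeff {n : ℕ} (K : Fin n → Mom) : Continuous fun ψ : Sector n => coeff ψ K := by
  simp only [coeff_eq_inner]
  fun_prop

/-- The graph of the square root of the `n`-particle form. -/
def formGraph (β lam : ℝ) (n : ℕ) : Submodule ℂ (WithLp 2 (Sector n × FormTarget n)) where
  carrier := {x | (∀ K, x.snd.fst K = kinWeight lam K * coeff x.fst K) ∧
    ∀ p : pairs n, x.snd.snd p =ᵐ[volume] fun X => intWeight β lam p.1 X * wave x.fst X}
  zero_mem' := by
    refine ⟨fun K => ?_, fun p => ?_⟩
    · rw [WithLp.zero_fst, coeff_zero, mul_zero, WithLp.zero_snd, WithLp.zero_fst]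
      rfl
    · have h : wave (0 : Sector n) =ᵐ[volume] 0 := Lp.coeFn_zero _ _ _
      filter_upwards [h, Lp.coeFn_zero ℂ 2 (volume : Measure (Conf n))] with X h1 h2
      rw [WithLp.zero_fst, h1, WithLp.zero_snd, WithLp.zero_snd]
      simp
  add_mem' := by
    intro x y hx hy
    refine ⟨fun K => ?_, fun p => ?_⟩
    · rw [WithLp.add_fst, coeff_add, mul_add, WithLp.add_snd, WithLp.add_fst, ← hx.1, ← hy.1]
      rfl
    · filter_upwards [hx.2 p, hy.2 p, wave_add x.fst y.fst,
        Lp.coeFn_add (x.snd.snd p) (y.snd.snd p)] with X h1 h2 h3 h4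
      rw [WithLp.add_fst, h3, WithLp.add_snd, WithLp.add_snd, mul_add, ← h1, ← h2, ← Pi.add_apply,
        ← h4]
      rfl
  smul_mem' := by
    intro c x hx
    refine ⟨fun K => ?_, fun p => ?_⟩
    · rw [WithLp.smul_fst, coeff_smul, mul_left_comm, WithLp.smul_snd, WithLp.smul_fst, ← hx.1]
      rfl
    · filter_upwards [hx.2 p, wave_smul c x.fst,
        Lp.coeFn_smul c (x.snd.snd p)] with X h1 h3 h4
      rw [WithLp.smul_fst, h3, WithLp.smul_snd, WithLp.smul_snd, mul_left_comm, ← h1]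
      exact h4

theorem isClosed_formGraph (β lam : ℝ) (n : ℕ) :
    IsClosed (formGraph β lam n : Set (WithLp 2 (Sector n × FormTarget n))) := by
  have hfst : Continuous fun x : WithLp 2 (Sector n × FormTarget n) => x.fst :=
    (WithLp.fstL 2 ℂ (Sector n) (FormTarget n)).continuous
  have hsnd : Continuous fun x : WithLp 2 (Sector n × FormTarget n) => x.snd :=
    (WithLp.sndL 2 ℂ (Sector n) (FormTarget n)).continuous
  have h1 : Continuous fun x : WithLp 2 (Sector n × FormTarget n) => x.snd.fst :=
    (WithLp.fstL 2 ℂ (lp (fun _ : Fin n → Mom => ℂ) 2)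
      (PiLp 2 fun _ : pairs n => L2 n)).continuous.comp hsnd
  have h2 : Continuous fun x : WithLp 2 (Sector n × FormTarget n) => x.snd.snd :=
    (WithLp.sndL 2 ℂ (lp (fun _ : Fin n → Mom => ℂ) 2)
      (PiLp 2 fun _ : pairs n => L2 n)).continuous.comp hsnd
  have heq : (formGraph β lam n : Set (WithLp 2 (Sector n × FormTarget n))) =
      (⋂ K, {x | x.snd.fst K = kinWeight lam K * coeff x.fst K}) ∩
      ⋂ p : pairs n,
        {x | x.snd.snd p =ᵐ[volume] fun X => intWeight β lam p.1 X * wave x.fst X} := by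
    ext x
    simp only [Set.mem_inter_iff, Set.mem_iInter]
    rfl
  rw [heq]
  refine (isClosed_iInter fun K => ?_).inter (isClosed_iInter fun p => ?_)
  · refine isClosed_eq ?_ (continuous_const.mul ((continuous_coeff K).comp hfst))
    exact (lp.lipschitzWith_one_eval (E := fun _ : Fin n → Mom => ℂ) 2 K).continuous.comp h1
  · have hc : Continuous fun x : WithLp 2 (Sector n × FormTarget n) =>
        ((x.fst : L2 n), x.snd.snd p) :=
      (continuous_subtype_val.comp hfst).prodMk ((PiLp.continuous_apply 2 _ p).comp h2)
    exact (isClosed_ae_eq_mul (intWeight β lam p.1)).preimage hc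

theorem ne_of_mem_pairs {n : ℕ} {p : Fin n × Fin n} (hp : p ∈ pairs n) : p.1 ≠ p.2 := by
  have := (Finset.mem_filter.1 hp).2
  exact this.ne

theorem ae_besselPotential_relPos {β : ℝ} (hβ : 1 < β) {n : ℕ} {p : Fin n × Fin n}
    (hp : p.1 ≠ p.2) :
    ∀ᵐ X : Conf n, 0 ≤ (besselPotential β (X p.1 - X p.2)).re ∧
      besselPotential β (X p.1 - X p.2) = ((besselPotential β (X p.1 - X p.2)).re : ℂ) := by
  obtain ⟨c, hc, h⟩ := exists_besselPotential_ge hβ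
  filter_upwards [(quasiMeasurePreserving_relPos hp).ae h] with X hX
  rw [relPos_apply] at hX
  refine ⟨hc.le.trans hX.2, Complex.ext (by simp) (by simpa using hX.1)⟩

theorem aestronglyMeasurable_besselPotential_relPos (β : ℝ) {n : ℕ} {i j : Fin n} (hij : i ≠ j) :
    AEStronglyMeasurable (fun X : Conf n => besselPotential β (X i - X j)) volume :=
  (memLp_comp_relPos hij (Lp.memLp (besselPotential β))).aestronglyMeasurable

theorem aestronglyMeasurable_intWeight (β lam : ℝ) {n : ℕ} {p : Fin n × Fin n} (hp : p.1 ≠ p.2) :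
    AEStronglyMeasurable (intWeight β lam p) (volume : Measure (Conf n)) := by
  have h := (aestronglyMeasurable_besselPotential_relPos β hp).re
  have h1 : AEStronglyMeasurable (fun X : Conf n =>
      Real.sqrt (besselPotential β (X p.1 - X p.2)).re) volume :=
    Real.continuous_sqrt.comp_aestronglyMeasurable h
  exact Complex.continuous_ofReal.comp_aestronglyMeasurable (h1.const_mul lam)

theorem conj_intWeight_mul {β lam : ℝ} {n : ℕ} {p : Fin n × Fin n} {X : Conf n}
    (h : 0 ≤ (besselPotential β (X p.1 - X p.2)).re ∧
      besselPotential β (X p.1 - X p.2) = ((besselPotential β (X p.1 - X p.2)).re : ℂ)) (z w : ℂ) :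
    conj (intWeight β lam p X * z) * (intWeight β lam p X * w) =
      lam ^ 2 * (besselPotential β (X p.1 - X p.2) * (conj z * w)) := by
  have h1 := Real.mul_self_sqrt h.1
  have h2 : ((Real.sqrt (besselPotential β (X p.1 - X p.2)).re : ℝ) : ℂ) *
      (Real.sqrt (besselPotential β (X p.1 - X p.2)).re : ℝ) =
      besselPotential β (X p.1 - X p.2) := by
    rw [← Complex.ofReal_mul, h1, ← h.2]
  rw [map_mul, intWeight, Complex.conj_ofReal, Complex.ofReal_mul]
  linear_combination (lam ^ 2 * (conj z * w)) * h2

theorem norm_intWeight_sq {β lam : ℝ} {n : ℕ} {p : Fin n × Fin n} {X : Conf n}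
    (h : 0 ≤ (besselPotential β (X p.1 - X p.2)).re ∧
      besselPotential β (X p.1 - X p.2) = ((besselPotential β (X p.1 - X p.2)).re : ℂ)) (z : ℂ) :
    ((‖intWeight β lam p X * z‖ ^ 2 : ℝ) : ℂ) =
      lam ^ 2 * (besselPotential β (X p.1 - X p.2) * ((‖z‖ ^ 2 : ℝ) : ℂ)) := by
  have h1 := conj_intWeight_mul (lam := lam) h z z
  rw [← Complex.normSq_eq_conj_mul_self, ← Complex.normSq_eq_conj_mul_self,
    Complex.normSq_eq_norm_sq, Complex.normSq_eq_norm_sq] at h1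
  exact h1

theorem norm_kinWeight_sq {lam : ℝ} (hlam : 0 < lam) {n : ℕ} (K : Fin n → Mom) (z : ℂ) :
    ‖kinWeight lam K * z‖ ^ 2 = lam * (kinetic K * ‖z‖ ^ 2) := by
  rw [norm_mul, mul_pow, kinWeight, Complex.norm_real, Real.norm_of_nonneg (Real.sqrt_nonneg _),
    Real.sq_sqrt (mul_nonneg hlam.le (kinetic_nonneg K)), mul_assoc]

/-- Since the potential is real and nonnegative, finite interaction energy means that its square
root times ψ is in L²; likewise for the kinetic energy on the Fourier side. -/
theorem inFormDomain_iff {β lam : ℝ} (hβ : 1 < β) (hlam : 0 < lam) {n : ℕ} (ψ : Sector n) :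
    InFormDomain β ψ ↔ ∃ x ∈ formGraph β lam n, x.fst = ψ := by
  have hlam' : (lam : ℂ) ^ 2 ≠ 0 := pow_ne_zero 2 (Complex.ofReal_ne_zero.2 hlam.ne')
  constructor
  · rintro ⟨hk, hp⟩
    have h1 : Memℓp (fun K => kinWeight lam K * coeff ψ K) 2 := by
      apply memℓp_gen
      have : (2 : ℝ≥0∞).toReal = ((2 : ℕ) : ℝ) := by norm_num
      simp only [this, Real.rpow_natCast, norm_kinWeight_sq hlam]
      exact hk.mul_left lam
    have h2 : ∀ p : pairs n, MemLp (fun X => intWeight β lam p.1 X * wave ψ X) 2 volume := by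
      intro p
      have hne := ne_of_mem_pairs p.2
      have hm : AEStronglyMeasurable (fun X => intWeight β lam p.1 X * wave ψ X) volume :=
        (aestronglyMeasurable_intWeight β lam hne).mul (Lp.aestronglyMeasurable (ψ : L2 n))
      rw [memLp_two_iff_integrable_sq_norm hm]
      have h3 := (((hp p.1 p.2).const_mul ((lam : ℂ) ^ 2)).re)
      refine h3.congr ?_
      filter_upwards [ae_besselPotential_relPos hβ hne] with X hX
      rw [← norm_intWeight_sq hX]
      exact Complex.ofReal_re _
    refine ⟨WithLp.toLp 2 (ψ, WithLp.toLp 2 (⟨_, h1⟩, WithLp.toLp 2 fun p => (h2 p).toLp _)),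
      ⟨fun K => rfl, fun p => (h2 p).coeFn_toLp⟩, rfl⟩
  · rintro ⟨x, ⟨hk, hp⟩, rfl⟩
    constructor
    · have h1 := (lp.memℓp x.snd.fst).summable (by norm_num)
      have : (2 : ℝ≥0∞).toReal = ((2 : ℕ) : ℝ) := by norm_num
      simp only [this, Real.rpow_natCast, hk, norm_kinWeight_sq hlam] at h1
      exact (summable_mul_left_iff hlam.ne').1 h1
    · intro p hpm
      have h1 := (memLp_two_iff_integrable_sq_norm (Lp.aestronglyMeasurable _)).1
        (Lp.memLp (x.snd.snd ⟨p, hpm⟩))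
      have h2 := h1.ofReal (𝕜 := ℂ) |>.const_mul (((lam : ℂ) ^ 2)⁻¹)
      refine h2.congr ?_
      filter_upwards [hp ⟨p, hpm⟩, ae_besselPotential_relPos hβ (ne_of_mem_pairs hpm)] with X hX hX'
      rw [hX]
      simp only [Complex.coe_algebraMap]
      rw [norm_intWeight_sq hX', ← mul_assoc, inv_mul_cancel₀ hlam', one_mul]

/-- The particle-number dependent constant of the sector form. -/
def sectorConst (lam : ℝ) (n : ℕ) : ℝ :=
  lam * n + lam ^ 2 / (2 * (2 * Real.pi) ^ 2) * (((n : ℝ) - freeNumber lam) ^ 2 - ((n : ℝ) ^ 2 - n))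

/-- The graph inner product consists of ⟨φ, ψ⟩, the kinetic and the interaction part. The summand
⟨φ, ψ⟩ already present accounts for the -1. -/
theorem sectorForm_eq_inner {β lam : ℝ} (hβ : 1 < β) (hlam : 0 < lam) {n : ℕ}
    {x y : WithLp 2 (Sector n × FormTarget n)} (hx : x ∈ formGraph β lam n)
    (hy : y ∈ formGraph β lam n) :
    sectorForm β lam y.fst x.fst =
      inner ℂ y x + ((sectorConst lam n - 1 : ℝ) : ℂ) * inner ℂ y.fst x.fst := by
  have h1 : inner ℂ y.snd.fst x.snd.fst = (lam : ℂ) * ∑' K : Fin n → Mom,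
      (kinetic K : ℂ) * (conj (coeff y.fst K) * coeff x.fst K) := by
    rw [lp.inner_eq_tsum, ← tsum_mul_left]
    congr 1
    ext K
    have h2 := Real.mul_self_sqrt (mul_nonneg hlam.le (kinetic_nonneg K))
    have h3 : kinWeight lam K * kinWeight lam K = (lam : ℂ) * kinetic K := by
      rw [kinWeight, ← Complex.ofReal_mul, h2, Complex.ofReal_mul]
    have h4 : conj (kinWeight lam K) = kinWeight lam K := Complex.conj_ofReal _
    rw [RCLike.inner_apply, hx.1, hy.1, map_mul, h4]
    linear_combination (conj (coeff y.fst K) * coeff x.fst K) * h3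
  have h2 : inner ℂ y.snd.snd x.snd.snd = (lam : ℂ) ^ 2 * ∑ p ∈ pairs n, ∫ X : Conf n,
      besselPotential β (X p.1 - X p.2) * (conj (wave y.fst X) * wave x.fst X) := by
    rw [PiLp.inner_apply, Finset.mul_sum, ← Finset.sum_coe_sort (pairs n)]
    refine Finset.sum_congr rfl fun p _ => ?_
    rw [MeasureTheory.L2.inner_def, ← integral_const_mul]
    apply integral_congr_ae
    filter_upwards [hx.2 p, hy.2 p, ae_besselPotential_relPos hβ (ne_of_mem_pairs p.2)]
      with X h3 h4 h5
    rw [RCLike.inner_apply, h3, h4, mul_comm, conj_intWeight_mul h5]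
  rw [sectorForm, WithLp.prod_inner_apply, WithLp.ofLp_fst, WithLp.ofLp_snd]
  rw [WithLp.ofLp_fst, WithLp.ofLp_snd, WithLp.prod_inner_apply y.snd, WithLp.ofLp_fst,
    WithLp.ofLp_snd,
    WithLp.ofLp_fst, WithLp.ofLp_snd, h1, h2,
    sectorConst]
  push_cast
  ring

end FormGraph

/-! ### Compact embedding and eigenbasis of the n-particle operator -/

section SectorOperator

theorem inFormDomain_of_finite {β : ℝ} {n : ℕ} {ψ : Sector n}
    (h : {K | coeff ψ K ≠ 0}.Finite) : InFormDomain β ψ := by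
  have hF : ∀ K ∉ h.toFinset, coeff ψ K = 0 := fun K hK => by simpa using hK
  refine ⟨summable_of_ne_finset_zero (s := h.toFinset) fun K hK => by rw [hF K hK]; simp,
    fun p hp => ?_⟩
  have hint := (memLp_comp_relPos (ne_of_mem_pairs hp)
    (Lp.memLp (besselPotential β))).integrable (by norm_num)
  have hb := hint.mul_bdd (c := ‖trigPart ψ h.toFinset‖ ^ 2)
    (g := fun X => ((‖trigPart ψ h.toFinset X‖ ^ 2 : ℝ) : ℂ))
    (by
      have : Continuous fun X => ((‖trigPart ψ h.toFinset X‖ ^ 2 : ℝ) : ℂ) := by fun_prop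
      exact this.aestronglyMeasurable)
    (ae_of_all _ fun X => by
      rw [Complex.norm_real, Real.norm_of_nonneg (by positivity)]
      gcongr
      exact (trigPart ψ h.toFinset).norm_coe_le_norm X)
  refine hb.congr ?_
  filter_upwards [wave_ae_eq_trigPart hF] with X hX
  rw [hX]

theorem formGraph_dense {β lam : ℝ} (hβ : 1 < β) (hlam : 0 < lam) {n : ℕ} (ψ : Sector n)
    (h : ∀ x ∈ formGraph β lam n, inner ℂ x.fst ψ = 0) : ψ = 0 := by
  refine Sector.ext_coeff fun K => ?_
  obtain ⟨x, hx, hxK⟩ := (inFormDomain_iff hβ hlam (symWave K)).1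
    (inFormDomain_of_finite (finite_coeff_symWave K))
  have h1 := h x hx
  rw [hxK, inner_symWave] at h1
  rw [coeff_zero]
  refine (mul_eq_zero.1 h1).resolve_left ?_
  exact_mod_cast Fintype.card_ne_zero

/-- A bounded map into a Hilbert space is compact if it controls a weight that tends to infinity
along a Hilbert basis. -/
theorem isCompactOperator_of_weight {κ M L : Type*} [NormedAddCommGroup M] [NormedSpace ℂ M]
    [NormedAddCommGroup L] [InnerProductSpace ℂ L] [CompleteSpace L] (e : HilbertBasis κ ℂ L)
    (J : M →L[ℂ] L) {w : κ → ℝ} (hw : ∀ k, 0 ≤ w k) (hfin : ∀ N : ℕ, {k | w k ≤ N}.Finite)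
    {C : ℝ} (hC : 0 ≤ C)
    (h : ∀ x, ∃ s ≤ C * ‖x‖ ^ 2, HasSum (fun k => w k * ‖inner ℂ (e k) (J x)‖ ^ 2) s) :
    IsCompactOperator J := by
  classical
  let F : ℕ → Finset κ := fun N => (hfin N).toFinset
  let T : ℕ → M →L[ℂ] L := fun N => ∑ k ∈ F N,
    (ContinuousLinearMap.toSpanSingleton ℂ (e k)).comp ((innerSL ℂ (e k)).comp J)
  have hT : ∀ N x, T N x = ∑ k ∈ F N, (inner ℂ (e k) (J x) : ℂ) • e k := by
    intro N x
    simp only [T, sum_apply, ContinuousLinearMap.comp_apply,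
      ContinuousLinearMap.toSpanSingleton_apply, innerSL_apply_apply]
  have hTc : ∀ N, IsCompactOperator (T N) := by
    intro N
    refine (compactOperator (RingHom.id ℂ) M L).sum_mem fun k _ => ?_
    exact (isCompactOperator_of_locallyCompactSpace_rng
      (ContinuousLinearMap.toSpanSingleton ℂ (e k))).comp_clm _
  -- Outside `F (N + 1)` the weight exceeds N + 1, so the discarded mass is at most 1/(N + 1) of the
  -- weighted sum. The finite-rank operators `T (N + 1)` thus converge in norm to `J`.
  have hbound : ∀ N : ℕ, ∀ x, ‖J x - T (N + 1) x‖ ^ 2 ≤ (C * (1 / ((N : ℝ) + 1))) * ‖x‖ ^ 2 := by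
    intro N x
    have h1 := HilbertBasis.hasSum_norm_sq e (J x - T (N + 1) x)
    have h2 : ∀ k, inner ℂ (e k) (J x - T (N + 1) x) =
        if k ∈ F (N + 1) then 0 else inner ℂ (e k) (J x) := by
      intro k
      rw [inner_sub_right, hT, inner_sum]
      have h3 : ∀ l ∈ F (N + 1), inner ℂ (e k) ((inner ℂ (e l) (J x) : ℂ) • e l) =
          if k = l then inner ℂ (e l) (J x) else 0 := by
        intro l _
        rw [inner_smul_right, orthonormal_iff_ite.1 e.orthonormal]
        simp
      rw [Finset.sum_congr rfl h3, Finset.sum_ite_eq]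
      split_ifs <;> simp
    obtain ⟨s, hs, h5⟩ := h x
    refine (hasSum_le (fun k => ?_) h1 (h5.mul_left (1 / ((N : ℝ) + 1)))).trans ?_
    · rw [h2]
      split_ifs with hk
      · rw [norm_zero, zero_pow two_ne_zero]
        have := hw k
        positivity
      · have hk' : (N + 1 : ℝ) < w k := by simpa [F] using hk
        rw [← mul_assoc]
        refine le_mul_of_one_le_left (by positivity) ?_
        rw [one_div_mul_eq_div, one_le_div (by positivity)]
        exact hk'.le
    · rw [mul_comm C, mul_assoc]
      exact mul_le_mul_of_nonneg_left hs (by positivity)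
  have hlim : Tendsto (fun N => T (N + 1)) atTop (𝓝 J) := by
    rw [tendsto_iff_norm_sub_tendsto_zero]
    have h1 : Tendsto (fun N : ℕ => Real.sqrt (C * (1 / ((N : ℝ) + 1)))) atTop (𝓝 0) := by
      have h4 := ((tendsto_one_div_add_atTop_nhds_zero_nat (𝕜 := ℝ)).const_mul C).sqrt
      rwa [mul_zero, Real.sqrt_zero] at h4
    refine squeeze_zero (fun _ => norm_nonneg _) (fun N => ?_) h1
    refine ContinuousLinearMap.opNorm_le_bound _ (Real.sqrt_nonneg _) fun x => ?_
    rw [sub_apply, norm_sub_rev]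
    refine abs_le_of_sq_le_sq' ?_ (by positivity) |>.2
    rw [mul_pow, Real.sq_sqrt (by positivity)]
    exact hbound N x
  exact isCompactOperator_of_tendsto hlim (Eventually.of_forall fun N => hTc _)

theorem isCompactOperator_submodule_of_weight {κ V L : Type*} [NormedAddCommGroup V]
    [NormedSpace ℂ V] (G : Submodule ℂ V)
    [NormedAddCommGroup L] [InnerProductSpace ℂ L] [CompleteSpace L] (e : HilbertBasis κ ℂ L)
    (J : V →L[ℂ] L) {w : κ → ℝ} (hw : ∀ k, 0 ≤ w k) (hfin : ∀ N : ℕ, {k | w k ≤ N}.Finite)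
    {C : ℝ} (hC : 0 ≤ C)
    (h : ∀ x ∈ G, ∃ s ≤ C * ‖x‖ ^ 2, HasSum (fun k => w k * ‖inner ℂ (e k) (J x)‖ ^ 2) s) :
    IsCompactOperator fun x : G => J x :=
  isCompactOperator_of_weight e (J.comp G.subtypeL) hw hfin hC fun x => h x x.2

/-- Rellich's theorem for the torus. Compactness is proved in the full L² space, where plane waves
form a basis, and then restricted to the closed symmetric subspace. -/
theorem isCompactOperator_formGraph_fst {β lam : ℝ} (hlam : 0 < lam) (n : ℕ) :
    IsCompactOperator fun x : formGraph β lam n => x.1.fst := by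
  let J : WithLp 2 (Sector n × FormTarget n) →L[ℂ] L2 n := (symSubspace n).subtypeL.comp
    (WithLp.fstL 2 ℂ (Sector n) (FormTarget n))
  suffices hJ : IsCompactOperator fun x : formGraph β lam n => J x by
    have h1 := hJ.codRestrict (V := symSubspace n) (fun x => x.1.fst.2) (isClosed_symSubspace n)
    exact h1
  refine isCompactOperator_submodule_of_weight (formGraph β lam n) (planeWaveBasis n) J
    kinetic_nonneg (fun N => finite_kinetic_le n N) (inv_nonneg.2 hlam.le) fun x hx => ?_
  have h5 := (lp.hasSum_norm (p := 2) (by norm_num) x.snd.fst)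
  have h22 : (2 : ℝ≥0∞).toReal = ((2 : ℕ) : ℝ) := by norm_num
  simp only [h22, Real.rpow_natCast] at h5
  have h6 : ‖x.snd.fst‖ ^ 2 ≤ ‖x‖ ^ 2 := by
    have h7 : ‖x‖ ^ 2 = ‖x.fst‖ ^ 2 + ‖x.snd‖ ^ 2 := WithLp.prod_norm_sq_eq_of_L2 x
    have h8 : ‖x.snd‖ ^ 2 = ‖x.snd.fst‖ ^ 2 + ‖x.snd.snd‖ ^ 2 :=
      WithLp.prod_norm_sq_eq_of_L2 x.snd
    nlinarith [sq_nonneg ‖x.fst‖, sq_nonneg ‖x.snd.snd‖]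
  refine ⟨lam⁻¹ * ‖x.snd.fst‖ ^ 2, mul_le_mul_of_nonneg_left h6 (inv_nonneg.2 hlam.le),
    (h5.mul_left lam⁻¹).congr_summand fun K => ?_⟩
  rw [hx.1, norm_kinWeight_sq hlam, ← mul_assoc, inv_mul_cancel₀ hlam.ne', one_mul, coeff_eq_inner]
  rfl

theorem inner_sub_smul_eq_iff {E : Type*} [NormedAddCommGroup E] [InnerProductSpace ℂ E]
    (φ χ ψ : E) (r : ℝ) (z : ℂ) :
    inner ℂ φ (χ - (r : ℂ) • ψ) = z ↔ inner ℂ φ χ = z + (r : ℂ) * inner ℂ φ ψ := by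
  rw [inner_sub_right, inner_smul_right, sub_eq_iff_eq_add]

/-- The `n`-particle form operator is diagonal in some Hilbert basis. -/
theorem exists_sectorBasis {β lam : ℝ} (hβ : 1 < β) (hlam : 0 < lam) (n : ℕ) :
    ∃ (ι : Type) (b : HilbertBasis ι ℂ (Sector n)) (E : ι → ℝ), ∀ ψ χ : Sector n,
      (InFormDomain β ψ ∧ ∀ φ, InFormDomain β φ → sectorForm β lam φ ψ = inner ℂ φ χ) ↔
        ∀ i, inner ℂ (b i) χ = E i * inner ℂ (b i) ψ := by
  obtain ⟨ι, b, μ, h⟩ := exists_formBasis (formGraph β lam n) (isClosed_formGraph β lam n)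
    (formGraph_dense hβ hlam) (isCompactOperator_formGraph_fst hlam n)
  refine ⟨ι, b, fun i => μ i + (sectorConst lam n - 1), fun ψ χ => ?_⟩
  -- The multiple of the inner product by which the form exceeds the graph inner product is moved to
  -- the right-hand side, so every eigenvalue is shifted by it.
  have h1 := h ψ (χ - ((sectorConst lam n - 1 : ℝ) : ℂ) • ψ)
  have h2 : (∀ i, inner ℂ (b i) (χ - ((sectorConst lam n - 1 : ℝ) : ℂ) • ψ) =
      μ i * inner ℂ (b i) ψ) ↔ ∀ i, inner ℂ (b i) χ =
      ((μ i + (sectorConst lam n - 1) : ℝ) : ℂ) * inner ℂ (b i) ψ := by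
    refine forall_congr' fun i => (inner_sub_smul_eq_iff _ _ _ _ _).trans ?_
    rw [← add_mul, ← Complex.ofReal_add]
  rw [← h2, ← h1, inFormDomain_iff hβ hlam]
  constructor
  · rintro ⟨⟨x, hx, rfl⟩, hq⟩
    refine ⟨x, hx, rfl, fun y hy => ?_⟩
    have h3 := hq y.fst ((inFormDomain_iff hβ hlam _).2 ⟨y, hy, rfl⟩)
    rw [sectorForm_eq_inner hβ hlam hx hy] at h3
    exact ((inner_sub_smul_eq_iff _ _ _ _ _).2 h3.symm).symm
  · rintro ⟨x, hx, rfl, hq⟩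
    refine ⟨⟨x, hx, rfl⟩, fun φ hφ => ?_⟩
    obtain ⟨y, hy, rfl⟩ := (inFormDomain_iff hβ hlam φ).1 hφ
    rw [sectorForm_eq_inner hβ hlam hx hy]
    exact ((inner_sub_smul_eq_iff _ _ _ _ _).1 (hq y hy).symm).symm

end SectorOperator

/-! ### Lower bound on the energy and sector partition functions -/

section EnergyBound

theorem card_pairs (n : ℕ) : ((pairs n).card : ℝ) = ((n : ℝ) ^ 2 - n) / 2 := by
  have h : (pairs n).card = ∑ j ∈ Finset.range n, j := by
    have h1 : (pairs n).card = ∑ j : Fin n, (j : ℕ) := by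
      have h2 : pairs n = (Finset.univ : Finset (Fin n)).biUnion
          fun j => (Finset.Iio j).image fun i => (i, j) := by
        ext p
        simp [pairs, Prod.ext_iff]
      rw [h2, Finset.card_biUnion]
      · refine Finset.sum_congr rfl fun j _ => ?_
        rw [Finset.card_image_of_injective _ fun a b h => (Prod.ext_iff.1 h).1, Fin.card_Iio]
      · intro i _ j _ hij
        rw [Function.onFun, Finset.disjoint_left]
        intro p hp hq
        simp only [Finset.mem_image] at hp hq
        obtain ⟨a, _, rfl⟩ := hp
        obtain ⟨b, _, hb⟩ := hq
        exact hij (Prod.ext_iff.1 hb).2.symm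
    rw [h1, Finset.sum_range]
  have h3 := Finset.sum_range_id_mul_two n
  rw [← h] at h3
  have h4 : ((pairs n).card : ℝ) * 2 = n * ((n - 1 : ℕ) : ℝ) := by exact_mod_cast h3
  rcases n with _ | n
  · norm_num at h4 ⊢
    exact h4
  · push_cast at h4 ⊢
    linarith

theorem inner_self_eq_ofReal {E : Type*} [NormedAddCommGroup E] [InnerProductSpace ℂ E] (x : E) :
    inner ℂ x x = ((‖x‖ ^ 2 : ℝ) : ℂ) := by
  rw [inner_self_eq_norm_sq_to_K]
  push_cast
  rfl

theorem inner_basis_smul {E ι : Type*} [NormedAddCommGroup E] [InnerProductSpace ℂ E]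
    (b : HilbertBasis ι ℂ E) (μ : ι → ℝ) (i j : ι) :
    inner ℂ (b j) ((μ i : ℂ) • b i) = μ j * inner ℂ (b j) (b i) := by
  rcases eq_or_ne j i with rfl | h
  · exact inner_smul_right _ _ _
  · rw [inner_smul_right, b.orthonormal.2 h, mul_zero, mul_zero]

theorem integral_norm_wave_sq {n : ℕ} (ψ : Sector n) :
    Integrable (fun X => ‖wave ψ X‖ ^ 2) ∧ ∫ X, ‖wave ψ X‖ ^ 2 = ‖ψ‖ ^ 2 := by
  have h := Lp.memLp (ψ : L2 n)
  refine ⟨(memLp_two_iff_integrable_sq_norm h.1).1 h, ?_⟩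
  have h1 := inner_self_eq_ofReal (ψ : L2 n)
  rw [MeasureTheory.L2.inner_def] at h1
  have h2 : ∀ X, inner ℂ ((ψ : L2 n) X) ((ψ : L2 n) X) = ((‖wave ψ X‖ ^ 2 : ℝ) : ℂ) := by
    intro X
    exact inner_self_eq_ofReal _
  simp only [h2] at h1
  have h3 : ∫ X, ((‖wave ψ X‖ ^ 2 : ℝ) : ℂ) = ((∫ X, ‖wave ψ X‖ ^ 2 : ℝ) : ℂ) := integral_ofReal
  rw [h3] at h1
  exact Complex.ofReal_injective h1

/-- Each pair contributes at least c ‖ψ‖² because the potential is at least c. The constant is the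
same for all n, which makes the repulsion quadratic in n. -/
theorem re_sectorForm_self_ge {β lam : ℝ} (hβ : 1 < β) : ∃ c > 0,
    ∀ (n : ℕ) (ψ : Sector n), InFormDomain β ψ →
      lam * (∑' K : Fin n → Mom, kinetic K * ‖coeff ψ K‖ ^ 2) +
        (sectorConst lam n + lam ^ 2 * (c * (pairs n).card)) * ‖ψ‖ ^ 2 ≤
      (sectorForm β lam ψ ψ).re := by
  obtain ⟨c, hc, hv⟩ := exists_besselPotential_ge hβ
  refine ⟨c, hc, fun n ψ hψ => ?_⟩
  have h1 : (∑' K : Fin n → Mom, (kinetic K : ℂ) * (conj (coeff ψ K) * coeff ψ K)) =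
      ((∑' K : Fin n → Mom, kinetic K * ‖coeff ψ K‖ ^ 2 : ℝ) : ℂ) := by
    rw [Complex.ofReal_tsum]
    congr 1
    ext K
    rw [← Complex.normSq_eq_conj_mul_self, Complex.normSq_eq_norm_sq]
    push_cast
    rfl
  have h2 : ∀ p ∈ pairs n, c * ‖ψ‖ ^ 2 ≤ (∫ X : Conf n,
      besselPotential β (X p.1 - X p.2) * (conj (wave ψ X) * wave ψ X)).re := by
    intro p hp
    have h3 : ∀ X : Conf n, conj (wave ψ X) * wave ψ X = ((‖wave ψ X‖ ^ 2 : ℝ) : ℂ) := by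
      intro X
      rw [← Complex.normSq_eq_conj_mul_self, Complex.normSq_eq_norm_sq]
    simp only [h3]
    have hint := hψ.2 p hp
    have h4 := integral_re hint
    change _ = (∫ X : Conf n, besselPotential β (X p.1 - X p.2) * ((‖wave ψ X‖ ^ 2 : ℝ) : ℂ)).re
      at h4
    rw [← h4, ← (integral_norm_wave_sq ψ).2, ← integral_const_mul]
    refine integral_mono_ae ((integral_norm_wave_sq ψ).1.const_mul c) hint.re ?_
    filter_upwards [(quasiMeasurePreserving_relPos (ne_of_mem_pairs hp)).ae hv] with X hX
    rw [relPos_apply] at hX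
    change _ ≤ (besselPotential β (X p.1 - X p.2) * ((‖wave ψ X‖ ^ 2 : ℝ) : ℂ)).re
    rw [Complex.re_mul_ofReal]
    exact mul_le_mul_of_nonneg_right hX.2 (by positivity)
  have h5 : ((pairs n).card : ℝ) * (c * ‖ψ‖ ^ 2) ≤ (∑ p ∈ pairs n, ∫ X : Conf n,
      besselPotential β (X p.1 - X p.2) * (conj (wave ψ X) * wave ψ X)).re := by
    rw [Complex.re_sum, ← nsmul_eq_mul, ← Finset.sum_const]
    exact Finset.sum_le_sum h2
  have h6 : inner ℂ ψ ψ = ((‖ψ‖ ^ 2 : ℝ) : ℂ) := inner_self_eq_ofReal ψ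
  rw [sectorForm, h1, h6, Complex.add_re, Complex.add_re, ← Complex.ofReal_pow,
    Complex.re_ofReal_mul, Complex.re_ofReal_mul, Complex.re_ofReal_mul, Complex.ofReal_re,
    Complex.ofReal_re, add_mul, ← add_assoc, sectorConst]
  refine add_le_add_right ?_ _
  rw [mul_assoc]
  refine mul_le_mul_of_nonneg_left ?_ (sq_nonneg lam)
  calc c * (pairs n).card * ‖ψ‖ ^ 2 = (pairs n).card * (c * ‖ψ‖ ^ 2) := by ring
    _ ≤ _ := h5

/-- Jensen's inequality for a discrete probability distribution and `exp (-·)`. -/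
theorem exp_neg_tsum_le {κ : Type*} {p x : κ → ℝ} (hp : ∀ k, 0 ≤ p k) (h1 : HasSum p 1)
    (hx0 : ∀ k, 0 ≤ x k) (hx : Summable fun k => x k * p k) :
    Summable (fun k => p k * Real.exp (-x k)) ∧
      Real.exp (-∑' k, x k * p k) ≤ ∑' k, p k * Real.exp (-x k) := by
  have hs : Summable fun k => p k * Real.exp (-x k) :=
    h1.summable.of_nonneg_of_le (fun k => mul_nonneg (hp k) (Real.exp_nonneg _)) fun k =>
      mul_le_of_le_one_right (hp k) (Real.exp_le_one_iff.2 (neg_nonpos.2 (hx0 k)))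
  refine ⟨hs, ?_⟩
  set e := ∑' k, x k * p k with he
  -- The tangent line of exp(-x) at the mean e, averaged with the weights p, has the value exp(-e).
  have h2 : HasSum (fun k => Real.exp (-e) * ((1 + e) * p k - x k * p k)) (Real.exp (-e)) := by
    have := ((h1.mul_left (1 + e)).sub hx.hasSum).mul_left (Real.exp (-e))
    rwa [← he, mul_one, add_sub_cancel_right, mul_one] at this
  refine hasSum_le (fun k => ?_) h2 hs.hasSum
  have h3 : Real.exp (-x k) = Real.exp (-e) * Real.exp (e - x k) := by
    rw [← Real.exp_add]
    ring_nf
  have h4 := Real.add_one_le_exp (e - x k)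
  rw [h3]
  calc Real.exp (-e) * ((1 + e) * p k - x k * p k) = Real.exp (-e) * p k * (e - x k + 1) := by ring
    _ ≤ Real.exp (-e) * p k * Real.exp (e - x k) :=
        mul_le_mul_of_nonneg_left h4 (mul_nonneg (Real.exp_nonneg _) (hp k))
    _ = _ := by ring

/-- Bessel's inequality for a plane wave: orthonormal states together occupy each momentum
configuration at most once. -/
theorem sum_norm_coeff_sq_le {ι : Type*} {n : ℕ} {b : ι → Sector n} (hb : Orthonormal ℂ b)
    (s : Finset ι) (K : Fin n → Mom) : ∑ i ∈ s, ‖coeff (b i) K‖ ^ 2 ≤ 1 := by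
  have h1 : Orthonormal ℂ fun i => (b i : L2 n) := hb.comp_linearIsometry (symSubspace n).subtypeₗᵢ
  have h2 := h1.sum_inner_products_le (planeWaveLp K) (s := s)
  rw [(orthonormal_planeWaveLp n).1 K, one_pow] at h2
  refine le_trans (le_of_eq (Finset.sum_congr rfl fun i _ => ?_)) h2
  rw [coeff_eq_inner, planeWaveBasis_apply, norm_inner_symm]

/-- The Boltzmann factors of an eigenbasis of the `n`-particle form operator decay exponentially
in `n`, uniformly. -/
theorem exists_sum_exp_neg_le {β lam : ℝ} (hβ : 1 < β) (hlam : 0 < lam) : ∃ D : ℝ, 0 ≤ D ∧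
    ∀ (n : ℕ) (ι : Type) (b : HilbertBasis ι ℂ (Sector n)) (E : ι → ℝ),
      (∀ ψ χ : Sector n,
        (InFormDomain β ψ ∧ ∀ φ, InFormDomain β φ → sectorForm β lam φ ψ = inner ℂ φ χ) ↔
          ∀ i, inner ℂ (b i) χ = E i * inner ℂ (b i) ψ) →
      ∀ s : Finset ι, ∑ i ∈ s, Real.exp (-E i) ≤ Real.exp (D - n) := by
  obtain ⟨c, hc, hq⟩ := re_sectorForm_self_ge (lam := lam) hβ
  set z : ℝ := ∑' k, Real.exp (-(lam * normSq k)) with hz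
  have hz1 : 0 < z :=
    (summable_exp_neg_mul_normSq hlam).tsum_pos (fun k => Real.exp_nonneg _) 0 (Real.exp_pos _)
  set a : ℝ := lam ^ 2 / (2 * (2 * Real.pi) ^ 2)
  -- `α` is the coefficient of n² in the energy bound, from n(n-1)/2 pairs. `B` is the coefficient
  -- of n after removing the entropy n log z and the desired decay n. `D` is what completing the
  -- square costs.
  set α : ℝ := lam ^ 2 * c / 2 with hα
  have hα0 : 0 < α := by positivity
  set B : ℝ := lam + a * (1 - 2 * freeNumber lam) - α - Real.log z - 1 with hB
  set D : ℝ := B ^ 2 / (4 * α) with hD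
  have hkey : ∀ n : ℕ, (n : ℝ) - D ≤
      sectorConst lam n + lam ^ 2 * (c * (pairs n).card) - n * Real.log z := by
    intro n
    have h1 : sectorConst lam n + lam ^ 2 * (c * (pairs n).card) - n * Real.log z - n =
        α * n ^ 2 + B * n + a * freeNumber lam ^ 2 := by
      rw [card_pairs, sectorConst, hB, hα]
      ring
    have h2 : 0 ≤ α * ((n : ℝ) + B / (2 * α)) ^ 2 := by positivity
    have h3 : α * ((n : ℝ) + B / (2 * α)) ^ 2 = α * n ^ 2 + B * n + D := by
      rw [hD]
      field_simp
      ring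
    have h4 : 0 ≤ a * freeNumber lam ^ 2 := by positivity
    linarith
  refine ⟨D, by positivity, fun n ι b E hE s => ?_⟩
  -- An eigenvalue is the form evaluated at its normalized eigenvector.
  have h1 : ∀ i, InFormDomain β (b i) ∧ (sectorForm β lam (b i) (b i)).re = E i := by
    intro i
    have h2 := (hE (b i) ((E i : ℂ) • b i)).2 fun j => inner_basis_smul b E i j
    refine ⟨h2.1, ?_⟩
    rw [h2.2 (b i) h2.1]
    have h3 := inner_self_eq_ofReal (b i)
    rw [b.orthonormal.1, one_pow, Complex.ofReal_one] at h3
    rw [inner_basis_smul, h3, mul_one, Complex.ofReal_re]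
  set κ := sectorConst lam n + lam ^ 2 * (c * (pairs n).card) with hκ
  have h2 : ∀ i, Summable (fun K => ‖coeff (b i) K‖ ^ 2 * Real.exp (-(lam * kinetic K))) ∧
      Real.exp (-E i) ≤ Real.exp (-κ) *
        ∑' K, ‖coeff (b i) K‖ ^ 2 * Real.exp (-(lam * kinetic K)) := by
    intro i
    have h3 := hasSum_coeff_norm_sq (b i)
    rw [b.orthonormal.1, one_pow] at h3
    obtain ⟨h4, h5⟩ := exp_neg_tsum_le (x := fun K => lam * kinetic K) (fun K => sq_nonneg _) h3
      (fun K => mul_nonneg hlam.le (kinetic_nonneg K))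
      (((h1 i).1.1.mul_left lam).congr fun K => (mul_assoc _ _ _).symm)
    refine ⟨h4, le_trans ?_ (mul_le_mul_of_nonneg_left h5 (Real.exp_nonneg _))⟩
    rw [← Real.exp_add, Real.exp_le_exp]
    have h6 := hq n (b i) (h1 i).1
    rw [(h1 i).2, b.orthonormal.1, one_pow, mul_one, ← tsum_mul_left] at h6
    simp only [mul_assoc] at h6 ⊢
    linarith
  calc ∑ i ∈ s, Real.exp (-E i)
      ≤ ∑ i ∈ s, Real.exp (-κ) * ∑' K, ‖coeff (b i) K‖ ^ 2 * Real.exp (-(lam * kinetic K)) :=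
        Finset.sum_le_sum fun i _ => (h2 i).2
    _ = Real.exp (-κ) *
        ∑' K, ∑ i ∈ s, ‖coeff (b i) K‖ ^ 2 * Real.exp (-(lam * kinetic K)) := by
        rw [← Finset.mul_sum, Summable.tsum_finsetSum fun i _ => (h2 i).1]
    _ ≤ Real.exp (-κ) * ∑' K : Fin n → Mom, Real.exp (-(lam * kinetic K)) := by
        refine mul_le_mul_of_nonneg_left ?_ (Real.exp_nonneg _)
        refine Summable.tsum_le_tsum (fun K => ?_) (summable_sum fun i _ => (h2 i).1)
          (summable_exp_neg_mul_kinetic hlam n)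
        rw [← Finset.sum_mul]
        exact mul_le_of_le_one_left (Real.exp_nonneg _) (sum_norm_coeff_sq_le b.orthonormal s K)
    _ ≤ Real.exp (-κ) * z ^ n := by
        exact mul_le_mul_of_nonneg_left (tsum_exp_neg_mul_kinetic_le hlam n) (Real.exp_nonneg _)
    _ ≤ Real.exp (D - n) := by
        rw [← Real.exp_log hz1, ← Real.exp_nat_mul, ← Real.exp_add, Real.exp_le_exp]
        linarith [hkey n]

end EnergyBound

/-! ### Hilbert bases of a Hilbert direct sum -/

section DirectSum

variable {G : ℕ → Type} [∀ n, NormedAddCommGroup (G n)] [∀ n, InnerProductSpace ℂ (G n)]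
  [∀ n, CompleteSpace (G n)] {ι : ℕ → Type}

/-- Hilbert bases of the summands form a Hilbert basis of the Hilbert direct sum. -/
theorem exists_lpBasis (b : ∀ n, HilbertBasis (ι n) ℂ (G n)) :
    ∃ B : HilbertBasis (Σ n, ι n) ℂ (lp G 2),
      ∀ p x, inner ℂ (B p) x = inner ℂ (b p.1 p.2) (x p.1) := by
  classical
  have hin : ∀ (p : Σ n, ι n) (x : lp G 2),
      inner ℂ (lp.single 2 p.1 (b p.1 p.2)) x = inner ℂ (b p.1 p.2) (x p.1) := fun p x =>
    lp.inner_single_left p.1 (b p.1 p.2) x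
  have hon : Orthonormal ℂ fun p : Σ n, ι n => (lp.single 2 p.1 (b p.1 p.2) : lp G 2) := by
    rw [orthonormal_iff_ite]
    rintro ⟨n, i⟩ ⟨m, j⟩
    rw [hin]
    by_cases hnm : n = m
    · subst hnm
      rw [lp.single_apply_self, orthonormal_iff_ite.1 (b n).orthonormal]
      simp
    · rw [lp.single_apply_ne _ _ _ hnm, inner_zero_right, if_neg]
      exact fun h => hnm (Sigma.mk.inj_iff.1 h).1
  have hbot : (Submodule.span ℂ (Set.range fun p : Σ n, ι n =>
      (lp.single 2 p.1 (b p.1 p.2) : lp G 2)))ᗮ = ⊥ := by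
    rw [eq_bot_iff]
    intro x hx
    rw [Submodule.mem_orthogonal] at hx
    rw [Submodule.mem_bot]
    ext n
    refine HilbertBasis.eq_of_inner (b n) fun i => ?_
    have := hx _ (Submodule.subset_span ⟨⟨n, i⟩, rfl⟩)
    rw [hin] at this
    rw [this, lp.coeFn_zero, Pi.zero_apply, inner_zero_right]
  refine ⟨HilbertBasis.mkOfOrthogonalEqBot hon hbot, fun p x => ?_⟩
  rw [HilbertBasis.coe_mkOfOrthogonalEqBot]
  exact hin p x

end DirectSum

/-! ### The Hamiltonian on Fock space and its Boltzmann operator -/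

section GrandCanonical

/-- The sector forms define self-adjoint operators, their direct sum is self-adjoint and bounded
below, and its Boltzmann operator is trace class. -/
theorem exists_hamiltonian {β lam : ℝ} (hβ : 1 < β) (hlam : 0 < lam) :
    ∃ (Hn : ∀ n, Sector n →ₗ.[ℂ] Sector n) (H : Fock →ₗ.[ℂ] Fock),
      (∀ n, IsFormOperator (InFormDomain β) (sectorForm β lam) (Hn n) ∧ IsSelfAdjoint (Hn n)) ∧
      IsDirectSum Hn H ∧ IsSelfAdjoint H ∧ IsBoundedBelow H ∧
      ∃ S : Fock →L[ℂ] Fock, IsExpNeg H S ∧ IsTraceClass S ∧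
        ∃ Z : ℝ, 0 < Z ∧ HasTrace S (Z : ℂ) ∧ IsState (((Z : ℂ)⁻¹) • S) := by
  choose ι b E hE using fun n => exists_sectorBasis hβ hlam n
  obtain ⟨D, hD0, hD⟩ := exists_sum_exp_neg_le hβ hlam
  have hsum : ∀ n (s : Finset (ι n)), ∑ i ∈ s, Real.exp (-E n i) ≤ Real.exp (D - n) :=
    fun n s => hD n (ι n) (b n) (E n) (hE n) s
  choose Hn hHn using fun n => exists_isDiagonal (b n) (E n)
  obtain ⟨B, hB⟩ := exists_lpBasis b
  set μ : (Σ n, ι n) → ℝ := fun p => E p.1 p.2 with hμ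
  obtain ⟨H, hH⟩ := exists_isDiagonal B μ
  -- A single Boltzmann factor is at most e^(D-n) ≤ e^D, which is semiboundedness.
  have hbelow : ∀ p, -D ≤ μ p := by
    intro p
    have h1 := hsum p.1 {p.2}
    rw [Finset.sum_singleton, Real.exp_le_exp] at h1
    have h2 : (0 : ℝ) ≤ (p.1 : ℝ) := Nat.cast_nonneg _
    simp only [hμ]
    linarith
  obtain ⟨S, hSexp, hS⟩ := hH.exists_isExpNeg hD0 hbelow
  have hsummable : Summable fun p => Real.exp (-μ p) := by
    rw [summable_sigma_of_nonneg fun p => (Real.exp_pos _).le]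
    refine ⟨fun n => summable_of_sum_le (fun _ => (Real.exp_pos _).le) (hsum n), ?_⟩
    have hg : Summable fun n : ℕ => Real.exp (D - n) := by
      have h1 := Real.summable_exp_neg_nat.mul_left (Real.exp D)
      refine h1.congr fun n => ?_
      rw [← Real.exp_add, sub_eq_add_neg]
    exact hg.of_nonneg_of_le (fun n => tsum_nonneg fun _ => (Real.exp_pos _).le)
      fun n => Real.tsum_le_of_sum_le (fun _ => (Real.exp_pos _).le) (hsum n)
  -- The vacuum is a nonzero vector, so at least one Boltzmann factor occurs and Z > 0.
  have hne : Nonempty (ι 0) := by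
    by_contra h
    rw [not_nonempty_iff] at h
    have h0 : symWave (0 : Fin 0 → Mom) = 0 := HilbertBasis.eq_of_inner (b 0) fun i => h.elim i
    have h1 : ((symWave (0 : Fin 0 → Mom) : Sector 0) : L2 0) = planeWaveLp 0 := by
      change ∑ σ : Equiv.Perm (Fin 0), planeWaveLp (fun i => (0 : Fin 0 → Mom) (σ i)) = _
      rw [Fintype.sum_unique]
      rfl
    rw [h0] at h1
    have h2 := (orthonormal_planeWaveLp 0).1 0
    rw [← h1, Submodule.coe_zero, norm_zero] at h2
    exact zero_ne_one h2
  obtain ⟨i₀⟩ := hne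
  have hZ : 0 < ∑' p, Real.exp (-μ p) :=
    hsummable.tsum_pos (fun _ => (Real.exp_pos _).le) ⟨0, i₀⟩ (Real.exp_pos _)
  have hnonneg : ∀ p, 0 ≤ Real.exp (-μ p) := fun p => (Real.exp_pos _).le
  refine ⟨Hn, H, fun n => ⟨fun ψ χ => (hHn n ψ χ).trans (hE n ψ χ).symm, (hHn n).isSelfAdjoint⟩,
    fun Ψ Χ => ?_, hH.isSelfAdjoint, hH.isBoundedBelow hbelow, S, hSexp,
    isTraceClass_of_diagonal hS hnonneg hsummable, _, hZ, hasTrace_of_diagonal hS hnonneg hsummable,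
    isState_of_diagonal (b := B) (s := fun p => (∑' p, Real.exp (-μ p))⁻¹ * Real.exp (-μ p))
      (fun x p => ?_) (fun p => mul_nonneg (inv_nonneg.2 hZ.le) (hnonneg p)) ?_⟩
  · rw [hH]
    simp only [hB]
    constructor
    · intro h n
      rw [hHn]
      exact fun i => h ⟨n, i⟩
    · intro h p
      have := h p.1
      rw [hHn] at this
      exact this p.2
  · rw [smul_apply, inner_smul_right, hS]
    push_cast
    ring
  · have := hsummable.hasSum.mul_left (∑' p, Real.exp (-μ p))⁻¹
    rwa [inv_mul_cancel₀ hZ.ne'] at this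

end GrandCanonical

/-! ### Trigonometric polynomials and annihilation operators -/

section TrigPolynomial

/-- `f` is almost everywhere a trigonometric polynomial with coefficients `c`. -/
def IsTrig {n : ℕ} (f : Conf n → ℂ) (c : (Fin n → Mom) → ℂ) : Prop :=
  ∃ F : Finset (Fin n → Mom), (∀ K ∉ F, c K = 0) ∧
    f =ᵐ[volume] fun X => ∑ K ∈ F, c K * planeWave K X

theorem isTrig_wave {n : ℕ} {ψ : Sector n} (h : {K | coeff ψ K ≠ 0}.Finite) :
    IsTrig (wave ψ) (coeff ψ) := by
  have hF : ∀ K ∉ h.toFinset, coeff ψ K = 0 := fun K hK => by simpa using hK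
  refine ⟨h.toFinset, hF, ?_⟩
  filter_upwards [wave_ae_eq_trigPart hF] with X hX
  rw [hX, trigPart_apply]

theorem IsTrig.hasSum_integral {n : ℕ} {f g : Conf n → ℂ} {c d : (Fin n → Mom) → ℂ}
    (hf : IsTrig f c) (hg : IsTrig g d) :
    HasSum (fun K => conj (c K) * d K) (∫ X, conj (f X) * g X) := by
  classical
  obtain ⟨F, hF, hf⟩ := hf
  obtain ⟨G, hG, hg⟩ := hg
  have hext : ∀ (c : (Fin n → Mom) → ℂ) (F U : Finset (Fin n → Mom)), (∀ K ∉ F, c K = 0) →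
      F ⊆ U → ∀ X : Conf n, ∑ K ∈ F, c K * planeWave K X = (∑ K ∈ U, c K • planeWaveC K) X := by
    intro c F U hc hFU X
    rw [ContinuousMap.sum_apply]
    exact Finset.sum_subset hFU fun K _ hK => by rw [hc K hK, zero_mul]
  have h1 : ∫ X, conj (f X) * g X = ∑ K ∈ F ∪ G, conj (c K) * d K := by
    rw [← (orthonormal_planeWaveLp n).inner_sum]
    have h2 : ∀ c : (Fin n → Mom) → ℂ, ∑ K ∈ F ∪ G, c K • planeWaveLp K =
        ContinuousMap.toLp (E := ℂ) 2 (volume : Measure (Conf n)) ℂ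
          (∑ K ∈ F ∪ G, c K • planeWaveC K) := by
      intro c
      rw [map_sum]
      simp only [map_smul]
      rfl
    rw [h2, h2, ContinuousMap.inner_toLp]
    apply integral_congr_ae
    filter_upwards [hf, hg] with X hX hX'
    rw [hX, hX', hext c F _ hF Finset.subset_union_left, hext d G _ hG Finset.subset_union_right,
      mul_comm]
  rw [h1]
  refine hasSum_sum_of_ne_finset_zero fun K hK => ?_
  rw [hF K fun h => hK (Finset.mem_union_left _ h), map_zero, zero_mul]

theorem character_mul_planeWave {n : ℕ} (S K : Fin n → Mom) (X : Conf n) :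
    character S X * planeWave K X = planeWave (K + S) X := by
  rw [planeWave_eq_character, planeWave_eq_character, character_add]
  ring

theorem IsTrig.character_mul {n : ℕ} {f : Conf n → ℂ} {c : (Fin n → Mom) → ℂ} (hf : IsTrig f c)
    (S : Fin n → Mom) : IsTrig (fun X => character S X * f X) fun K => c (K - S) := by
  classical
  obtain ⟨F, hF, hf⟩ := hf
  refine ⟨F.map (addRightEmbedding S), fun K hK => hF _ fun h => hK ?_, ?_⟩
  · exact Finset.mem_map.2 ⟨K - S, h, sub_add_cancel K S⟩
  · filter_upwards [hf] with X hX
    rw [hX, Finset.mul_sum, Finset.sum_map]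
    refine Finset.sum_congr rfl fun K _ => ?_
    rw [addRightEmbedding_apply, add_sub_cancel_right, ← character_mul_planeWave]
    ring

theorem measurePreserving_snoc (n : ℕ) :
    MeasurePreserving
      (fun p : Conf n × Torus => (Fin.snoc (α := fun _ => Torus) p.1 p.2 : Conf (n + 1)))
      (volume.prod volume) volume := by
  have h1 := (volume_preserving_piFinSuccAbove (fun _ : Fin (n + 1) => Torus) (Fin.last n)).symm
  have h2 := h1.comp (Measure.measurePreserving_swap (μ := (volume : Measure (Conf n)))
    (ν := (volume : Measure Torus)))
  have h3 : (fun p : Conf n × Torus => (Fin.snoc (α := fun _ => Torus) p.1 p.2 : Conf (n + 1))) =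
      (MeasurableEquiv.piFinSuccAbove (fun _ => Torus) (Fin.last n)).symm ∘ Prod.swap :=
    funext fun p => (Fin.insertNth_last' p.2 p.1).symm
  rw [h3]
  exact h2

theorem planeWave_snoc {n : ℕ} (L : Fin (n + 1) → Mom) (X : Conf n) (x : Torus) :
    planeWave L (Fin.snoc (α := fun _ => Torus) X x) =
      planeWave (Fin.init L) X * mode (L (Fin.last n)) x := by
  rw [planeWave, Fin.prod_univ_castSucc]
  simp only [Fin.snoc_castSucc, Fin.snoc_last]
  rfl

/-- Orthogonality of the modes selects the configurations whose last momentum is k. On coefficients,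
`annihilate k` fixes that last momentum and multiplies by √(n+1). -/
theorem IsTrig.annihilate {n : ℕ} {Ψ : Waves} {c : (Fin (n + 1) → Mom) → ℂ}
    (h : IsTrig (Ψ (n + 1)) c) (k : Mom) :
    IsTrig (annihilate k Ψ n)
      fun K => (Real.sqrt (n + 1) : ℂ) * c (Fin.snoc (α := fun _ => Mom) K k) := by
  classical
  obtain ⟨F, hF, hf⟩ := h
  -- Once the last momentum is fixed, dropping it loses no information, so no two terms merge.
  have hinj : Set.InjOn (Fin.init : (Fin (n + 1) → Mom) → Fin n → Mom)
      (F.filter fun L => L (Fin.last n) = k) := by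
    intro L hL L' hL' h
    have h1 : L (Fin.last n) = k := (Finset.mem_filter.1 hL).2
    have h2 : L' (Fin.last n) = k := (Finset.mem_filter.1 hL').2
    rw [← Fin.snoc_init_self L, ← Fin.snoc_init_self L', h, h1, h2]
  refine ⟨(F.filter fun L => L (Fin.last n) = k).image Fin.init, fun K hK => ?_, ?_⟩
  · have h1 : c (Fin.snoc (α := fun _ => Mom) K k) = 0 := hF _ fun h => hK
      (Finset.mem_image.2 ⟨_, Finset.mem_filter.2 ⟨h, Fin.snoc_last _ _⟩, Fin.init_snoc _ _⟩)
    dsimp only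
    rw [h1, mul_zero]
  · have h1 := Measure.ae_ae_of_ae_prod ((measurePreserving_snoc n).quasiMeasurePreserving.ae hf)
    filter_upwards [h1] with X hX
    have h2 : ∫ x, conj (mode k x) * Ψ (n + 1) (Fin.snoc (α := fun _ => Torus) X x) =
        ∑ L ∈ F, if k = L (Fin.last n) then c L * planeWave (Fin.init L) X else 0 := by
      have h3 : ∫ x, conj (mode k x) * Ψ (n + 1) (Fin.snoc (α := fun _ => Torus) X x) =
          ∫ x, ∑ L ∈ F, c L * planeWave (Fin.init L) X *
            (conj (mode k x) * mode (L (Fin.last n)) x) := by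
        apply integral_congr_ae
        filter_upwards [hX] with x hx
        rw [hx, Finset.mul_sum]
        refine Finset.sum_congr rfl fun L _ => ?_
        rw [planeWave_snoc]
        ring
      rw [h3, integral_finsetSum]
      · refine Finset.sum_congr rfl fun L _ => ?_
        rw [integral_const_mul, integral_conj_mode_mul_mode]
        split_ifs <;> simp
      · intro L _
        refine Integrable.const_mul ?_ _
        have hc : Continuous fun x => conj (mode k x) * mode (L (Fin.last n)) x := by fun_prop
        exact hc.integrable_of_hasCompactSupport (HasCompactSupport.of_compactSpace _)
    rw [BesselGas.annihilate, h2, Finset.sum_image hinj, Finset.mul_sum, Finset.sum_filter]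
    refine Finset.sum_congr rfl fun L _ => ?_
    by_cases hk : L (Fin.last n) = k
    · rw [if_pos hk.symm, if_pos hk]
      subst hk
      rw [Fin.snoc_init_self]
      ring
    · rw [if_neg (Ne.symm hk), if_neg hk, mul_zero]

end TrigPolynomial

/-! ### Trigonometric polynomials in the operator domain -/

section Domain

theorem hasSum_inner_of_finite {n : ℕ} (φ : Sector n) {ψ : Sector n} (g : (Fin n → Mom) → ℂ)
    (F : Finset (Fin n → Mom)) (hF : ∀ K ∉ F, coeff ψ K = 0) :
    HasSum (fun K => g K * (conj (coeff φ K) * coeff ψ K))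
      (inner ℂ (φ : L2 n) (∑ K ∈ F, (g K * coeff ψ K) • planeWaveLp K)) := by
  have h : inner ℂ (φ : L2 n) (∑ K ∈ F, (g K * coeff ψ K) • planeWaveLp K) =
      ∑ K ∈ F, g K * (conj (coeff φ K) * coeff ψ K) := by
    rw [inner_sum]
    refine Finset.sum_congr rfl fun K _ => ?_
    rw [inner_smul_right, ← inner_conj_symm, ← planeWaveBasis_apply, ← coeff_eq_inner]
    ring
  rw [h]
  exact hasSum_sum_of_ne_finset_zero fun K hK => by rw [hF K hK, mul_zero, mul_zero]

/-- Trigonometric polynomials lie in the operator domain. -/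
theorem exists_sectorForm_eq_inner {β lam : ℝ} {n : ℕ} {ψ : Sector n}
    (h : {K | coeff ψ K ≠ 0}.Finite) :
    ∃ χ : Sector n, ∀ φ, sectorForm β lam φ ψ = inner ℂ φ χ := by
  have hF : ∀ K ∉ h.toFinset, coeff ψ K = 0 := fun K hK => by simpa using hK
  -- The potential is in L² and the trigonometric polynomial is bounded, so their product is an L²
  -- vector representing the pair interaction.
  have hint : ∀ p : pairs n, ∃ f : L2 n, ∀ φ : Sector n,
      ∫ X : Conf n, besselPotential β (X p.1.1 - X p.1.2) * (conj (wave φ X) * wave ψ X) =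
        inner ℂ (φ : L2 n) f := by
    intro p
    have hv := memLp_comp_relPos (ne_of_mem_pairs p.2) (Lp.memLp (besselPotential β))
    have hm : MemLp (fun X : Conf n => besselPotential β (X p.1.1 - X p.1.2) *
        trigPart ψ h.toFinset X) 2 volume := by
      have hb : MemLp (trigPart ψ h.toFinset) ∞ (volume : Measure (Conf n)) :=
        memLp_top_of_bound (trigPart ψ h.toFinset).continuous.aestronglyMeasurable
          ‖trigPart ψ h.toFinset‖ (ae_of_all _ fun X => (trigPart ψ h.toFinset).norm_coe_le_norm X)
      exact hb.mul hv
    refine ⟨hm.toLp _, fun φ => ?_⟩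
    rw [MeasureTheory.L2.inner_def]
    apply integral_congr_ae
    filter_upwards [hm.coeFn_toLp, wave_ae_eq_trigPart hF] with X h1 h2
    rw [h1, h2, RCLike.inner_apply]
    change _ = _ * conj (wave φ X)
    ring
  choose f hf using hint
  let χ : L2 n := (lam : ℂ) • (∑ K ∈ h.toFinset, ((kinetic K : ℂ) * coeff ψ K) • planeWaveLp K) +
    (sectorConst lam n : ℂ) • (ψ : L2 n) + (lam : ℂ) ^ 2 • ∑ p, f p
  -- Only symmetric φ are tested, so `χ` may be replaced by its symmetric projection.
  refine ⟨(symSubspace n).orthogonalProjectionOnto χ, fun φ => ?_⟩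
  have h1 : inner ℂ φ ((symSubspace n).orthogonalProjectionOnto χ) = inner ℂ (φ : L2 n) χ :=
    (symSubspace n).inner_orthogonalProjectionOnto_eq_of_mem_left φ χ
  have h2 : inner ℂ φ ψ = inner ℂ (φ : L2 n) (ψ : L2 n) := rfl
  rw [h1, inner_add_right, inner_add_right, inner_smul_right, inner_smul_right, inner_smul_right,
    ← (hasSum_inner_of_finite φ _ _ hF).tsum_eq, inner_sum, sectorForm,
    ← Finset.sum_coe_sort (pairs n)]
  simp only [hf, h2]
  rfl

end Domain

/-! ### Kinetic and interaction matrix elements in momentum space -/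

section MatrixElements

theorem inner_eq_integral {n : ℕ} (φ ψ : Sector n) :
    inner ℂ φ ψ = ∫ X, conj (wave φ X) * wave ψ X := by
  change inner ℂ (φ : L2 n) (ψ : L2 n) = _
  rw [MeasureTheory.L2.inner_def]
  congr 1
  ext X
  exact mul_comm _ _

theorem hasSum_fiberwise {α α' γ : Type*} (e : α × α' ≃ γ) {f : γ → ℂ} {a : ℂ} (hf : HasSum f a)
    (hfin : f.support.Finite) : HasSum (fun x => ∑' y, f (e (x, y))) a := by
  refine (e.hasSum_iff.2 hf).prod_fiberwise fun x => Summable.hasSum ?_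
  refine summable_of_hasFiniteSupport ?_
  refine (hfin.preimage (f := fun y => e (x, y)) ?_)
  exact fun y _ y' _ h => (Prod.ext_iff.1 (e.injective h)).2

/-- Symmetry: the kinetic energy is `n + 1` times that of the last particle. -/
theorem hasSum_kinetic_last {n : ℕ} (φ : Sector (n + 1)) {ψ : Sector (n + 1)}
    (h : {K | coeff ψ K ≠ 0}.Finite) :
    HasSum (fun K => (((n + 1 : ℝ) * (normSq (K (Fin.last n)) + 1) : ℝ) : ℂ) *
        (conj (coeff φ K) * coeff ψ K))
      ((∑' K, (kinetic K : ℂ) * (conj (coeff φ K) * coeff ψ K)) +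
        ((n : ℂ) + 1) * inner ℂ φ ψ) := by
  have hs : ∀ g : (Fin (n + 1) → Mom) → ℂ,
      Summable fun K => g K * (conj (coeff φ K) * coeff ψ K) := by
    intro g
    refine summable_of_hasFiniteSupport (h.subset fun K hK => ?_)
    exact fun h0 => hK (by simp only [h0, mul_zero])
  have h1 : ∀ j, HasSum (fun K => (normSq (K j) : ℂ) * (conj (coeff φ K) * coeff ψ K))
      (∑' K, (normSq (K (Fin.last n)) : ℂ) * (conj (coeff φ K) * coeff ψ K)) := by
    intro j
    have h2 := (hs fun K => (normSq (K (Fin.last n)) : ℂ)).hasSum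
    rw [← (Equiv.arrowCongr (Equiv.swap j (Fin.last n)) (Equiv.refl Mom)).hasSum_iff] at h2
    refine h2.congr_summand fun K => ?_
    have h3 : ∀ θ : Sector (n + 1), coeff θ ((Equiv.arrowCongr (Equiv.swap j (Fin.last n))
        (Equiv.refl Mom)) K) = coeff θ K := fun θ => coeff_perm θ _ K
    have h4 : (Equiv.arrowCongr (Equiv.swap j (Fin.last n)) (Equiv.refl Mom)) K (Fin.last n) =
        K j := by
      simp
    rw [Function.comp_apply, h3, h3, h4]
  have h2 := hasSum_sum (s := Finset.univ) fun j _ => h1 j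
  rw [Finset.sum_const, Finset.card_univ, Fintype.card_fin, nsmul_eq_mul] at h2
  have h3 : ∑' K, (kinetic K : ℂ) * (conj (coeff φ K) * coeff ψ K) =
      ((n + 1 : ℕ) : ℂ) * ∑' K, (normSq (K (Fin.last n)) : ℂ) * (conj (coeff φ K) * coeff ψ K) := by
    refine HasSum.tsum_eq (h2.congr_summand fun K => ?_)
    rw [kinetic, Complex.ofReal_sum, Finset.sum_mul]
  rw [h3]
  have h4 := (((h1 (Fin.last n)).add (hasSum_coeff_inner φ ψ)).mul_left ((n + 1 : ℕ) : ℂ))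
  rw [mul_add] at h4
  push_cast at h4 ⊢
  exact h4.congr_summand fun K => by ring

/-- Momentum transfer `k` from the last particle but one to the last. -/
def transfer (n : ℕ) (k : Mom) : Fin (n + 2) → Mom :=
  Pi.single (Fin.last (n + 1)) k - Pi.single (Fin.last n).castSucc k

theorem snoc_add_transfer {n : ℕ} (K : Fin n → Mom) (p q k : Mom) :
    (Fin.snoc (α := fun _ => Mom) (Fin.snoc (α := fun _ => Mom) K q : Fin (n + 1) → Mom) p :
      Fin (n + 2) → Mom) + transfer n k =
    Fin.snoc (α := fun _ => Mom)
      (Fin.snoc (α := fun _ => Mom) K (q - k) : Fin (n + 1) → Mom) (p + k) := by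
  funext j
  refine Fin.lastCases ?_ (fun j => ?_) j
  · simp [transfer]
  · refine Fin.lastCases ?_ (fun j => ?_) j
    · simp [transfer, Pi.single_eq_of_ne, (Fin.castSucc_lt_last _).ne, sub_eq_add_neg]
    · simp [transfer, Pi.single_eq_of_ne, (Fin.castSucc_lt_last _).ne]

theorem exists_perm_pair {α : Type*} [DecidableEq α] {i j a b : α} (hij : i ≠ j) (hab : a ≠ b) :
    ∃ σ : Equiv.Perm α, σ i = a ∧ σ j = b := by
  refine ⟨Equiv.swap b (Equiv.swap i a j) * Equiv.swap i a, ?_, ?_⟩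
  · rw [Equiv.Perm.mul_apply, Equiv.swap_apply_left, Equiv.swap_apply_of_ne_of_ne hab]
    intro h
    exact hij ((Equiv.swap i a).injective (by rw [← h, Equiv.swap_apply_left]))
  · rw [Equiv.Perm.mul_apply, Equiv.swap_apply_right]

/-- The correlation of two wave functions at total momentum transfer `S`. -/
def correlation {n : ℕ} (φ ψ : Sector n) (S : Fin n → Mom) : ℂ :=
  ∑' K, conj (coeff φ (K + S)) * coeff ψ K

theorem correlation_perm {n : ℕ} (φ ψ : Sector n) (σ : Equiv.Perm (Fin n)) (S : Fin n → Mom) :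
    correlation φ ψ (fun i => S (σ i)) = correlation φ ψ S := by
  rw [correlation, correlation, ← (Equiv.arrowCongr σ (Equiv.refl Mom)).tsum_eq
    fun K => conj (coeff φ (K + S)) * coeff ψ K]
  congr 1
  ext K
  have h3 : coeff ψ ((Equiv.arrowCongr σ (Equiv.refl Mom)) K) = coeff ψ K :=
    coeff_perm ψ σ.symm K
  have h4 : coeff φ ((Equiv.arrowCongr σ (Equiv.refl Mom)) K + S) =
      coeff φ (K + fun i => S (σ i)) := by
    rw [← coeff_perm φ σ]
    congr 1
    funext i
    simp
  rw [h3, h4]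

/-- A permutation carries the pair (i, j) to the last two particles and leaves the correlation
unchanged. Hence every pair of particles contributes equally. -/
theorem correlation_single {n : ℕ} (φ ψ : Sector (n + 2)) {i j : Fin (n + 2)} (hij : i ≠ j)
    (k : Mom) : correlation φ ψ (Pi.single i k - Pi.single j k) =
      correlation φ ψ (transfer n k) := by
  obtain ⟨σ, hi, hj⟩ := exists_perm_pair hij
    (show Fin.last (n + 1) ≠ (Fin.last n).castSucc from (Fin.castSucc_lt_last _).ne')
  rw [← correlation_perm φ ψ σ (transfer n k)]
  congr 1
  funext l
  rw [transfer, ← hi, ← hj]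
  simp [Pi.single_apply]

theorem correlation_zero {n : ℕ} (φ ψ : Sector n) : correlation φ ψ 0 = inner ℂ φ ψ := by
  rw [correlation, ← (hasSum_coeff_inner φ ψ).tsum_eq]
  simp only [add_zero]

theorem hasSum_correlation {n : ℕ} (φ : Sector n) {ψ : Sector n}
    (h : {K | coeff ψ K ≠ 0}.Finite) (S : Fin n → Mom) :
    HasSum (fun K => conj (coeff φ (K + S)) * coeff ψ K) (correlation φ ψ S) := by
  refine (summable_of_hasFiniteSupport (h.subset fun K hK => ?_)).hasSum
  exact fun h0 => hK (by simp only [h0, mul_zero])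

/-- A Fourier mode of the relative position is a character that adds k to the momentum of particle i
and removes it from particle j. -/
theorem mode_sub (k : Mom) {n : ℕ} (i j : Fin n) (X : Conf n) :
    mode k (X i - X j) = ((2 * Real.pi : ℝ) : ℂ)⁻¹ *
      character (Pi.single i k - Pi.single j k) X := by
  have h1 : ∀ i : Fin n, character (Pi.single i k) X = ∏ a, fourier (k a) (X i a) := by
    intro i
    change ∏ j', ∏ a', fourier ((Pi.single i k : Fin n → Mom) j' a') (X j' a') = _
    rw [Finset.prod_eq_single i]
    · rw [Pi.single_eq_same]
    · intro j' _ h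
      rw [Pi.single_eq_of_ne h]
      simp
    · simp
  have h2 : (Pi.single i k - Pi.single j k : Fin n → Mom) = Pi.single i k + -Pi.single j k :=
    sub_eq_add_neg _ _
  rw [h2, character_add, character_neg, h1, h1, map_prod, ← Finset.prod_mul_distrib]
  change _ * ∏ a, fourier (k a) ((X i - X j) a) = _
  congr 1
  refine Finset.prod_congr rfl fun a _ => ?_
  rw [Pi.sub_apply, ← fourier_neg, fourier_apply, fourier_apply, fourier_apply, smul_sub,
    sub_eq_add_neg, AddCircle.toCircle_add, neg_smul, Circle.coe_mul]

theorem integral_character_mul {n : ℕ} {φ ψ : Sector n} (hφ : {K | coeff φ K ≠ 0}.Finite)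
    (hψ : {K | coeff ψ K ≠ 0}.Finite) (S : Fin n → Mom) :
    ∫ X, character S X * (conj (wave φ X) * wave ψ X) = correlation φ ψ S := by
  have h1 := (isTrig_wave hφ).hasSum_integral ((isTrig_wave hψ).character_mul S)
  rw [← (Equiv.addRight S).hasSum_iff] at h1
  have h2 := h1.unique ((hasSum_correlation φ hψ S).congr_summand fun K => by simp)
  rw [← h2]
  congr 1
  ext X
  ring

/-- The Fourier series of the interaction energy of a pair of particles. -/
theorem hasSum_interaction {β : ℝ} (hβ : 1 < β) {n : ℕ} {φ ψ : Sector (n + 2)}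
    (hφ : {K | coeff φ K ≠ 0}.Finite) (hψ : {K | coeff ψ K ≠ 0}.Finite)
    {p : Fin (n + 2) × Fin (n + 2)} (hp : p.1 ≠ p.2) :
    HasSum (fun k => ((((2 * Real.pi) ^ 2)⁻¹ * besselCoeff β k : ℝ) : ℂ) *
        correlation φ ψ (transfer n k))
      (∫ X : Conf (n + 2),
        besselPotential β (X p.1 - X p.2) * (conj (wave φ X) * wave ψ X)) := by
  obtain ⟨F, -, hF⟩ := isTrig_wave hφ
  obtain ⟨G, -, hG⟩ := isTrig_wave hψ
  -- A continuous representative of conj(φ) ψ, against which the L² series of the potential can be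
  -- integrated term by term.
  let g : C(Conf (n + 2), ℂ) := star (∑ K ∈ F, coeff φ K • planeWaveC K) *
    ∑ K ∈ G, coeff ψ K • planeWaveC K
  have hg : (fun X => conj (wave φ X) * wave ψ X) =ᵐ[volume] g := by
    filter_upwards [hF, hG] with X h1 h2
    rw [h1, h2]
    change _ = star ((∑ K ∈ F, coeff φ K • planeWaveC K) X) *
      (∑ K ∈ G, coeff ψ K • planeWaveC K) X
    rw [ContinuousMap.sum_apply, ContinuousMap.sum_apply]
    rfl
  obtain ⟨Λ, hΛ⟩ := exists_relPos_functional hp g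
  have hΛ' : ∀ f, Λ f = ∫ X : Conf (n + 2), f (X p.1 - X p.2) * (conj (wave φ X) * wave ψ X) := by
    intro f
    rw [hΛ]
    apply integral_congr_ae
    filter_upwards [hg] with X hX
    rw [← hX]
  have h1 := (hasSum_besselPotential hβ).mapL Λ
  rw [hΛ'] at h1
  refine h1.congr_summand fun k => ?_
  rw [map_smul, hΛ', smul_eq_mul, ← correlation_single φ ψ hp, ← integral_character_mul hφ hψ]
  have h2 : ∫ X : Conf (n + 2), modeLp k (X p.1 - X p.2) * (conj (wave φ X) * wave ψ X) =
      ∫ X : Conf (n + 2), ((2 * Real.pi : ℝ) : ℂ)⁻¹ *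
        (character (Pi.single p.1 k - Pi.single p.2 k) X * (conj (wave φ X) * wave ψ X)) := by
    apply integral_congr_ae
    filter_upwards [(quasiMeasurePreserving_relPos hp).ae
      (ContinuousMap.coeFn_toLp (p := 2) (𝕜 := ℂ) volume (mode k))] with X hX
    rw [relPos_apply] at hX
    rw [modeLp, hX, mode_sub, mul_assoc]
  rw [h2, integral_const_mul]
  push_cast
  ring

end MatrixElements

/-! ### Comparison with the formal Hamiltonian -/

section FormalHamiltonian

theorem pairing_eq_tsum {Φ Ψ : Waves} {c d : ∀ n, (Fin n → Mom) → ℂ}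
    (hΦ : ∀ n, IsTrig (Φ n) (c n)) (hΨ : ∀ n, IsTrig (Ψ n) (d n)) :
    pairing Φ Ψ = ∑' n, ∑' K, conj (c n K) * d n K := by
  rw [pairing]
  congr 1
  ext n
  exact ((hΦ n).hasSum_integral (hΨ n)).tsum_eq.symm

theorem IsFinite.isTrig_waves {Ψ : Fock} (h : IsFinite Ψ) (n : ℕ) :
    IsTrig (waves Ψ n) (coeff (Ψ n)) := isTrig_wave (h.2 n)

theorem IsFinite.exists_bound {Ψ : Fock} (h : IsFinite Ψ) : ∃ N, ∀ n, N ≤ n → Ψ n = 0 := by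
  obtain ⟨M, hM⟩ := h.1.bddAbove
  refine ⟨M + 1, fun n hn => ?_⟩
  by_contra h0
  exact absurd (hM h0) (by omega)

theorem conj_sqrt_mul_sqrt (n : ℕ) (z w : ℂ) :
    conj ((Real.sqrt (n + 1) : ℂ) * z) * ((Real.sqrt (n + 1) : ℂ) * w) =
      ((n : ℂ) + 1) * (conj z * w) := by
  have h : ((Real.sqrt (n + 1) : ℝ) : ℂ) * (Real.sqrt (n + 1) : ℝ) = (n : ℂ) + 1 := by
    rw [← Complex.ofReal_mul, Real.mul_self_sqrt (by positivity)]
    push_cast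
    rfl
  rw [map_mul, Complex.conj_ofReal, ← h]
  ring

/-- The sesquilinear form of `-∑ⱼ Δⱼ`. -/
def kineticForm {n : ℕ} (φ ψ : Sector n) : ℂ :=
  ∑' K : Fin n → Mom, (kinetic K : ℂ) * (conj (coeff φ K) * coeff ψ K)

/-- The sesquilinear form of `∑_{i<j} v_β(xᵢ - xⱼ)`. -/
def interactionForm (β : ℝ) {n : ℕ} (φ ψ : Sector n) : ℂ :=
  ∑ p ∈ pairs n, ∫ X : Conf n,
    besselPotential β (X p.1 - X p.2) * (conj (wave φ X) * wave ψ X)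

/-- The zero mode n² - n is grouped with the interaction, where it cancels the k = 0 term and leaves
the sum over k ≠ 0. -/
theorem sectorForm_eq (β lam : ℝ) {n : ℕ} (φ ψ : Sector n) :
    sectorForm β lam φ ψ = lam * (kineticForm φ ψ + n * inner ℂ φ ψ) +
      (((lam : ℂ) ^ 2 * interactionForm β φ ψ -
        ((lam ^ 2 / (2 * (2 * Real.pi) ^ 2) : ℝ) : ℂ) * ((n : ℂ) ^ 2 - n) * inner ℂ φ ψ) +
        ((lam ^ 2 / (2 * (2 * Real.pi) ^ 2) : ℝ) : ℂ) *
          ((((n : ℝ) - freeNumber lam : ℝ) : ℂ) ^ 2 * inner ℂ φ ψ)) := by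
  rw [sectorForm, kineticForm, interactionForm]
  push_cast
  ring

theorem sectorForm_zero_right (β lam : ℝ) {n : ℕ} (φ : Sector n) : sectorForm β lam φ 0 = 0 := by
  have h1 : ∀ p : Fin n × Fin n, ∫ X : Conf n, besselPotential β (X p.1 - X p.2) *
      (conj (wave φ X) * wave (0 : Sector n) X) = 0 := by
    intro p
    have h2 : (fun X : Conf n => besselPotential β (X p.1 - X p.2) *
        (conj (wave φ X) * wave (0 : Sector n) X)) =ᵐ[volume] 0 := by
      have h3 : wave (0 : Sector n) =ᵐ[volume] 0 := Lp.coeFn_zero _ _ _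
      filter_upwards [h3] with X hX
      simp only [hX, Pi.zero_apply, mul_zero]
    exact integral_eq_zero_of_ae h2
  have h2 : inner ℂ φ (0 : Sector n) = 0 := inner_zero_right _
  rw [sectorForm, h2]
  simp only [h1, coeff_zero, mul_zero, tsum_zero, Finset.sum_const_zero, add_zero]

theorem kineticForm_sector_zero (φ ψ : Sector 0) : kineticForm φ ψ = 0 := by
  simp [kineticForm, kinetic]

theorem interactionForm_of_le_one (β : ℝ) {n : ℕ} (hn : n ≤ 1) (φ ψ : Sector n) :
    interactionForm β φ ψ = 0 := by
  have h : pairs n = ∅ := by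
    rw [pairs, Finset.filter_eq_empty_iff]
    intro p _ hp
    have := p.2.2
    have : (p.1 : ℕ) < p.2 := hp
    omega
  rw [interactionForm, h, Finset.sum_empty]

theorem hasSum_pairing_annihilate {Φ Ψ : Fock} (hΦ : IsFinite Φ) (hΨ : IsFinite Ψ) {N : ℕ}
    (hN : ∀ n, N ≤ n → Ψ n = 0) :
    HasSum (fun k : Mom => ((normSq k + 1 : ℝ) : ℂ) *
        pairing (annihilate k (waves Φ)) (annihilate k (waves Ψ)))
      (∑ n ∈ Finset.range (N + 1),
        (kineticForm (Φ (n + 1)) (Ψ (n + 1)) +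
          ((n : ℂ) + 1) * inner ℂ (Φ (n + 1)) (Ψ (n + 1)))) := by
  have h1 := hasSum_sum (s := Finset.range (N + 1)) fun n _ =>
    hasSum_fiberwise (Fin.snocEquiv fun _ : Fin (n + 1) => Mom)
      (hasSum_kinetic_last (Φ (n + 1)) (hΨ.2 (n + 1)))
      ((hΨ.2 (n + 1)).subset fun K hK h0 => hK (by simp only [h0, mul_zero]))
  refine h1.congr_summand fun k => ?_
  rw [pairing_eq_tsum (fun n => (hΦ.isTrig_waves (n + 1)).annihilate k)
    (fun n => (hΨ.isTrig_waves (n + 1)).annihilate k), tsum_eq_sum (s := Finset.range (N + 1)),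
    Finset.mul_sum]
  · refine Finset.sum_congr rfl fun n _ => ?_
    rw [← tsum_mul_left]
    congr 1
    ext K
    have h2 : (Fin.snocEquiv fun _ : Fin (n + 1) => Mom) (k, K) =
        Fin.snoc (α := fun _ => Mom) K k := rfl
    rw [conj_sqrt_mul_sqrt, h2, Fin.snoc_last]
    push_cast
    ring
  · intro n hn
    rw [Finset.mem_range, not_lt] at hn
    rw [hN (n + 1) (by omega)]
    simp only [coeff_zero, mul_zero, tsum_zero]

/-- A configuration of `n + 2` momenta as the last one, the last but one, and the others. -/
def snocSnocEquiv (n : ℕ) : (Mom × Mom) × (Fin n → Mom) ≃ (Fin (n + 2) → Mom) :=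
  (Equiv.prodAssoc Mom Mom (Fin n → Mom)).trans
    (((Equiv.refl Mom).prodCongr (Fin.snocEquiv fun _ : Fin (n + 1) => Mom)).trans
      (Fin.snocEquiv fun _ : Fin (n + 2) => Mom))

/-- Two annihilations give (n+1)(n+2) in the pairing. The sums over p, q and the remaining n momenta
combine into one over all configurations of n + 2 particles, and the shifts p + k, q - k on the left
become `transfer n k`. -/
theorem hasSum_pairing_annihilate_annihilate {Φ Ψ : Fock} (hΦ : IsFinite Φ) (hΨ : IsFinite Ψ)
    {N : ℕ} (hN : ∀ n, N ≤ n → Ψ n = 0) (k : Mom) :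
    HasSum (fun pq : Mom × Mom =>
        pairing (annihilate (pq.2 - k) (annihilate (pq.1 + k) (waves Φ)))
          (annihilate pq.2 (annihilate pq.1 (waves Ψ))))
      (∑ n ∈ Finset.range N, ((n : ℂ) + 1) * ((n : ℂ) + 2) *
        correlation (Φ (n + 2)) (Ψ (n + 2)) (transfer n k)) := by
  have h1 := hasSum_sum (s := Finset.range N) fun n _ =>
    (hasSum_fiberwise (snocSnocEquiv n)
      (hasSum_correlation (Φ (n + 2)) (hΨ.2 (n + 2)) (transfer n k))
      ((hΨ.2 (n + 2)).subset fun K hK h0 => hK (by simp only [h0, mul_zero]))).mul_left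
        (((n : ℂ) + 1) * ((n : ℂ) + 2))
  refine h1.congr_summand fun pq => ?_
  rw [pairing_eq_tsum
    (fun n => ((hΦ.isTrig_waves (n + 1 + 1)).annihilate (pq.1 + k)).annihilate (pq.2 - k))
    (fun n => ((hΨ.isTrig_waves (n + 1 + 1)).annihilate pq.1).annihilate pq.2),
    tsum_eq_sum (s := Finset.range N)]
  · refine Finset.sum_congr rfl fun n _ => ?_
    rw [← tsum_mul_left]
    congr 1
    ext K
    have h2 : snocSnocEquiv n (pq, K) = Fin.snoc (α := fun _ => Mom)
        (Fin.snoc (α := fun _ => Mom) K pq.2 : Fin (n + 1) → Mom) pq.1 := rfl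
    rw [conj_sqrt_mul_sqrt, conj_sqrt_mul_sqrt, h2, snoc_add_transfer]
    push_cast
    ring
  · intro n hn
    rw [Finset.mem_range, not_lt] at hn
    rw [hN (n + 1 + 1) (by omega)]
    simp only [coeff_zero, mul_zero, tsum_zero]

theorem pairing_centredNumber (lam : ℝ) (Φ : Fock) {Ψ : Fock} {N : ℕ}
    (hN : ∀ n, N ≤ n → Ψ n = 0) :
    pairing (centredNumber lam (waves Φ)) (centredNumber lam (waves Ψ)) =
      ∑ n ∈ Finset.range N, (((n : ℝ) - freeNumber lam : ℝ) : ℂ) ^ 2 * inner ℂ (Φ n) (Ψ n) := by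
  have h1 : ∀ n, ∫ X : Conf n, conj (centredNumber lam (waves Φ) n X) *
      centredNumber lam (waves Ψ) n X =
      (((n : ℝ) - freeNumber lam : ℝ) : ℂ) ^ 2 * inner ℂ (Φ n) (Ψ n) := by
    intro n
    rw [inner_eq_integral, ← integral_const_mul]
    congr 1
    ext X
    rw [centredNumber, centredNumber, map_mul, Complex.conj_ofReal, waves, waves]
    ring
  simp only [pairing, h1]
  refine tsum_eq_sum fun n hn => ?_
  rw [Finset.mem_range, not_lt] at hn
  have h2 : inner ℂ (Φ n) (0 : Sector n) = 0 := inner_zero_right _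
  rw [hN n hn, h2, mul_zero]

theorem besselCoeff_zero (β : ℝ) : besselCoeff β 0 = 1 := by
  simp [besselCoeff, normSq]

theorem hasSum_ne {f : Mom → ℂ} {a : ℂ} (h : HasSum f a) :
    HasSum (fun k : {k : Mom // k ≠ 0} => f k) (a - f 0) := by
  have h1 := h.update 0 0
  have h2 : HasSum (Set.indicator {k : Mom | k ≠ 0} f) (a - f 0) := by
    have h3 : Set.indicator {k : Mom | k ≠ 0} f = Function.update f 0 0 := by
      funext k
      by_cases hk : k = 0
      · subst hk; simp
      · simp [hk]
    rw [h3, sub_eq_neg_add, ← zero_sub]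
    exact h1
  exact (hasSum_subtype_iff_indicator (s := {k : Mom | k ≠ 0})).2 h2

/-- The total interaction energy in terms of the Fourier coefficients of the potential. -/
theorem hasSum_total_interaction {β : ℝ} (hβ : 1 < β) {n : ℕ} {φ ψ : Sector (n + 2)}
    (hφ : {K | coeff φ K ≠ 0}.Finite) (hψ : {K | coeff ψ K ≠ 0}.Finite) :
    HasSum (fun k => (besselCoeff β k : ℂ) *
        (((n : ℂ) + 1) * ((n : ℂ) + 2) * correlation φ ψ (transfer n k)))
      (2 * ((2 * Real.pi : ℝ) : ℂ) ^ 2 * interactionForm β φ ψ) := by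
  have h1 := (hasSum_sum fun p hp => hasSum_interaction hβ hφ hψ (ne_of_mem_pairs hp)).mul_left
    (2 * ((2 * Real.pi : ℝ) : ℂ) ^ 2)
  refine h1.congr_summand fun k => ?_
  have h2 : ((pairs (n + 2)).card : ℂ) = (((pairs (n + 2)).card : ℝ) : ℂ) := by push_cast; rfl
  -- All pairs give the same term and there are (n+1)(n+2)/2 of them, so the prefactor 2(2π)² leaves
  -- (n+1)(n+2).
  rw [Finset.sum_const, nsmul_eq_mul, h2, card_pairs]
  have h3 := two_pi_complex_ne_zero
  push_cast at h3 ⊢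
  field_simp
  ring

/-- Annihilation lowers the particle number by one in the kinetic term and by two in the
interaction. The skipped terms vanish: no kinetic energy for n = 0, no pairs for n ≤ 1, and n² - n =
0 there. -/
theorem sum_range_shift {kin ip pot w : ℕ → ℂ} {lam a c : ℂ} (hk : kin 0 = 0) (hp0 : pot 0 = 0)
    (hp1 : pot 1 = 0) (ha : a * c = lam ^ 2) (N : ℕ) :
    ∑ n ∈ Finset.range (N + 2), (lam * (kin n + n * ip n) +
      ((lam ^ 2 * pot n - a * ((n : ℂ) ^ 2 - n) * ip n) + a * (w n * ip n))) =
    lam * ∑ n ∈ Finset.range (N + 1), (kin (n + 1) + ((n : ℂ) + 1) * ip (n + 1)) +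
      a * (∑ n ∈ Finset.range N, c * pot (n + 2) -
        ∑ n ∈ Finset.range N, ((n : ℂ) + 1) * ((n : ℂ) + 2) * ip (n + 2)) +
      a * ∑ n ∈ Finset.range (N + 2), w n * ip n := by
  rw [Finset.sum_add_distrib, Finset.sum_add_distrib, ← add_assoc, ← Finset.mul_sum,
    ← Finset.mul_sum]
  congr 2
  · rw [Finset.sum_range_succ', hk]
    push_cast
    rw [zero_mul, add_zero, add_zero]
  · rw [Finset.sum_range_succ', Finset.sum_range_succ', ← Finset.sum_sub_distrib, Finset.mul_sum,
      hp0, zero_add, hp1, ← sub_eq_zero]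
    have h : ∀ n : ℕ, a * (c * pot (n + 2) - ((n : ℂ) + 1) * ((n : ℂ) + 2) * ip (n + 2)) =
        lam ^ 2 * pot (n + 1 + 1) - a * (((n + 1 + 1 : ℕ) : ℂ) ^ 2 - (n + 1 + 1 : ℕ)) *
          ip (n + 1 + 1) := by
      intro n
      push_cast
      linear_combination pot (n + 2) * ha
    simp only [h]
    push_cast
    ring

theorem tsum_sectorForm_eq_formalHamiltonian {β lam : ℝ} (hβ : 1 < β) {Φ Ψ : Fock}
    (hΦ : IsFinite Φ) (hΨ : IsFinite Ψ) :
    ∑' n, sectorForm β lam (Φ n) (Ψ n) = formalHamiltonian β lam (waves Φ) (waves Ψ) := by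
  obtain ⟨N, hN⟩ := hΨ.exists_bound
  have h2 : HasSum (fun k => (besselCoeff β k : ℂ) * ∑ n ∈ Finset.range N,
      ((n : ℂ) + 1) * ((n : ℂ) + 2) * correlation (Φ (n + 2)) (Ψ (n + 2)) (transfer n k))
      (∑ n ∈ Finset.range N,
        2 * ((2 * Real.pi : ℝ) : ℂ) ^ 2 * interactionForm β (Φ (n + 2)) (Ψ (n + 2))) :=
    (hasSum_sum fun n _ => hasSum_total_interaction hβ (hΦ.2 (n + 2)) (hΨ.2 (n + 2))).congr_summand
      fun k => Finset.mul_sum _ _ _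
  -- Dropping k = 0 subtracts the correlation at zero transfer, an inner product with weight
  -- (n+1)(n+2), i.e. m² - m for m = n + 2 particles.
  have h3 := (hasSum_ne h2).tsum_eq
  have h4 : ∀ n, correlation (Φ (n + 2)) (Ψ (n + 2)) (transfer n 0) =
      inner ℂ (Φ (n + 2)) (Ψ (n + 2)) := by
    intro n
    rw [transfer, Pi.single_zero, Pi.single_zero, sub_zero, correlation_zero]
  rw [besselCoeff_zero, Complex.ofReal_one, one_mul] at h3
  simp only [h4] at h3
  have hsum : ∑' n, sectorForm β lam (Φ n) (Ψ n) =
      ∑ n ∈ Finset.range (N + 2), sectorForm β lam (Φ n) (Ψ n) := by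
    refine tsum_eq_sum fun n hn => ?_
    rw [Finset.mem_range, not_lt] at hn
    rw [hN n (by omega), sectorForm_zero_right]
  rw [formalHamiltonian, (hasSum_pairing_annihilate hΦ hΨ hN).tsum_eq,
    pairing_centredNumber lam Φ (N := N + 2) fun n hn => hN n (by omega)]
  simp only [(hasSum_pairing_annihilate_annihilate hΦ hΨ hN _).tsum_eq]
  rw [h3, hsum]
  simp only [sectorForm_eq]
  refine sum_range_shift (kin := fun n => kineticForm (Φ n) (Ψ n))
    (pot := fun n => interactionForm β (Φ n) (Ψ n)) (ip := fun n => inner ℂ (Φ n) (Ψ n))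
    (kineticForm_sector_zero _ _) (interactionForm_of_le_one β zero_le_one _ _)
    (interactionForm_of_le_one β le_rfl _ _) ?_ N
  have h5 := two_pi_complex_ne_zero
  push_cast at h5 ⊢
  field_simp

end FormalHamiltonian

/-! ### The Hamiltonian acts on finite vectors as the formal expression -/

section Realization

theorem exists_mem_domain_of_isFinite {β lam : ℝ} (hβ : 1 < β)
    {Hn : ∀ n, Sector n →ₗ.[ℂ] Sector n} {H : Fock →ₗ.[ℂ] Fock}
    (hHn : ∀ n, IsFormOperator (InFormDomain β) (sectorForm β lam) (Hn n))
    (hH : IsDirectSum Hn H) {Ψ : Fock} (hΨ : IsFinite Ψ) :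
    ∃ h : Ψ ∈ H.domain, ∀ Φ : Fock, IsFinite Φ →
      inner ℂ Φ (H ⟨Ψ, h⟩) = formalHamiltonian β lam (waves Φ) (waves Ψ) := by
  -- The image is chosen to be zero wherever `Ψ n` is zero, so only finitely many components remain
  -- and the sequence lies in Fock space.
  have hex : ∀ n, ∃ χ : Sector n, (∀ φ, sectorForm β lam φ (Ψ n) = inner ℂ φ χ) ∧
      (Ψ n = 0 → χ = 0) := by
    intro n
    by_cases h0 : Ψ n = 0
    · refine ⟨0, fun φ => ?_, fun _ => rfl⟩
      have h1 : inner ℂ φ (0 : Sector n) = 0 := inner_zero_right _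
      rw [h0, sectorForm_zero_right, h1]
    · obtain ⟨χ, hχ⟩ := exists_sectorForm_eq_inner (β := β) (lam := lam) (hΨ.2 n)
      exact ⟨χ, hχ, fun h => absurd h h0⟩
  choose χ hχ hχ0 using hex
  have hmem : Memℓp χ 2 := by
    refine memℓp_gen (summable_of_ne_finset_zero (s := hΨ.1.toFinset) fun n hn => ?_)
    have h1 : χ n = 0 := hχ0 n (by simpa using hn)
    rw [h1]
    have h2 : ‖(0 : Sector n)‖ = 0 := norm_zero
    rw [h2, Real.zero_rpow (by norm_num)]
  have hgraph : (Ψ, (⟨χ, hmem⟩ : Fock)) ∈ H.graph :=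
    (hH _ _).2 fun n => (hHn n _ _).2 ⟨inFormDomain_of_finite (hΨ.2 n), fun φ _ => hχ n φ⟩
  have hdom := LinearPMap.mem_domain_of_mem_graph hgraph
  refine ⟨hdom, fun Φ hΦ => ?_⟩
  have hval : H ⟨Ψ, hdom⟩ = (⟨χ, hmem⟩ : Fock) :=
    LinearPMap.mem_graph_snd_inj H (H.mem_graph ⟨Ψ, hdom⟩) hgraph rfl
  rw [hval, ← tsum_sectorForm_eq_formalHamiltonian hβ hΦ hΨ, lp.inner_eq_tsum]
  congr 1
  ext n
  exact (hχ n (Φ n)).symm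

end Realization

end BesselGas

end

theorem mainTheorem8 (β : ℝ) (hβ₁ : 3 / 2 < β) (hβ₂ : β ≤ 2) (lam : ℝ) (hlam : 0 < lam) :
    ∃ (Hn : ∀ n, BesselGas.Sector n →ₗ.[ℂ] BesselGas.Sector n)
      (H : BesselGas.Fock →ₗ.[ℂ] BesselGas.Fock),
      (∀ n, BesselGas.IsFormOperator (BesselGas.InFormDomain β)
          (BesselGas.sectorForm β lam) (Hn n) ∧ IsSelfAdjoint (Hn n)) ∧
      BesselGas.IsDirectSum Hn H ∧
      IsSelfAdjoint H ∧
      (∀ Ψ : BesselGas.Fock, BesselGas.IsFinite Ψ → ∃ hΨ : Ψ ∈ H.domain,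
        ∀ Φ : BesselGas.Fock, BesselGas.IsFinite Φ →
          inner ℂ Φ (H ⟨Ψ, hΨ⟩) =
            BesselGas.formalHamiltonian β lam (BesselGas.waves Φ) (BesselGas.waves Ψ)) ∧
      BesselGas.IsBoundedBelow H ∧
      ∃ S : BesselGas.Fock →L[ℂ] BesselGas.Fock,
        BesselGas.IsExpNeg H S ∧
        BesselGas.IsTraceClass S ∧
        ∃ Z : ℝ, 0 < Z ∧ BesselGas.HasTrace S (Z : ℂ) ∧
          BesselGas.IsState (((Z : ℂ)⁻¹) • S) := by
  have hβ : 1 < β := by linarith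
  obtain ⟨Hn, H, h1, h2, h3, h4, h5⟩ := BesselGas.exists_hamiltonian hβ hlam
  exact ⟨Hn, H, h1, h2, h3,
    fun Ψ hΨ => BesselGas.exists_mem_domain_of_isFinite hβ (fun n => (h1 n).1) h2 hΨ, h4, h5⟩
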